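/- **Theorem 3.2.** Let $q\in\mathbb C$ with $0<|q|<1$. Write $(a;q)_n=\prod_{k=0}^{n-1}(1-aq^k)$, $(a;q)_\infty=\prod_{k\ge0}(1-aq^k)$, $(c_1,\dots,c_m;q)_\infty=\prod_i(c_i;q)_\infty$, $\theta(x)=\sum_{n\in\mathbb Z}q^{n(n-1)/2}x^n$ for $x\in\mathbb C^*$, $[\mu;q]=\mu q^{\mathbb Z}$, and $${}_r\varphi_s(a_1,\dots,a_r;b_1,\dots,b_s;q,x)=\sum_{n\ge0}\frac{(a_1;q)_n\cdots(a_r;q)_n}{(b_1;q)_n\cdots(b_s;q)_n(q;q)_n}\left\{(-1)^nq^{n(n-1)/2}\right\}^{1+s-r}x^n .$$ Let $a_1,a_2,a_3,b_1\in\mathbb C^*$ with $a_i/a_j\notin q^{\mathbb Z}$ for $i\ne j$ and $b_1\notin\{q^{-k}:k\ge 0\}$, and let $\lambda\in\mathbb C^*\setminus[-1;q]$. The $q$-Borel transform of a formal power series $f=\sum_{n\ge0} c_nx^n$ is $\mathcal B_q^+f=\sum_{n\ge0} c_nq^{n(n-1)/2}\xi^n$. The $q$-Borel transform of the formal series ${}_3\varphi_1(a_1,a_2,a_3;b_1;q,x)$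 converges near $\xi=0$ and continues to a single-valued analytic function $\varphi$ on $\mathbb C\setminus\{-q^{-k}:k\ge0\}$. For $x\in\mathbb C^*\setminus[-\lambda;q]$ the series $${}_3f_1(x):=\left(\mathcal L^+_{q,\lambda}\circ\mathcal B_q^+\,{}_3\varphi_1(a_1,a_2,a_3;b_1;q,\cdot)\right)(x)=\sum_{n\in\mathbb Z}\frac{\varphi(\lambda q^n)}{\theta(\lambda q^n/x)}$$ converges absolutely, and ${}_3f_1$ is analytic on $\mathbb C^*\setminus[-\lambda;q]$. For $\{j,k,l\}=\{1,2,3\}$ put $$v_j(x)=\frac{\theta(a_jx)}{\theta(x)}\,{}_3\varphi_2\left(a_j,\frac{a_jq}{b_1},0;\frac{a_jq}{a_k},\frac{a_jq}{a_l};q,\frac{qb_1}{a_1a_2a_3x}\right),$$ $$C_j(x)=\frac{(a_k,a_l,b_1/a_j;q)_\infty}{(b_1,a_k/a_j,a_l/a_j;q)_\infty}\,\frac{\theta(a_j\lambda)}{\theta(\lambda)}\,\frac{\theta(a_jqx/\lambda)}{\theta(qx/\lambda)}\,\frac{\theta(x)}{\theta(a_jx)},$$ where ${}_3\varphi_2(\dots;q,z)$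 denotes the sum of the series near $z=0$ together with its single-valued analytic continuation to $\mathbb C\setminus\{q^{-k}:k\ge0\}$, which exists. Then $${}_3f_1(x)=C_1(x)v_1(x)+C_2(x)v_2(x)+C_3(x)v_3(x)$$ for every $x\in\mathbb C^*\setminus[-\lambda;q]$ at which all factors on the right are defined, that is, $\theta(x)\ne0$, $\theta(a_jx)\neq0$ for $j=1,2,3$, and $x\ne q^{k+1}b_1/(a_1a_2a_3)$ for all integers $k\ge0$. (As ${}_3f_1$ is analytic on $\mathbb C^*\setminus[-\lambda;q]$, the singularities of the right-hand side at the remaining points of this set are removable, and the formula holds there by continuation.) Moreover $v_1,v_2,v_3$ are solutions of the equation $$\left(a_1a_2a_3x-\tfrac{b_1}{q^2}\right)u(q^3x)-\left\{(a_1a_2+a_2a_3+a_3a_1)x-\left(\tfrac{b_1}{q^2}+\tfrac1q\right)\right\}u(q^2x)+\left\{(a_1+a_2+a_3)x-\tfrac1q\right\}u(qx)-xu(x)=0$$ at every $x\in\mathbb C^*$ with $\theta(x)\neq0$ such that none of $x$, $q^3x$ is of the form $q^{k+1}b_1/(a_1a_2a_3)$ with $k\ge0$. The coefficients $C_1,C_2,C_3$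 are $q$-elliptic: they are meromorphic on $\mathbb C^*$ and satisfy $C_j(qx)=C_j(x)$. -/

import Mathlib

open Filter Topology

noncomputable section

/-- The `q`-shifted factorial `(a;q)_n = (1-a)(1-aq)⋯(1-aq^{n-1})`. -/
def qPoch (q a : ℂ) (n : ℕ) : ℂ := ∏ k ∈ Finset.range n, (1 - a * q ^ k)

/-- `(a;q)_∞ = ∏_{k ≥ 0} (1 - a q^k)` (convergent for `|q| < 1`). -/
def qPochInf (q a : ℂ) : ℂ := ∏' k : ℕ, (1 - a * q ^ k)

/-- The theta function of Jacobi `θ_q(x) = ∑_{n ∈ ℤ} q^{n(n-1)/2} x^n`. -/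
def qTheta (q x : ℂ) : ℂ := ∑' n : ℤ, q ^ (n * (n - 1) / 2) * x ^ n

/-- The spiral `[μ;q] = μ q^ℤ`. -/
def qSpiral (q μ : ℂ) : Set ℂ := {x | ∃ k : ℤ, x = μ * q ^ k}

/-- The basic hypergeometric series `_rφ_s(a_1,…,a_r; b_1,…,b_s; q, x)`, as a formal power series
in `x`. -/
def qHypSeries (q : ℂ) (as bs : List ℂ) : PowerSeries ℂ :=
  PowerSeries.mk fun n =>
    (as.map fun a => qPoch q a n).prod / ((bs.map fun b => qPoch q b n).prod * qPoch q q n) *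
      ((-1) ^ n * q ^ (n * (n - 1) / 2)) ^ (1 + (bs.length : ℤ) - (as.length : ℤ))

/-- `F` is, on `U`, a (single-valued) analytic continuation of the power series `f`: it is analytic
on `U`, and near `0` it is the sum of the series. -/
structure IsContinuation (f : PowerSeries ℂ) (U : Set ℂ) (F : ℂ → ℂ) : Prop where
  analytic : AnalyticOnNhd ℂ F U
  hasSum : ∀ᶠ z in 𝓝 (0 : ℂ), HasSum (fun n : ℕ => PowerSeries.coeff n f * z ^ n) (F z)

/-- On a connected set containing `0` there is at most one analytic continuation. -/
theorem IsContinuation.eqOn {f : PowerSeries ℂ} {U : Set ℂ} {F G : ℂ → ℂ}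
    (hF : IsContinuation f U F) (hG : IsContinuation f U G)
    (hU : IsPreconnected U) (h0 : (0 : ℂ) ∈ U) : Set.EqOn F G U := by
  refine hF.analytic.eqOn_of_preconnected_of_eventuallyEq hG.analytic hU h0 ?_
  filter_upwards [hF.hasSum, hG.hasSum] with z h1 h2
  exact h1.unique h2

open Classical in
/-- The analytic continuation to `U` of the power series `f` (the zero function if there is
none). Only its values on `U` are meaningful. -/
def continuation (f : PowerSeries ℂ) (U : Set ℂ) : ℂ → ℂ :=
  if h : ∃ F, IsContinuation f U F then h.choose else 0

/-- The plane without the points `c q^{-k}`, `k = 0, 1, 2, …`. -/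
def qSlitPlane (q c : ℂ) : Set ℂ := {z | ∀ k : ℕ, z * q ^ k ≠ c}

/-- The `q`-Borel transformation `∑ a_n x^n ↦ ∑ a_n q^{n(n-1)/2} ξ^n`. -/
def qBorel (q : ℂ) (f : PowerSeries ℂ) : PowerSeries ℂ :=
  PowerSeries.mk fun n => PowerSeries.coeff n f * q ^ (n * (n - 1) / 2)

/-- The terms of the bilateral sum which defines the `q`-Laplace transform. -/
def qLaplaceTerm (q lam : ℂ) (φ : ℂ → ℂ) (x : ℂ) (n : ℤ) : ℂ :=
  φ (lam * q ^ n) / qTheta q (lam * q ^ n / x)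

/-- The `q`-Laplace transformation
`(ℒ⁺_{q,λ} φ)(x) = ∑_{n ∈ ℤ} φ(λ q^n) / θ_q(λ q^n / x)`. -/
def qLaplace (q lam : ℂ) (φ : ℂ → ℂ) (x : ℂ) : ℂ := ∑' n : ℤ, qLaplaceTerm q lam φ x n

/-- The `q`-Borel transform of `₃φ₁(a₁,a₂,a₃;b₁;q,x)`, as a power series. -/
def borel31 (q a₁ a₂ a₃ b₁ : ℂ) : PowerSeries ℂ := qBorel q (qHypSeries q [a₁, a₂, a₃] [b₁])

/-- The function defined by `borel31`, continued to the plane without `-q^{-k}`, `k ≥ 0`. -/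
def borel31Fun (q a₁ a₂ a₃ b₁ : ℂ) : ℂ → ℂ :=
  continuation (borel31 q a₁ a₂ a₃ b₁) (qSlitPlane q (-1))

/-- The `q`-Borel–Laplace transform `₃f₁(a₁,a₂,a₃;b₁;q;λ,x)` of `₃φ₁(a₁,a₂,a₃;b₁;q,x)`. -/
def f31 (q a₁ a₂ a₃ b₁ lam x : ℂ) : ℂ := qLaplace q lam (borel31Fun q a₁ a₂ a₃ b₁) x

/-- The series `₃φ₂(a, aq/b₁, 0; aq/a', aq/a''; q, z)`. -/
def series32 (q a a' a'' b₁ : ℂ) : PowerSeries ℂ :=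
  qHypSeries q [a, a * q / b₁, 0] [a * q / a', a * q / a'']

/-- The function `₃φ₂(a, aq/b₁, 0; aq/a', aq/a''; q, z)`: the sum of the series for `|z| < 1`,
continued to the plane without `q^{-k}`, `k ≥ 0`. -/
def phi32 (q a a' a'' b₁ : ℂ) : ℂ → ℂ :=
  continuation (series32 q a a' a'' b₁) (qSlitPlane q 1)

/-- The solution at infinity
`v(x) = θ(ax)/θ(x) · ₃φ₂(a, aq/b₁, 0; aq/a', aq/a''; q, q b₁/(a a' a'' x))`. -/
def vInf (q a a' a'' b₁ x : ℂ) : ℂ :=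
  qTheta q (a * x) / qTheta q x * phi32 q a a' a'' b₁ (q * b₁ / (a * a' * a'' * x))

/-- The connection coefficient
`(a',a'',b₁/a;q)_∞/(b₁,a'/a,a''/a;q)_∞ · θ(aλ)/θ(λ) · θ(aqx/λ)/θ(qx/λ) · θ(x)/θ(ax)`. -/
def connCoeff (q a a' a'' b₁ lam x : ℂ) : ℂ :=
  (qPochInf q a' * qPochInf q a'' * qPochInf q (b₁ / a)) /
      (qPochInf q b₁ * qPochInf q (a' / a) * qPochInf q (a'' / a)) *
    (qTheta q (a * lam) / qTheta q lam) *
    (qTheta q (a * q * x / lam) / qTheta q (q * x / lam)) *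
    (qTheta q x / qTheta q (a * x))

/-- A `q`-elliptic function: a (single-valued) meromorphic function on `ℂ*` invariant under
`x ↦ qx`. -/
structure IsQElliptic (q : ℂ) (f : ℂ → ℂ) : Prop where
  meromorphic : MeromorphicOn f {0}ᶜ
  periodic : ∀ x : ℂ, x ≠ 0 → f (q * x) = f x

/-- The left-hand side at `x` of the third order linear `q`-difference equation satisfied by the
formal series `₃φ₁(a₁,a₂,a₃;b₁;q,x)`. -/
def thirdOrderOp (q a₁ a₂ a₃ b₁ : ℂ) (u : ℂ → ℂ) (x : ℂ) : ℂ :=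
  (a₁ * a₂ * a₃ * x - b₁ / q ^ 2) * u (q ^ 3 * x)
    - ((a₁ * a₂ + a₂ * a₃ + a₃ * a₁) * x - (b₁ / q ^ 2 + 1 / q)) * u (q ^ 2 * x)
    + ((a₁ + a₂ + a₃) * x - 1 / q) * u (q * x) - x * u x

/-- The points of `ℂ*` at which `θ(ax)/θ(x)` and `₃φ₂(…; q, q b₁/(a₁a₂a₃x))` are regular: those
with `θ(x) ≠ 0` and `x ≠ q^{k+1} b₁/(a₁a₂a₃)` for `k = 0, 1, 2, …`. -/
def regularPts (q a₁ a₂ a₃ b₁ : ℂ) : Set ℂ :=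
  {x | x ≠ 0 ∧ qTheta q x ≠ 0 ∧ q * b₁ / (a₁ * a₂ * a₃ * x) ∈ qSlitPlane q 1}

end

/-! By `coeff_borel31` the Gaussian factors cancel in the Borel transform, so `φ(ξ)` is
`₃φ₂(a₁,a₂,a₃;b₁,0;q,-ξ)`, and the heart of the matter is to connect this function from `0` to `∞`.

Up to a constant, its `n`-th coefficient is `R(q^n)` with `R(t) = (b₁t, qt;q)_∞ / (a₁t, a₂t,
a₃t;q)_∞`. Since `R(q^n) = 0` for `n < 0`, the power series is a bilateral sum (`hasSum_bilateral`).
The function `R` is the sum of its partial fractions over the simple poles `t = 1/(a_j q^m)`, and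
the residues carry a factor `q^{m(m+1)/2}` (`qPochInf_div_eq_tsum`). Summing over `n` first leaves
Kronecker's sum `∑ z^n/(1 - aq^n) = (q;q)_∞^3 θ(-az) / (θ(-a) θ(-z))` (`lerch_mul_qTheta`,
`lerchCoeff_zero_mul_qTheta`). The outcome is `borel31Fun_connection`: `φ(ξ)θ(ξ)` is a sum of three
terms, each a constant times `θ(a_jξ)` times an entire function of `1/ξ`. The coefficients of that
entire function are those of the `₃φ₂` in `v_j`, times `q^{m(m+1)/2}` and a geometric factor.

On the spiral `ξ = λq^n` the quotient `θ(a_jξ)/θ(ξ)` is a constant times `a_j^{-n}`, while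
`1/θ(λq^n/x)` is `q^{n(n-1)/2}(λ/x)^n/θ(λ/x)`. The two Gaussian factors combine into the one of
index `n - m`, so the double sum over `n` and `m` factors as a theta function times the `₃φ₂` in
`v_j` (`hasSum_spiral_laurent`). This proves the formula for large `|x|`, and the identity theorem
carries it to the rest of the domain (`f31_eq_connTerm`).

The `q`-difference equation of `v_j` is that of its `₃φ₂` read in the variable `1/x`, with the theta
quotient supplying powers of `a_j`. Ellipticity of `C_j` is the quasi-periodicity of `θ`. -/

/-! ### Infinite `q`-products: convergence, zeros, analyticity, bounds. -/

theorem summable_norm_mul_pow {q : ℂ} (hq : ‖q‖ < 1) (a : ℂ) :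
    Summable fun k : ℕ => ‖-(a * q ^ k)‖ := by
  simpa using (summable_geometric_of_lt_one (norm_nonneg q) hq).mul_left ‖a‖

theorem tendsto_qPoch {q : ℂ} (hq : ‖q‖ < 1) (a : ℂ) :
    Tendsto (qPoch q a) atTop (𝓝 (qPochInf q a)) := by
  have h := (multipliable_one_add_of_summable (summable_norm_mul_pow hq a)).hasProd.tendsto_prod_nat
  simp only [← sub_eq_add_neg] at h
  exact h

theorem qPoch_succ (q a : ℂ) (n : ℕ) : qPoch q a (n + 1) = qPoch q a n * (1 - a * q ^ n) := by
  simp [qPoch, Finset.prod_range_succ]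

theorem qPoch_zero_left (q : ℂ) (n : ℕ) : qPoch q 0 n = 1 := by simp [qPoch]

theorem qPoch_add (q a : ℂ) (m n : ℕ) :
    qPoch q a (m + n) = qPoch q a m * qPoch q (a * q ^ m) n := by
  simp only [qPoch, Finset.prod_range_add]
  congr 1
  exact Finset.prod_congr rfl fun k _ => by ring

theorem qPoch_ne_zero {q a : ℂ} (h : ∀ k : ℕ, a * q ^ k ≠ 1) (n : ℕ) : qPoch q a n ≠ 0 :=
  Finset.prod_ne_zero_iff.2 fun k _ => sub_ne_zero.2 (h k).symm

theorem qPochInf_ne_zero {q a : ℂ} (hq : ‖q‖ < 1) (h : ∀ k : ℕ, a * q ^ k ≠ 1) :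
    qPochInf q a ≠ 0 := by
  have := tprod_one_add_ne_zero_of_summable (f := fun k : ℕ => -(a * q ^ k))
    (fun k => by rw [← sub_eq_add_neg]; exact sub_ne_zero.2 (h k).symm) (summable_norm_mul_pow hq a)
  simp only [← sub_eq_add_neg] at this
  exact this

theorem qPochInf_eq_qPoch_mul {q : ℂ} (hq : ‖q‖ < 1) (a : ℂ) (m : ℕ) :
    qPochInf q a = qPoch q a m * qPochInf q (a * q ^ m) := by
  have h1 := (tendsto_qPoch hq (a * q ^ m)).const_mul (qPoch q a m)
  have h2 := (tendsto_add_atTop_iff_nat m).2 (tendsto_qPoch hq a)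
  refine tendsto_nhds_unique h2 (h1.congr fun n => ?_)
  rw [add_comm n m, qPoch_add]

theorem qPochInf_eq_zero_iff {q a : ℂ} (hq : ‖q‖ < 1) :
    qPochInf q a = 0 ↔ ∃ k : ℕ, a * q ^ k = 1 := by
  constructor
  · intro h
    by_contra! hc
    exact qPochInf_ne_zero hq hc h
  · rintro ⟨k, hk⟩
    rw [qPochInf_eq_qPoch_mul hq a (k + 1), qPoch_succ, hk]
    simp

theorem qPochInf_eq_one_sub_mul {q : ℂ} (hq : ‖q‖ < 1) (a : ℂ) :
    qPochInf q a = (1 - a) * qPochInf q (a * q) := by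
  simpa [qPoch] using qPochInf_eq_qPoch_mul hq a 1

theorem differentiable_qPochInf {q : ℂ} (hq : ‖q‖ < 1) : Differentiable ℂ (qPochInf q) := by
  intro a
  have hu : Summable fun k : ℕ => (‖a‖ + 1) * ‖q‖ ^ k :=
    (summable_geometric_of_lt_one (norm_nonneg q) hq).mul_left _
  have hO : IsOpen (Metric.ball (0 : ℂ) (‖a‖ + 1)) := Metric.isOpen_ball
  have h := Summable.hasProdLocallyUniformlyOn_nat_one_add (f := fun (k : ℕ) (x : ℂ) => -(x * q ^ k))
    hO hu (Eventually.of_forall fun k x hx => by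
      have : ‖x‖ ≤ ‖a‖ + 1 := by simpa using (mem_ball_zero_iff.1 hx).le
      simpa using mul_le_mul_of_nonneg_right this (by positivity)) (fun k => by fun_prop)
  have hd : DifferentiableOn ℂ (fun x => ∏' k : ℕ, (1 + -(x * q ^ k)))
      (Metric.ball (0 : ℂ) (‖a‖ + 1)) :=
    TendstoLocallyUniformlyOn.differentiableOn h
      (.of_forall fun _ ↦ by simpa [Finset.prod_fn] using
        DifferentiableOn.finsetProd (fun _ _ ↦ by fun_prop)) hO
  have := hd.differentiableAt (hO.mem_nhds (by simp : a ∈ _))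
  simpa only [← sub_eq_add_neg] using! this

theorem continuous_qPochInf {q : ℂ} (hq : ‖q‖ < 1) : Continuous (qPochInf q) :=
  (differentiable_qPochInf hq).continuous

theorem norm_qPoch_le {q a : ℂ} {R : ℝ} (hq : ‖q‖ < 1) (ha : ‖a‖ ≤ R) (n : ℕ) :
    ‖qPoch q a n‖ ≤ Real.exp (R * (1 - ‖q‖)⁻¹) := by
  have hR : 0 ≤ R := (norm_nonneg a).trans ha
  have hs := (summable_geometric_of_lt_one (norm_nonneg q) hq).mul_left R
  calc ‖qPoch q a n‖ = ∏ k ∈ Finset.range n, ‖1 - a * q ^ k‖ := by rw [qPoch, norm_prod]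
    _ ≤ ∏ k ∈ Finset.range n, Real.exp (R * ‖q‖ ^ k) := by
        refine Finset.prod_le_prod (fun _ _ => norm_nonneg _) fun k _ => ?_
        calc ‖1 - a * q ^ k‖ ≤ ‖(1 : ℂ)‖ + ‖a * q ^ k‖ := norm_sub_le _ _
          _ ≤ R * ‖q‖ ^ k + 1 := by
            rw [norm_one, norm_mul, norm_pow, add_comm]
            gcongr
          _ ≤ _ := Real.add_one_le_exp _
    _ = Real.exp (∑ k ∈ Finset.range n, R * ‖q‖ ^ k) := (Real.exp_sum _ _).symm
    _ ≤ _ := by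
        rw [← tsum_geometric_of_lt_one (norm_nonneg q) hq, ← tsum_mul_left]
        exact Real.exp_le_exp.2 (hs.sum_le_tsum _ fun k _ => by positivity)

theorem exists_norm_le_of_tendsto {u : ℕ → ℂ} {l : ℂ} (h : Tendsto u atTop (𝓝 l)) :
    ∃ C : ℝ, 0 < C ∧ ∀ n, ‖u n‖ ≤ C := by
  obtain ⟨C, hC⟩ := h.norm.bddAbove_range
  exact ⟨max C 1, by positivity, fun n => (hC ⟨n, rfl⟩).trans (le_max_left _ _)⟩

theorem exists_norm_qPoch_le {q : ℂ} (hq : ‖q‖ < 1) (a : ℂ) :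
    ∃ C : ℝ, 0 < C ∧ ∀ n, ‖qPoch q a n‖ ≤ C :=
  exists_norm_le_of_tendsto (tendsto_qPoch hq a)

theorem exists_norm_inv_qPoch_le {q a : ℂ} (hq : ‖q‖ < 1) (h : ∀ k : ℕ, a * q ^ k ≠ 1) :
    ∃ C : ℝ, 0 < C ∧ ∀ n, ‖(qPoch q a n)⁻¹‖ ≤ C :=
  exists_norm_le_of_tendsto ((tendsto_qPoch hq a).inv₀ (qPochInf_ne_zero hq h))

theorem self_mul_pow_ne_one {q : ℂ} (hq : ‖q‖ < 1) (k : ℕ) : q * q ^ k ≠ 1 := by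
  intro h
  have := congrArg norm h
  rw [← pow_succ', norm_pow, norm_one] at this
  exact (pow_lt_one₀ (norm_nonneg q) hq (Nat.succ_ne_zero k)).ne this

/-! ### Gaussian weights and the theta series. -/

/-- The Gaussian factor `q^{n(n-1)/2}`. -/
noncomputable def gaussPow (q : ℂ) (n : ℤ) : ℂ := q ^ (n * (n - 1) / 2)

theorem gaussPow_add {q : ℂ} (hq0 : q ≠ 0) (m n : ℤ) :
    gaussPow q (m + n) = gaussPow q m * gaussPow q n * q ^ (m * n) := by
  obtain ⟨a, ha⟩ := Int.even_mul_pred_self m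
  obtain ⟨b, hb⟩ := Int.even_mul_pred_self n
  have h : (m + n) * (m + n - 1) = a + b + m * n + (a + b + m * n) := by linear_combination ha + hb
  have e : ∀ c : ℤ, (c + c) / 2 = c := fun c => by omega
  simp only [gaussPow, h, ha, hb, e, zpow_add₀ hq0]

theorem gaussPow_zero (q : ℂ) : gaussPow q 0 = 1 := by simp [gaussPow]

theorem gaussPow_one (q : ℂ) : gaussPow q 1 = 1 := by simp [gaussPow]

theorem gaussPow_ne_zero {q : ℂ} (hq0 : q ≠ 0) (n : ℤ) : gaussPow q n ≠ 0 := zpow_ne_zero _ hq0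

theorem gaussPow_add_one {q : ℂ} (hq0 : q ≠ 0) (n : ℤ) :
    gaussPow q (n + 1) = gaussPow q n * q ^ n := by
  simp [gaussPow_add hq0, gaussPow_one]

theorem gaussPow_one_sub (q : ℂ) (n : ℤ) : gaussPow q (1 - n) = gaussPow q n := by
  rw [gaussPow, gaussPow]; congr 2; ring

theorem gaussPow_neg {q : ℂ} (hq0 : q ≠ 0) (n : ℤ) : gaussPow q (-n) = gaussPow q n * q ^ n := by
  rw [← gaussPow_add_one hq0, ← gaussPow_one_sub]; congr 1; ring

theorem gaussPow_mul_self {q : ℂ} (hq0 : q ≠ 0) (n : ℤ) :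
    gaussPow q n * gaussPow q n * q ^ n = q ^ (n * n) := by
  have h := gaussPow_add hq0 n (-n)
  rw [add_neg_cancel, gaussPow_zero, gaussPow_neg hq0, mul_neg, zpow_neg] at h
  have := zpow_ne_zero (n * n) hq0
  field_simp at h
  linear_combination -h

theorem summable_gaussPow_mul_pow {q : ℂ} (hq0 : q ≠ 0) (hq : ‖q‖ < 1) (y : ℂ) :
    Summable fun n : ℕ => ‖gaussPow q n * y ^ n‖ := by
  rcases eq_or_ne y 0 with rfl | hy
  · refine summable_of_ne_finset_zero (s := {0}) fun n hn => ?_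
    simp [Finset.mem_singleton.not.1 hn]
  refine summable_of_ratio_test_tendsto_lt_one (l := 0) zero_lt_one
    (Eventually.of_forall fun n => ?_) ?_
  · simp [gaussPow_ne_zero hq0, hy]
  · have h : Tendsto (fun n : ℕ => ‖q‖ ^ n * ‖y‖) atTop (𝓝 0) := by
      simpa using (tendsto_pow_atTop_nhds_zero_of_lt_one (norm_nonneg q) hq).mul_const ‖y‖
    refine h.congr fun n => ?_
    have h1 : ‖gaussPow q n‖ ≠ 0 := norm_ne_zero_iff.2 (gaussPow_ne_zero hq0 n)
    have h2 : ‖y‖ ≠ 0 := norm_ne_zero_iff.2 hy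
    push_cast
    rw [norm_norm, norm_norm, gaussPow_add_one hq0]
    simp only [norm_mul, norm_pow, zpow_natCast, pow_succ]
    field_simp

theorem summable_gaussPow_mul_zpow {q : ℂ} (hq0 : q ≠ 0) (hq : ‖q‖ < 1) {u : ℤ → ℂ} {C : ℝ}
    (hC : ∀ n, ‖u n‖ ≤ C) (y z : ℂ) :
    Summable fun n : ℤ => ‖gaussPow q n * u n * (if 0 ≤ n then y else z) ^ n‖ := by
  have key : ∀ n : ℤ, ‖gaussPow q n * u n * (if 0 ≤ n then y else z) ^ n‖ ≤
      C * ‖gaussPow q n * (if 0 ≤ n then y else z) ^ n‖ := fun n => by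
    rw [mul_right_comm, norm_mul _ (u n), mul_comm]
    exact mul_le_mul_of_nonneg_right (hC n) (norm_nonneg _)
  refine Summable.of_nonneg_of_le (fun _ => norm_nonneg _) key (Summable.mul_left C ?_)
  refine Summable.of_nat_of_neg ?_ ?_
  · refine (summable_gaussPow_mul_pow hq0 hq y).congr fun n => ?_
    simp
  · refine (summable_nat_add_iff 1).1 ?_
    refine ((summable_nat_add_iff 1).2 (summable_gaussPow_mul_pow hq0 hq (q * z⁻¹))).congr
      fun n => ?_
    rw [gaussPow_neg hq0, if_neg (by push_cast; omega)]
    rw [mul_pow, zpow_neg, inv_pow, zpow_natCast, zpow_natCast, mul_assoc]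

theorem summable_theta {q : ℂ} (hq0 : q ≠ 0) (hq : ‖q‖ < 1) (x : ℂ) :
    Summable fun n : ℤ => ‖gaussPow q n * x ^ n‖ := by
  simpa using summable_gaussPow_mul_zpow hq0 hq (u := fun _ => 1) (C := 1) (by simp) x x

theorem norm_zpow_le_add {x r R : ℝ} (hr : 0 < r) (h1 : r ≤ x) (h2 : x ≤ R) (n : ℤ) :
    x ^ n ≤ r ^ n + R ^ n := by
  have hx := hr.trans_le h1
  have hR := hx.trans_le h2
  obtain ⟨m, rfl | rfl⟩ := n.eq_nat_or_neg
  · have : x ^ m ≤ R ^ m := by gcongr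
    simp only [zpow_natCast]
    have := pow_pos hr m
    linarith
  · have : (x ^ m)⁻¹ ≤ (r ^ m)⁻¹ := by gcongr
    simp only [zpow_natCast, zpow_neg]
    have := inv_pos.2 (pow_pos hR m)
    linarith

/-- On the annulus `r < |y| < R` each term is dominated by the sum of its norms at `r` and at `R`,
so the Weierstrass test applies with both tails at once. -/
theorem analyticAt_laurent {c : ℤ → ℂ} (h : ∀ x : ℂ, x ≠ 0 → Summable fun n => ‖c n * x ^ n‖)
    {x : ℂ} (hx : x ≠ 0) : AnalyticAt ℂ (fun x => ∑' n, c n * x ^ n) x := by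
  have hx' : 0 < ‖x‖ := norm_pos_iff.2 hx
  set r : ℝ := ‖x‖ / 2
  set R : ℝ := 2 * ‖x‖
  have hr : 0 < r := by positivity
  have hR : 0 < R := by positivity
  have hO : IsOpen {y : ℂ | r < ‖y‖ ∧ ‖y‖ < R} :=
    (isOpen_lt continuous_const continuous_norm).inter (isOpen_lt continuous_norm continuous_const)
  have hs : Summable fun n => ‖c n * (r : ℂ) ^ n‖ + ‖c n * (R : ℂ) ^ n‖ :=
    (h r (by exact_mod_cast hr.ne')).add (h R (by exact_mod_cast hR.ne'))
  have hd := Complex.differentiableOn_tsum_of_summable_norm (F := fun n y => c n * y ^ n) hs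
    (fun n y hy => by
      have : y ≠ 0 := norm_pos_iff.1 (hr.trans hy.1)
      exact ((differentiableAt_zpow.2 (Or.inl this)).const_mul _).differentiableWithinAt) hO
    (fun n y hy => by
      simp only [norm_mul, norm_zpow, Complex.norm_real, Real.norm_eq_abs, abs_of_pos hr,
        abs_of_pos hR, ← mul_add]
      exact mul_le_mul_of_nonneg_left (norm_zpow_le_add hr hy.1.le hy.2.le n) (norm_nonneg _))
  exact hd.analyticAt (hO.mem_nhds ⟨by simp only [r]; linarith, by simp only [R]; linarith⟩)

theorem qTheta_eq (q x : ℂ) : qTheta q x = ∑' n : ℤ, gaussPow q n * x ^ n := rfl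

theorem analyticAt_qTheta {q : ℂ} (hq0 : q ≠ 0) (hq : ‖q‖ < 1) {x : ℂ} (hx : x ≠ 0) :
    AnalyticAt ℂ (qTheta q) x :=
  analyticAt_laurent (fun x _ => summable_theta hq0 hq x) hx

theorem hasSum_qTheta {q : ℂ} (hq0 : q ≠ 0) (hq : ‖q‖ < 1) (x : ℂ) :
    HasSum (fun n : ℤ => gaussPow q n * x ^ n) (qTheta q x) :=
  (summable_theta hq0 hq x).of_norm.hasSum

theorem qTheta_zpow_mul {q : ℂ} (hq0 : q ≠ 0) {x : ℂ} (hx : x ≠ 0) (m : ℤ) :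
    qTheta q (q ^ m * x) = qTheta q x / (gaussPow q m * x ^ m) := by
  rw [eq_div_iff (mul_ne_zero (gaussPow_ne_zero hq0 m) (zpow_ne_zero m hx)), qTheta_eq, qTheta_eq,
    ← tsum_mul_right, ← (Equiv.addRight m).tsum_eq (fun n : ℤ => gaussPow q n * x ^ n)]
  refine tsum_congr fun n => ?_
  simp only [Equiv.coe_addRight, gaussPow_add hq0, zpow_add₀ hx, mul_zpow, ← zpow_mul, mul_comm n m]
  ring

theorem qTheta_mul_left {q : ℂ} (hq0 : q ≠ 0) {x : ℂ} (hx : x ≠ 0) :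
    qTheta q (q * x) = qTheta q x / x := by
  simpa [gaussPow_one] using qTheta_zpow_mul hq0 hx 1

theorem qTheta_inv {q : ℂ} (hq0 : q ≠ 0) (x : ℂ) :
    qTheta q x⁻¹ = qTheta q (q * x) := by
  rw [qTheta_eq, qTheta_eq, ← (Equiv.neg ℤ).tsum_eq]
  refine tsum_congr fun n => ?_
  simp only [Equiv.neg_apply, gaussPow_neg hq0, mul_zpow, inv_zpow, zpow_neg, inv_inv]
  ring

/-! ### The Jacobi triple product and the zeros of `θ`. -/

theorem qPoch_succ' (q a : ℂ) (n : ℕ) : qPoch q a (n + 1) = (1 - a) * qPoch q (a * q) n := by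
  rw [add_comm, qPoch_add]; simp [qPoch]

/-- Factoring `-c/q^i` out of each factor `1 - c/q^i`, `1 ≤ i ≤ m`, turns the product into one that
runs upwards from `q/c`. The Gaussian denominator is `q^{1+2+⋯+m}`. -/
theorem qPoch_div_pow {q c : ℂ} (hq0 : q ≠ 0) (hc : c ≠ 0) (m : ℕ) :
    qPoch q (c / q ^ m) m = (-c) ^ m / gaussPow q (m + 1) * qPoch q (q / c) m := by
  induction m with
  | zero => simp [qPoch, gaussPow_one]
  | succ m ih =>
    have e : c / q ^ (m + 1) * q = c / q ^ m := by rw [pow_succ]; field_simp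
    have := gaussPow_ne_zero hq0 (m + 1)
    rw [qPoch_succ', e, ih, qPoch_succ]
    push_cast
    rw [gaussPow_add_one hq0 (m + 1)]
    have e2 : q ^ ((m : ℤ) + 1) = q ^ (m + 1) := by
      rw [zpow_add₀ hq0, zpow_natCast, zpow_one, pow_succ]
    rw [e2]
    field_simp
    ring

/-- The Gaussian binomial coefficient `(q;q)_{n+k} / ((q;q)_n (q;q)_k)`. -/
noncomputable def gaussBinom (q : ℂ) (n k : ℕ) : ℂ :=
  qPoch q q (n + k) / (qPoch q q n * qPoch q q k)

/-- This is the finite `q`-binomial theorem. The induction uses the `q`-Pascal rule, obtained by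
writing `1 - q^{M+1}` as `(1 - q^i) + q^i(1 - q^j)` for `i + j = M + 1`. -/
theorem qPoch_neg_eq_sum {q : ℂ} (hq0 : q ≠ 0) (hq : ‖q‖ < 1) (y : ℂ) (M : ℕ) :
    qPoch q (-y) M =
      ∑ p ∈ Finset.HasAntidiagonal.antidiagonal M, gaussBinom q p.1 p.2 * (gaussPow q p.2 * y ^ p.2) := by
  have hne := qPoch_ne_zero (self_mul_pow_ne_one hq)
  induction M with
  | zero => simp [qPoch, gaussBinom, gaussPow_zero]
  | succ M ih =>
    have h1 : ∀ n : ℕ, 1 - q * q ^ n ≠ 0 := fun n => sub_ne_zero.2 (self_mul_pow_ne_one hq n).symm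
    have split : ∀ p ∈ Finset.HasAntidiagonal.antidiagonal (M + 1),
        gaussBinom q p.1 p.2 * (gaussPow q p.2 * y ^ p.2) =
          gaussBinom q p.1 p.2 * (1 - q ^ p.1) / (1 - q * q ^ M) * (gaussPow q p.2 * y ^ p.2) +
          gaussBinom q p.1 p.2 * (q ^ p.1 * (1 - q ^ p.2)) / (1 - q * q ^ M) *
            (gaussPow q p.2 * y ^ p.2) := by
      intro p hp
      have hp' : p.1 + p.2 = M + 1 := Finset.HasAntidiagonal.mem_antidiagonal.1 hp
      have e : (1 - q ^ p.1) + q ^ p.1 * (1 - q ^ p.2) = 1 - q * q ^ M := by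
        rw [mul_sub, ← pow_add, hp']; ring
      rw [← add_mul, ← add_div, ← mul_add, e, mul_div_cancel_right₀ _ (h1 M)]
    rw [qPoch_succ, ih, Finset.sum_congr rfl split, Finset.sum_add_distrib,
      Finset.Nat.sum_antidiagonal_succ, Finset.Nat.sum_antidiagonal_succ', mul_sub, mul_one,
      sub_eq_add_neg]
    simp only [pow_zero, sub_self, mul_zero, zero_div, zero_mul, zero_add]
    rw [← mul_neg, Finset.sum_mul]
    congr 1
    · refine Finset.sum_congr rfl fun p hp => ?_
      have hp' : p.1 + p.2 = M := Finset.HasAntidiagonal.mem_antidiagonal.1 hp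
      congr 1
      have := h1 p.1
      have := h1 M
      have := hne p.1
      have := hne p.2
      rw [gaussBinom, gaussBinom, show p.1 + 1 + p.2 = M + 1 by omega, hp', qPoch_succ, qPoch_succ,
        pow_succ']
      field_simp
    · refine Finset.sum_congr rfl fun p hp => ?_
      have hp' : p.1 + p.2 = M := Finset.HasAntidiagonal.mem_antidiagonal.1 hp
      have := h1 p.2
      have := h1 M
      have := hne p.1
      have := hne p.2
      push_cast
      rw [gaussBinom, gaussBinom, show p.1 + (p.2 + 1) = M + 1 by omega, hp', qPoch_succ,
        qPoch_succ, gaussPow_add_one hq0, zpow_natCast]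
      have hM : q ^ M = q ^ p.1 * q ^ p.2 := by rw [← hp', pow_add]
      have h3 := h1 M
      have h4 := h1 p.2
      rw [pow_succ' q p.2, pow_succ y, hM]
      rw [hM] at h3
      generalize q ^ p.1 = A at *
      generalize q ^ p.2 = B at *
      rw [mul_comm q] at h3 h4 ⊢
      rw [mul_comm q B]
      field_simp

/-- The `q`-binomial theorem for `(-x/q^N;q)_{2N}`, recentred at its middle term, is a finite form
of the triple product. -/
theorem qPoch_mul_qPoch_eq_tsum {q : ℂ} (hq0 : q ≠ 0) (hq : ‖q‖ < 1) {x : ℂ} (hx : x ≠ 0) (N : ℕ) :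
    qPoch q (-x) N * qPoch q (-(q / x)) N =
      ∑' n : ℤ, if n ∈ Finset.Icc (-(N : ℤ)) N then
        gaussBinom q (N - n).toNat (N + n).toNat * (gaussPow q n * x ^ n) else 0 := by
  rw [tsum_eq_sum (s := Finset.Icc (-(N : ℤ)) N) (fun n hn => if_neg hn),
    Finset.sum_congr rfl (fun n hn => if_pos hn)]
  have h := qPoch_neg_eq_sum hq0 hq (x / q ^ N) (N + N)
  have e : -(x / q ^ N) * q ^ N = -x := by field_simp
  rw [qPoch_add, e, ← neg_div, qPoch_div_pow hq0 (neg_ne_zero.2 hx), neg_neg, div_neg] at h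
  have hg := gaussPow_ne_zero hq0 (N + 1)
  have : qPoch q (-x) N * qPoch q (-(q / x)) N = gaussPow q (N + 1) / x ^ N *
      (x ^ N / gaussPow q (N + 1) * qPoch q (-(q / x)) N * qPoch q (-x) N) := by
    field_simp
  rw [this, h, Finset.mul_sum]
  refine Finset.sum_nbij' (fun p => (p.2 : ℤ) - N) (fun n => ((N - n).toNat, (N + n).toNat))
    ?_ ?_ ?_ ?_ ?_
  · rintro ⟨a, b⟩ hp
    simp only [Finset.HasAntidiagonal.mem_antidiagonal, Finset.mem_Icc] at *
    omega
  · intro n hn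
    simp only [Finset.HasAntidiagonal.mem_antidiagonal, Finset.mem_Icc] at *
    omega
  · rintro ⟨a, b⟩ hp
    simp only [Finset.HasAntidiagonal.mem_antidiagonal, Prod.mk.injEq] at *
    omega
  · intro n hn
    simp only [Finset.mem_Icc] at *
    omega
  · rintro ⟨a, b⟩ hp
    simp only [Finset.HasAntidiagonal.mem_antidiagonal] at *
    rw [show ((N : ℤ) - (b - N)).toNat = a by omega, show ((N : ℤ) + (b - N)).toNat = b by omega]
    have hb : (b : ℤ) = N + (b - N) := by ring
    set n : ℤ := b - N
    have h2 := gaussPow_mul_self hq0 (N : ℤ)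
    have hN : gaussPow q (N : ℤ) ≠ 0 := gaussPow_ne_zero hq0 _
    have e3 : (x / q ^ N) ^ b = x ^ N * x ^ n / (q ^ ((N : ℤ) * N) * q ^ (N * n)) := by
      rw [← zpow_natCast _ b, hb, div_zpow, ← zpow_natCast, ← zpow_mul, mul_add, zpow_add₀ hx,
        zpow_add₀ hq0, zpow_natCast]
    rw [e3, hb, gaussPow_add_one hq0, gaussPow_add hq0 N n, ← h2]
    have := zpow_ne_zero (N * n) hq0
    have := zpow_ne_zero (N : ℤ) hq0
    field_simp

/-- The Jacobi triple product identity. -/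
theorem qTheta_eq_mul {q : ℂ} (hq0 : q ≠ 0) (hq : ‖q‖ < 1) {x : ℂ} (hx : x ≠ 0) :
    qTheta q x = qPochInf q q * (qPochInf q (-x) * qPochInf q (-(q / x))) := by
  have hne := qPochInf_ne_zero hq (self_mul_pow_ne_one hq)
  obtain ⟨C, hC0, hC⟩ := exists_norm_qPoch_le hq q
  obtain ⟨D, hD0, hD⟩ := exists_norm_inv_qPoch_le hq (self_mul_pow_ne_one hq)
  have hT := tendsto_qPoch hq q
  -- For fixed `n` the binomials tend to `1/(q;q)_∞`, and they are bounded uniformly in `N` and `n`;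
  -- hence a multiple of the theta series dominates.
  have lim := tendsto_tsum_of_dominated_convergence (𝓕 := atTop)
    (f := fun (N : ℕ) (n : ℤ) => if n ∈ Finset.Icc (-(N : ℤ)) N then
        gaussBinom q (N - n).toNat (N + n).toNat * (gaussPow q n * x ^ n) else 0)
    (g := fun n => (qPochInf q q)⁻¹ * (gaussPow q n * x ^ n))
    ((summable_theta hq0 hq x).mul_left (C * (D * D))) (fun n => ?_)
    (Eventually.of_forall fun N n => ?_)
  · have h2 : Tendsto (fun N : ℕ => qPoch q (-x) N * qPoch q (-(q / x)) N) atTop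
        (𝓝 (∑' n : ℤ, (qPochInf q q)⁻¹ * (gaussPow q n * x ^ n))) :=
      lim.congr fun N => (qPoch_mul_qPoch_eq_tsum hq0 hq hx N).symm
    have h3 := tendsto_nhds_unique h2 ((tendsto_qPoch hq (-x)).mul (tendsto_qPoch hq (-(q / x))))
    rw [← h3, tsum_mul_left, ← mul_assoc, mul_inv_cancel₀ hne, one_mul, qTheta_eq]
  · have t1 : Tendsto (fun N : ℕ => ((N : ℤ) - n).toNat) atTop atTop :=
      tendsto_atTop_atTop.2 fun b => ⟨b + n.natAbs, fun a ha => by omega⟩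
    have t2 : Tendsto (fun N : ℕ => ((N : ℤ) + n).toNat) atTop atTop :=
      tendsto_atTop_atTop.2 fun b => ⟨b + n.natAbs, fun a ha => by omega⟩
    have t3 : Tendsto (fun N : ℕ => ((N : ℤ) - n).toNat + ((N : ℤ) + n).toNat) atTop atTop :=
      t1.atTop_add_atTop t2
    have t4 := ((hT.comp t3).div ((hT.comp t1).mul (hT.comp t2)) (mul_ne_zero hne hne)).mul_const
      (gaussPow q n * x ^ n)
    rw [show qPochInf q q / (qPochInf q q * qPochInf q q) = (qPochInf q q)⁻¹ by field_simp] at t4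
    refine t4.congr' ?_
    filter_upwards [eventually_ge_atTop n.natAbs] with N hN
    rw [if_pos (by simp only [Finset.mem_Icc]; omega)]
    rfl
  · split_ifs
    · rw [norm_mul, gaussBinom, div_eq_mul_inv, mul_inv, norm_mul, norm_mul]
      gcongr
      · exact hC _
      · exact hD _
      · exact hD _
    · rw [norm_zero]; positivity

theorem qTheta_eq_zero_iff {q : ℂ} (hq0 : q ≠ 0) (hq : ‖q‖ < 1) {x : ℂ} (hx : x ≠ 0) :
    qTheta q x = 0 ↔ x ∈ qSpiral q (-1) := by
  rw [qTheta_eq_mul hq0 hq hx]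
  simp only [mul_eq_zero, qPochInf_ne_zero hq (self_mul_pow_ne_one hq), false_or,
    qPochInf_eq_zero_iff hq, qSpiral, Set.mem_ofPred_eq]
  constructor
  · rintro (⟨k, hk⟩ | ⟨k, hk⟩)
    · refine ⟨-k, ?_⟩
      rw [zpow_neg, zpow_natCast]
      field_simp
      linear_combination -hk
    · refine ⟨k + 1, ?_⟩
      rw [zpow_add₀ hq0, zpow_natCast, zpow_one]
      field_simp at hk
      linear_combination -hk
  · rintro ⟨k, rfl⟩
    rcases le_or_gt k 0 with h | h
    · obtain ⟨m, rfl⟩ := Int.eq_ofNat_of_zero_le (neg_nonneg.2 h) |>.imp fun m hm => neg_eq_iff_eq_neg.1 hm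
      left
      refine ⟨m, ?_⟩
      rw [zpow_neg, zpow_natCast]
      field_simp
    · obtain ⟨m, rfl⟩ : ∃ m : ℕ, k = m + 1 := ⟨(k - 1).toNat, by omega⟩
      right
      refine ⟨m, ?_⟩
      rw [zpow_add₀ hq0, zpow_natCast, zpow_one]
      field_simp

theorem qTheta_neg_one {q : ℂ} (hq0 : q ≠ 0) (hq : ‖q‖ < 1) : qTheta q (-1) = 0 :=
  (qTheta_eq_zero_iff hq0 hq (by simp)).2 ⟨0, by simp⟩

/-! ### The series `₃φ₂` and its continuation. -/

/-- The coefficients of `₃φ₂(α, β, γ; δ, ε; q, z)`. -/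
noncomputable def hyp32Coeff (q α β γ δ ε : ℂ) (n : ℕ) : ℂ :=
  qPoch q α n * qPoch q β n * qPoch q γ n / (qPoch q δ n * qPoch q ε n * qPoch q q n)

theorem coeff_qHypSeries_three_two (q α β γ δ ε : ℂ) (n : ℕ) :
    PowerSeries.coeff n (qHypSeries q [α, β, γ] [δ, ε]) = hyp32Coeff q α β γ δ ε n := by
  simp [qHypSeries, hyp32Coeff, mul_assoc]

/-- Here `1 + s - r = -1`, so the Borel weight cancels the Gaussian of `₃φ₁` and only the sign
survives: the transform is a convergent `₃φ₂` in `-ξ`. -/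
theorem coeff_borel31 {q : ℂ} (hq0 : q ≠ 0) (a₁ a₂ a₃ b₁ : ℂ) (n : ℕ) :
    PowerSeries.coeff n (borel31 q a₁ a₂ a₃ b₁) = (-1) ^ n * hyp32Coeff q a₁ a₂ a₃ b₁ 0 n := by
  have h1 : (1 + (([b₁] : List ℂ).length : ℤ) - (([a₁, a₂, a₃] : List ℂ).length : ℤ)) = -1 := by
    simp
  have h2 : q ^ (n * (n - 1) / 2) ≠ 0 := pow_ne_zero _ hq0
  have h3 : ((-1 : ℂ) ^ n)⁻¹ = (-1) ^ n := by rw [← inv_pow]; norm_num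
  rw [borel31, qBorel, PowerSeries.coeff_mk, qHypSeries, PowerSeries.coeff_mk, h1, zpow_neg_one,
    mul_inv, h3]
  simp only [List.map_cons, List.map_nil, List.prod_cons, List.prod_nil, hyp32Coeff,
    qPoch_zero_left, mul_one]
  field_simp

theorem hyp32Coeff_succ {q α β γ δ ε : ℂ} (hq : ‖q‖ < 1) (hδ : ∀ k : ℕ, δ * q ^ k ≠ 1)
    (hε : ∀ k : ℕ, ε * q ^ k ≠ 1) (n : ℕ) :
    hyp32Coeff q α β γ δ ε (n + 1) * ((1 - δ * q ^ n) * (1 - ε * q ^ n) * (1 - q * q ^ n)) =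
      hyp32Coeff q α β γ δ ε n * ((1 - α * q ^ n) * (1 - β * q ^ n) * (1 - γ * q ^ n)) := by
  have h1 := qPoch_ne_zero hδ n
  have h2 := qPoch_ne_zero hε n
  have h3 := qPoch_ne_zero (self_mul_pow_ne_one hq) n
  have h4 := sub_ne_zero.2 (hδ n).symm
  have h5 := sub_ne_zero.2 (hε n).symm
  have h6 := sub_ne_zero.2 (self_mul_pow_ne_one hq n).symm
  simp only [hyp32Coeff, qPoch_succ]
  rw [div_mul_eq_mul_div, div_mul_eq_mul_div, div_eq_div_iff (by simp [*]) (by simp [*])]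
  ring

theorem exists_norm_hyp32Coeff_le {q α β γ δ ε : ℂ} (hq : ‖q‖ < 1) (hδ : ∀ k : ℕ, δ * q ^ k ≠ 1)
    (hε : ∀ k : ℕ, ε * q ^ k ≠ 1) : ∃ C : ℝ, 0 < C ∧ ∀ n, ‖hyp32Coeff q α β γ δ ε n‖ ≤ C := by
  have hi : ∀ a, Tendsto (qPoch q a) atTop (𝓝 (qPochInf q a)) := tendsto_qPoch hq
  exact exists_norm_le_of_tendsto ((((hi α).mul (hi β)).mul (hi γ)).div
    (((hi δ).mul (hi ε)).mul (hi q)) (mul_ne_zero (mul_ne_zero (qPochInf_ne_zero hq hδ)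
      (qPochInf_ne_zero hq hε)) (qPochInf_ne_zero hq (self_mul_pow_ne_one hq))))

theorem summable_norm_mul_pow_of_bounded {u : ℕ → ℂ} {C : ℝ} (hu : ∀ n, ‖u n‖ ≤ C) {z : ℂ}
    (hz : ‖z‖ < 1) : Summable fun n => ‖u n * z ^ n‖ := by
  refine Summable.of_nonneg_of_le (fun _ => norm_nonneg _) (fun n => ?_)
    ((summable_geometric_of_lt_one (norm_nonneg z) hz).mul_left C)
  rw [norm_mul, norm_pow]
  exact mul_le_mul_of_nonneg_right (hu n) (by positivity)

theorem differentiableOn_tsum_mul_pow {u : ℕ → ℂ} {R : ℝ}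
    (h : ∀ z : ℂ, ‖z‖ < R → Summable fun n => ‖u n * z ^ n‖) :
    DifferentiableOn ℂ (fun z => ∑' n, u n * z ^ n) (Metric.ball 0 R) := by
  intro z hz
  rw [mem_ball_zero_iff] at hz
  obtain ⟨r, hr1, hr2⟩ := exists_between hz
  have hr0 : 0 ≤ r := (norm_nonneg z).trans hr1.le
  have hs := h (r : ℂ) (by simpa [abs_of_nonneg hr0] using hr2)
  have hd := Complex.differentiableOn_tsum_of_summable_norm (F := fun n y => u n * y ^ n) hs
    (fun n => by fun_prop) (Metric.isOpen_ball (x := (0 : ℂ)) (ε := r)) (fun n y hy => by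
      rw [mem_ball_zero_iff] at hy
      simp only [norm_mul, norm_pow, Complex.norm_real, Real.norm_eq_abs, abs_of_nonneg hr0]
      gcongr)
  exact (hd.differentiableAt (Metric.isOpen_ball.mem_nhds
    (by simpa using hr1))).differentiableWithinAt

/-- The right-hand side at `z` needs `G` only at points of modulus at most `|q||z|`. Each
application of the equation therefore enlarges the disc of analyticity by the factor `1/|q|`. -/
theorem exists_entire_of_functional_eq {q : ℂ} (hq0 : q ≠ 0) (hq : ‖q‖ < 1) {G A B C : ℂ → ℂ}
    (hA : Differentiable ℂ A) (hB : Differentiable ℂ B) (hC : Differentiable ℂ C)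
    (hG : DifferentiableOn ℂ G (Metric.ball 0 1))
    (h : ∀ z ∈ Metric.ball (0 : ℂ) 1,
      G z = A z * G (q * z) + B z * G (q ^ 2 * z) + C z * G (q ^ 3 * z)) :
    ∃ E : ℂ → ℂ, Differentiable ℂ E ∧ ∀ z ∈ Metric.ball (0 : ℂ) 1, E z = G z := by
  set T : (ℂ → ℂ) → ℂ → ℂ := fun H z =>
    A z * H (q * z) + B z * H (q ^ 2 * z) + C z * H (q ^ 3 * z) with hT
  have hqn : 0 < ‖q‖ := norm_pos_iff.2 hq0
  set R : ℕ → ℝ := fun k => ‖q‖⁻¹ ^ k with hR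
  have hinv : 1 < ‖q‖⁻¹ := (one_lt_inv₀ hqn).2 hq
  have hmaps : ∀ r : ℝ, ∀ i : ℕ, 1 ≤ i → Set.MapsTo (fun z : ℂ => q ^ i * z)
      (Metric.ball 0 (‖q‖⁻¹ * r)) (Metric.ball 0 r) := by
    intro r i hi z hz
    rw [mem_ball_zero_iff] at *
    rw [norm_mul, norm_pow]
    calc ‖q‖ ^ i * ‖z‖ ≤ ‖q‖ * ‖z‖ := by
          gcongr
          exact pow_le_of_le_one hqn.le hq.le (by omega)
      _ < ‖q‖ * (‖q‖⁻¹ * r) := by gcongr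
      _ = r := by field_simp
  have main : ∀ k, DifferentiableOn ℂ (T^[k] G) (Metric.ball 0 (R k)) ∧
      Set.EqOn (T^[k] G) G (Metric.ball 0 1) := by
    intro k
    induction k with
    | zero => exact ⟨by simpa [hR] using hG, fun _ _ => rfl⟩
    | succ k ih =>
      rw [Function.iterate_succ_apply']
      have hRk : R (k + 1) = ‖q‖⁻¹ * R k := pow_succ' _ _
      constructor
      · rw [hRk]
        have hcomp : ∀ i : ℕ, 1 ≤ i → DifferentiableOn ℂ (fun z => T^[k] G (q ^ i * z))
            (Metric.ball 0 (‖q‖⁻¹ * R k)) := fun i hi =>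
          ih.1.comp (by fun_prop) (hmaps _ i hi)
        have h1 := hcomp 1 le_rfl
        simp only [pow_one] at h1
        exact ((hA.differentiableOn.mul h1).add
          (hB.differentiableOn.mul (hcomp 2 (by norm_num)))).add
          (hC.differentiableOn.mul (hcomp 3 (by norm_num)))
      · intro z hz
        have hm : ∀ i : ℕ, 1 ≤ i → q ^ i * z ∈ Metric.ball (0 : ℂ) 1 := fun i hi =>
          hmaps 1 i hi (Metric.ball_subset_ball (by linarith) hz)
        have h1 := hm 1 le_rfl
        rw [pow_one] at h1
        simp only [hT]
        rw [h z hz, ih.2 h1, ih.2 (hm 2 (by norm_num)), ih.2 (hm 3 (by norm_num))]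
  -- All iterates agree with `G` near `0`, so its Taylor series there represents each of them on its
  -- disc and glues them together.
  set E : ℂ → ℂ := fun z => ∑' n : ℕ, ((n.factorial : ℂ))⁻¹ • (z - 0) ^ n • iteratedDeriv n G 0
    with hE
  have hEk : ∀ k, Set.EqOn E (T^[k] G) (Metric.ball 0 (R k)) := by
    intro k z hz
    have h1 := (Complex.hasSum_taylorSeries_on_ball (main k).1 hz).tsum_eq
    rw [← h1, hE]
    have : T^[k] G =ᶠ[𝓝 0] G := (main k).2.eventuallyEq_of_mem (Metric.ball_mem_nhds _ one_pos)
    exact tsum_congr fun n => by rw [this.iteratedDeriv_eq]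
  refine ⟨E, fun z => ?_, fun z hz => hEk 0 (by simpa [hR] using hz)⟩
  obtain ⟨k, hk⟩ := ((tendsto_pow_atTop_atTop_of_one_lt hinv).eventually_gt_atTop ‖z‖).exists
  have hmem : Metric.ball (0 : ℂ) (R k) ∈ 𝓝 z := Metric.isOpen_ball.mem_nhds (mem_ball_zero_iff.2 hk)
  exact (((main k).1.congr (hEk k)).differentiableAt hmem)

/-- Every domain to which the identity theorem is applied below is the plane minus countably many
points. -/
theorem isPreconnected_of_countable_compl {U : Set ℂ} (h : Uᶜ.Countable) : IsPreconnected U := by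
  have := h.isPathConnected_compl_of_one_lt_rank (by rw [Complex.rank_real_complex]; norm_num)
  rw [compl_compl] at this
  exact this.isConnected.isPreconnected

theorem countable_compl_qSlitPlane {q : ℂ} (hq0 : q ≠ 0) (c : ℂ) :
    (qSlitPlane q c)ᶜ.Countable := by
  refine (Set.countable_range fun k : ℕ => c / q ^ k).mono fun z hz => ?_
  simp only [qSlitPlane, Set.mem_compl_iff, Set.mem_ofPred_eq, not_forall, not_not] at hz
  obtain ⟨k, hk⟩ := hz
  exact ⟨k, by rw [← hk]; field_simp⟩

theorem isPreconnected_qSlitPlane {q : ℂ} (hq0 : q ≠ 0) (c : ℂ) :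
    IsPreconnected (qSlitPlane q c) :=
  isPreconnected_of_countable_compl (countable_compl_qSlitPlane hq0 c)

theorem zero_mem_qSlitPlane {q c : ℂ} (hc : c ≠ 0) : (0 : ℂ) ∈ qSlitPlane q c :=
  fun k => by simpa using hc.symm

theorem pow_mul_mem_qSlitPlane {q c z : ℂ} (hz : z ∈ qSlitPlane q c) (i : ℕ) :
    q ^ i * z ∈ qSlitPlane q c := fun k => by
  rw [mul_comm _ z, mul_assoc, ← pow_add]; exact hz _

theorem mem_qSlitPlane_one_of_norm_lt {q z : ℂ} (hq : ‖q‖ < 1) (hz : ‖z‖ < 1) :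
    z ∈ qSlitPlane q 1 := fun k h => by
  have := congrArg norm h
  rw [norm_mul, norm_pow, norm_one] at this
  have h1 : ‖q‖ ^ k ≤ 1 := pow_le_one₀ (norm_nonneg _) hq.le
  nlinarith [norm_nonneg z]

/-- The coefficient recursion is a `q`-difference equation. After multiplication by `(z;q)_∞` it
expresses the product at `z` through its values at `qz`, `q²z`, `q³z` with polynomial coefficients,
so the product is entire. Dividing by `(z;q)_∞` gives the continuation. -/
theorem exists_continuation_hyp32 {q α β γ δ ε : ℂ} (hq0 : q ≠ 0) (hq : ‖q‖ < 1)
    (hδ : ∀ k : ℕ, δ * q ^ k ≠ 1) (hε : ∀ k : ℕ, ε * q ^ k ≠ 1) :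
    ∃ F : ℂ → ℂ, IsContinuation (qHypSeries q [α, β, γ] [δ, ε]) (qSlitPlane q 1) F ∧
      (∀ z, ‖z‖ < 1 → HasSum (fun n => hyp32Coeff q α β γ δ ε n * z ^ n) (F z)) ∧
      ∀ z ∈ qSlitPlane q 1,
        F z - (1 + (δ + ε) / q) * F (q * z) + ((δ + ε) / q + δ * ε / q ^ 2) * F (q ^ 2 * z)
          - δ * ε / q ^ 2 * F (q ^ 3 * z) =
        z * (F z - (α + β + γ) * F (q * z) + (α * β + β * γ + γ * α) * F (q ^ 2 * z)
          - α * β * γ * F (q ^ 3 * z)) := by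
  obtain ⟨C, -, hC⟩ := exists_norm_hyp32Coeff_le (α := α) (β := β) (γ := γ) hq hδ hε
  set u := hyp32Coeff q α β γ δ ε with hu
  set F₀ : ℂ → ℂ := fun z => ∑' n, u n * z ^ n with hF₀
  have hsum : ∀ z : ℂ, ‖z‖ < 1 → HasSum (fun n => u n * z ^ n) (F₀ z) := fun z hz =>
    (summable_norm_mul_pow_of_bounded hC hz).of_norm.hasSum
  have hpow : ∀ (i : ℕ) (z : ℂ), ‖z‖ < 1 → ‖q ^ i * z‖ < 1 := fun i z hz => by
    rw [norm_mul, norm_pow]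
    exact mul_lt_one_of_nonneg_of_lt_one_right (pow_le_one₀ (norm_nonneg _) hq.le)
      (norm_nonneg _) hz
  have heq : ∀ z : ℂ, ‖z‖ < 1 →
      F₀ z - (1 + (δ + ε) / q) * F₀ (q * z) + ((δ + ε) / q + δ * ε / q ^ 2) * F₀ (q ^ 2 * z)
          - δ * ε / q ^ 2 * F₀ (q ^ 3 * z) =
        z * (F₀ z - (α + β + γ) * F₀ (q * z) + (α * β + β * γ + γ * α) * F₀ (q ^ 2 * z)
          - α * β * γ * F₀ (q ^ 3 * z)) := by
    intro z hz
    have s0 := hsum z hz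
    have s1 := hsum (q * z) (by simpa using hpow 1 z hz)
    have s2 := hsum _ (hpow 2 z hz)
    have s3 := hsum _ (hpow 3 z hz)
    have hL := ((s0.sub (s1.mul_left (1 + (δ + ε) / q))).add
      (s2.mul_left ((δ + ε) / q + δ * ε / q ^ 2))).sub (s3.mul_left (δ * ε / q ^ 2))
    have hR := (((s0.sub (s1.mul_left (α + β + γ))).add
      (s2.mul_left (α * β + β * γ + γ * α))).sub (s3.mul_left (α * β * γ))).mul_left z
    have hL' := (hasSum_nat_add_iff' 1).2 hL
    simp only [Finset.range_one, Finset.sum_singleton, pow_zero] at hL'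
    -- With `σF(z) = F(qz)` the left side is `(1-σ)(1-δσ/q)(1-εσ/q)F`, which kills constants.
    -- Dropping the term `n = 0` thus aligns it with the factor `z` on the right.
    have e : (u 0 * 1 - (1 + (δ + ε) / q) * (u 0 * 1) +
        ((δ + ε) / q + δ * ε / q ^ 2) * (u 0 * 1) - δ * ε / q ^ 2 * (u 0 * 1)) = 0 := by ring
    rw [e, sub_zero] at hL'
    refine hL'.unique (hR.congr_fun fun n => ?_)
    have hrec := hyp32Coeff_succ (α := α) (β := β) (γ := γ) hq hδ hε n
    rw [← hu] at hrec
    calc _ = u (n + 1) * ((1 - δ * q ^ n) * (1 - ε * q ^ n) * (1 - q * q ^ n)) * z ^ (n + 1) := by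
          simp only [mul_pow, ← pow_mul, pow_succ]
          field_simp
          ring
      _ = _ := by
          rw [hrec]
          simp only [mul_pow, ← pow_mul]
          ring
  have hQ := differentiable_qPochInf hq
  have hF₀d : DifferentiableOn ℂ F₀ (Metric.ball 0 1) :=
    differentiableOn_tsum_mul_pow fun z hz => summable_norm_mul_pow_of_bounded hC hz
  obtain ⟨E, hEd, hE⟩ := exists_entire_of_functional_eq hq0 hq
    (G := fun z => qPochInf q z * F₀ z)
    (A := fun z => (1 + (δ + ε) / q) - (α + β + γ) * z)
    (B := fun z => (1 - q * z) * (-((δ + ε) / q + δ * ε / q ^ 2) + (α * β + β * γ + γ * α) * z))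
    (C := fun z => (1 - q * z) * (1 - q ^ 2 * z) * (δ * ε / q ^ 2 - α * β * γ * z))
    (by fun_prop) (by fun_prop) (by fun_prop) (hQ.differentiableOn.mul hF₀d) (fun z hz => by
      have h1 := heq z (by simpa using hz)
      have q1 := qPochInf_eq_one_sub_mul hq z
      have q2 := qPochInf_eq_one_sub_mul hq (q * z)
      have q3 := qPochInf_eq_one_sub_mul hq (q ^ 2 * z)
      rw [show z * q = q * z by ring] at q1
      rw [show q * z * q = q ^ 2 * z by ring] at q2
      rw [show q ^ 2 * z * q = q ^ 3 * z by ring] at q3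
      rw [q1, q2, q3]
      linear_combination (1 - q * z) * (1 - q ^ 2 * z) * qPochInf q (q ^ 3 * z) * h1)
  have hQne : ∀ z ∈ qSlitPlane q 1, qPochInf q z ≠ 0 := fun z hz => qPochInf_ne_zero hq hz
  set F : ℂ → ℂ := fun z => E z / qPochInf q z with hF
  have hFF₀ : ∀ z, ‖z‖ < 1 → F z = F₀ z := fun z hz => by
    simp only [hF]
    rw [hE z (by simpa using hz)]
    exact mul_div_cancel_left₀ _ (hQne z (mem_qSlitPlane_one_of_norm_lt hq hz))
  have han : AnalyticOnNhd ℂ F (qSlitPlane q 1) := fun z hz =>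
    (hEd.analyticAt z).div (hQ.analyticAt z) (hQne z hz)
  have hball : ∀ᶠ z in 𝓝 (0 : ℂ), ‖z‖ < 1 := by
    filter_upwards [Metric.ball_mem_nhds (0 : ℂ) one_pos] with z hz using by simpa using hz
  have hs : ∀ z, ‖z‖ < 1 → HasSum (fun n => u n * z ^ n) (F z) := fun z hz => by
    rw [hFF₀ z hz]; exact hsum z hz
  refine ⟨F, ⟨han, ?_⟩, hs, ?_⟩
  · filter_upwards [hball] with z hz
    simpa only [coeff_qHypSeries_three_two] using hs z hz
  · have hcomp : ∀ i : ℕ, AnalyticOnNhd ℂ (fun z => F (q ^ i * z)) (qSlitPlane q 1) :=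
      fun i z hz => (han _ (pow_mul_mem_qSlitPlane hz i)).comp
        (f := fun z => q ^ i * z) (by fun_prop)
    have h1 := hcomp 1
    simp only [pow_one] at h1
    have hid : AnalyticOnNhd ℂ (fun z : ℂ => z) (qSlitPlane q 1) := fun z _ => analyticAt_id
    have hc : ∀ c : ℂ, AnalyticOnNhd ℂ (fun _ : ℂ => c) (qSlitPlane q 1) :=
      fun c z _ => analyticAt_const
    have hl := ((han.sub ((hc (1 + (δ + ε) / q)).mul h1)).add
      ((hc ((δ + ε) / q + δ * ε / q ^ 2)).mul (hcomp 2))).sub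
      ((hc (δ * ε / q ^ 2)).mul (hcomp 3))
    have hr := hid.mul (((han.sub ((hc (α + β + γ)).mul h1)).add
      ((hc (α * β + β * γ + γ * α)).mul (hcomp 2))).sub ((hc (α * β * γ)).mul (hcomp 3)))
    refine hl.eqOn_of_preconnected_of_eventuallyEq hr (isPreconnected_qSlitPlane hq0 1)
      (zero_mem_qSlitPlane one_ne_zero) ?_
    filter_upwards [hball] with z hz
    have := heq z hz
    simp only [Pi.add_apply, Pi.sub_apply]
    rw [hFF₀ _ hz, hFF₀ _ (hpow 2 z hz), hFF₀ _ (hpow 3 z hz),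
      hFF₀ (q * z) (by simpa using hpow 1 z hz)]
    exact this

theorem isContinuation_continuation {f : PowerSeries ℂ} {U : Set ℂ}
    (h : ∃ F, IsContinuation f U F) : IsContinuation f U (continuation f U) := by
  rw [continuation, dif_pos h]
  exact h.choose_spec

/-! ### Partial fractions of `(bt, qt;q)_∞ / (at, a't, a''t;q)_∞`. -/

/-- Lagrange interpolation of the numerator at the poles `1/c_i`, divided by the denominator, is its
partial fraction decomposition. -/
theorem eval_div_prod_eq_sum {ι : Type*} [DecidableEq ι] {s : Finset ι} {c : ι → ℂ}
    (hc : ∀ i ∈ s, c i ≠ 0) (hinj : Set.InjOn c s) {P : Polynomial ℂ} (hdeg : P.degree < s.card)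
    {t : ℂ} (ht : ∀ i ∈ s, 1 - c i * t ≠ 0) :
    P.eval t / ∏ i ∈ s, (1 - c i * t) =
      ∑ i ∈ s, P.eval (c i)⁻¹ / (∏ j ∈ s.erase i, (1 - c j * (c i)⁻¹)) / (1 - c i * t) := by
  have hinj' : Set.InjOn (fun i => (c i)⁻¹) s := fun i hi j hj h => hinj hi hj (inv_injective h)
  have h := congrArg (Polynomial.eval t) (Lagrange.eq_interpolate hinj' hdeg)
  rw [Lagrange.interpolate_apply, Polynomial.eval_finsetSum] at h
  rw [h, Finset.sum_div]
  refine Finset.sum_congr rfl fun i hi => ?_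
  rw [Polynomial.eval_mul, Polynomial.eval_C, ← Finset.mul_prod_erase s _ hi, Lagrange.basis,
    Polynomial.eval_prod]
  have e : ∏ j ∈ s.erase i, Polynomial.eval t (Lagrange.basisDivisor (c i)⁻¹ (c j)⁻¹) =
      (∏ j ∈ s.erase i, (1 - c j * t)) / ∏ j ∈ s.erase i, (1 - c j * (c i)⁻¹) := by
    rw [← Finset.prod_div_distrib]
    refine Finset.prod_congr rfl fun j hj => ?_
    obtain ⟨hji, hj⟩ := Finset.mem_erase.1 hj
    have h1 := hc i hi
    have h2 := hc j hj
    have h3 : c i - c j ≠ 0 := sub_ne_zero.2 fun h => hji (hinj hj hi h.symm)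
    have h4 : c j - c i ≠ 0 := sub_ne_zero.2 fun h => hji (hinj hj hi h)
    have h5 : (c i)⁻¹ - (c j)⁻¹ ≠ 0 := sub_ne_zero.2 fun h => h3 (sub_eq_zero.2 (inv_injective h))
    have h6 : 1 - c j * (c i)⁻¹ ≠ 0 := by
      intro h
      apply h3
      field_simp at h
      simpa using h
    simp only [Lagrange.basisDivisor, Polynomial.eval_mul, Polynomial.eval_C, Polynomial.eval_sub,
      Polynomial.eval_X]
    rw [eq_div_iff h6, mul_assoc, inv_mul_eq_iff_eq_mul₀ h5]
    field_simp
    ring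
  have h7 : ∏ j ∈ s.erase i, (1 - c j * t) ≠ 0 :=
    Finset.prod_ne_zero_iff.2 fun j hj => ht j (Finset.mem_of_mem_erase hj)
  rw [e, mul_div_assoc', mul_comm (1 - c i * t), ← div_div, div_right_comm (_ * _),
    mul_div_cancel_right₀ _ h7]

theorem prod_product_erase {κ : Type*} [DecidableEq κ] (S : Finset κ) (T : Finset ℕ) {j : κ} {m : ℕ}
    (hj : j ∈ S) (f : κ × ℕ → ℂ) :
    ∏ p ∈ (S ×ˢ T).erase (j, m), f p =
      (∏ i ∈ T.erase m, f (j, i)) * ∏ k ∈ S.erase j, ∏ i ∈ T, f (k, i) := by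
  have h : (S ×ˢ T).erase (j, m) = ({j} ×ˢ T.erase m) ∪ (S.erase j ×ˢ T) := by
    ext ⟨k, i⟩
    simp only [Finset.mem_erase, Finset.mem_product, Finset.mem_union, Finset.mem_singleton, ne_eq,
      Prod.mk.injEq]
    constructor
    · rintro ⟨h1, h2, h3⟩
      by_cases hk : k = j
      · exact Or.inl ⟨hk, fun h => h1 ⟨hk, h⟩, h3⟩
      · exact Or.inr ⟨⟨hk, h2⟩, h3⟩
    · rintro (⟨rfl, h1, h2⟩ | ⟨⟨h1, h2⟩, h3⟩)
      · exact ⟨fun h => h1 h.2, hj, h2⟩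
      · exact ⟨fun h => h1 h.1, h2, h3⟩
  rw [h, Finset.prod_union, Finset.prod_product, Finset.prod_singleton, Finset.prod_product]
  rw [Finset.disjoint_left]
  rintro ⟨k, i⟩ h1 h2
  simp only [Finset.mem_erase, Finset.mem_product, Finset.mem_singleton] at h1 h2
  exact h2.1.1 h1.1

/-- The polynomial `(bX;q)_N`. -/
noncomputable def qPochPoly (q b : ℂ) (N : ℕ) : Polynomial ℂ :=
  ∏ k ∈ Finset.range N, (1 - Polynomial.C (b * q ^ k) * Polynomial.X)

theorem eval_qPochPoly (q b t : ℂ) (N : ℕ) : (qPochPoly q b N).eval t = qPoch q (b * t) N := by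
  simp only [qPochPoly, Polynomial.eval_prod, qPoch, Polynomial.eval_sub, Polynomial.eval_one,
    Polynomial.eval_mul, Polynomial.eval_C, Polynomial.eval_X]
  exact Finset.prod_congr rfl fun k _ => by ring

theorem natDegree_qPochPoly_le (q b : ℂ) (N : ℕ) : (qPochPoly q b N).natDegree ≤ N := by
  refine (Polynomial.natDegree_prod_le _ _).trans ?_
  refine (Finset.sum_le_card_nsmul _ _ 1 fun k _ => ?_).trans (by simp)
  exact (Polynomial.natDegree_sub_le _ _).trans
    (by simpa using Polynomial.natDegree_C_mul_le (b * q ^ k) Polynomial.X)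

/-- The residues of `(bt, qt;q)_N / (at, a't, a''t;q)_N` at the points `t = 1 / (a q^m)`. -/
noncomputable def finResidue (q a a' a'' b : ℂ) (N m : ℕ) : ℂ :=
  qPoch q (b / a / q ^ m) N * qPoch q (q / a / q ^ m) N /
    ((∏ i ∈ (Finset.range N).erase m, (1 - q ^ i / q ^ m)) *
      (qPoch q (a' / a / q ^ m) N * qPoch q (a'' / a / q ^ m) N))

theorem not_mem_qSpiral_comm {q a b : ℂ} (hq0 : q ≠ 0) (h : a ∉ qSpiral q b) :
    b ∉ qSpiral q a := by
  rintro ⟨k, rfl⟩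
  refine h ⟨-k, ?_⟩
  rw [mul_assoc, ← zpow_add₀ hq0]
  simp

theorem mul_pow_ne_mul_pow {q a b : ℂ} (hq0 : q ≠ 0) (h : a ∉ qSpiral q b) (m n : ℕ) :
    a * q ^ m ≠ b * q ^ n := by
  intro e
  refine h ⟨n - m, ?_⟩
  rw [zpow_sub₀ hq0, zpow_natCast, zpow_natCast, mul_div_assoc', ← e]
  field_simp

theorem pow_injective_of_norm_lt_one {q : ℂ} (hq0 : q ≠ 0) (hq : ‖q‖ < 1) :
    Function.Injective fun n : ℕ => q ^ n := by
  intro m n h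
  have := congrArg norm h
  simp only [norm_pow] at this
  exact pow_right_injective₀ (norm_pos_iff.2 hq0) hq.ne this

theorem qPoch_div_eq_sum {q a a' a'' b t : ℂ} (hq0 : q ≠ 0) (hq : ‖q‖ < 1)
    (ha : a ≠ 0) (ha' : a' ≠ 0) (ha'' : a'' ≠ 0) (h1 : a ∉ qSpiral q a') (h2 : a ∉ qSpiral q a'')
    (h3 : a' ∉ qSpiral q a'') (ht : ∀ m : ℕ, 1 - a * q ^ m * t ≠ 0)
    (ht' : ∀ m : ℕ, 1 - a' * q ^ m * t ≠ 0) (ht'' : ∀ m : ℕ, 1 - a'' * q ^ m * t ≠ 0)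
    {N : ℕ} (hN : 0 < N) :
    qPoch q (b * t) N * qPoch q (q * t) N /
        (qPoch q (a * t) N * qPoch q (a' * t) N * qPoch q (a'' * t) N) =
      (∑ m ∈ Finset.range N, finResidue q a a' a'' b N m / (1 - a * q ^ m * t)) +
      (∑ m ∈ Finset.range N, finResidue q a' a a'' b N m / (1 - a' * q ^ m * t)) +
      ∑ m ∈ Finset.range N, finResidue q a'' a' a b N m / (1 - a'' * q ^ m * t) := by
  set A : Fin 3 → ℂ := ![a, a', a''] with hA
  set c : Fin 3 × ℕ → ℂ := fun p => A p.1 * q ^ p.2 with hcdef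
  set s : Finset (Fin 3 × ℕ) := Finset.univ ×ˢ Finset.range N with hs
  have hA0 : ∀ j, A j ≠ 0 := by
    intro j; fin_cases j <;> simpa [hA]
  have hAA : ∀ j k, j ≠ k → A j ∉ qSpiral q (A k) := by
    intro j k hjk
    fin_cases j <;> fin_cases k <;>
      first
      | exact absurd rfl hjk
      | simpa [hA] using h1
      | simpa [hA] using h2
      | simpa [hA] using h3
      | simpa [hA] using not_mem_qSpiral_comm hq0 h1
      | simpa [hA] using not_mem_qSpiral_comm hq0 h2
      | simpa [hA] using not_mem_qSpiral_comm hq0 h3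
  have hc : ∀ i ∈ s, c i ≠ 0 := fun i _ => mul_ne_zero (hA0 _) (pow_ne_zero _ hq0)
  have hinj : Set.InjOn c s := by
    rintro ⟨j, m⟩ _ ⟨k, n⟩ _ h
    by_cases hjk : j = k
    · subst hjk
      have := pow_injective_of_norm_lt_one hq0 hq (mul_left_cancel₀ (hA0 j) h)
      exact Prod.ext rfl this
    · exact absurd h (mul_pow_ne_mul_pow hq0 (hAA j k hjk) m n)
  have hcard : s.card = 3 * N := by simp [hs]
  -- The degree is at most `2N`, against `3N` poles; strictness is where `N > 0` enters.
  have hdeg : (qPochPoly q b N * qPochPoly q q N).degree < s.card := by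
    refine (Polynomial.degree_le_natDegree).trans_lt ?_
    rw [hcard]
    have := (Polynomial.natDegree_mul_le (p := qPochPoly q b N) (q := qPochPoly q q N)).trans
      (add_le_add (natDegree_qPochPoly_le q b N) (natDegree_qPochPoly_le q q N))
    exact_mod_cast this.trans_lt (by omega)
  have htA : ∀ i ∈ s, 1 - c i * t ≠ 0 := by
    rintro ⟨j, m⟩ _
    fin_cases j
    · simpa [hcdef, hA] using ht m
    · simpa [hcdef, hA] using ht' m
    · simpa [hcdef, hA] using ht'' m
  have key := eval_div_prod_eq_sum hc hinj hdeg htA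
  have hprod : ∀ (j : Fin 3) (x : ℂ), ∏ i ∈ Finset.range N, (1 - c (j, i) * x) =
      qPoch q (A j * x) N := fun j x => by
    rw [qPoch]
    exact Finset.prod_congr rfl fun i _ => by simp only [hcdef]; ring
  have e0 : (Finset.univ : Finset (Fin 3)).erase 0 = {1, 2} := by decide
  have e1 : (Finset.univ : Finset (Fin 3)).erase 1 = {0, 2} := by decide
  have e2 : (Finset.univ : Finset (Fin 3)).erase 2 = {0, 1} := by decide
  rw [hs, Finset.prod_product, Finset.sum_product, Fin.sum_univ_three, Fin.prod_univ_three,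
    hprod, hprod, hprod, Polynomial.eval_mul, eval_qPochPoly, eval_qPochPoly] at key
  rw [show qPoch q (a * t) N * qPoch q (a' * t) N * qPoch q (a'' * t) N =
    qPoch q (A 0 * t) N * qPoch q (A 1 * t) N * qPoch q (A 2 * t) N from rfl, key]
  have hx : ∀ (y : ℂ) (j : Fin 3) (m : ℕ), y * (c (j, m))⁻¹ = y / A j / q ^ m := fun y j m => by
    simp only [hcdef]
    rw [mul_inv, div_div, div_eq_mul_inv, mul_inv]
  have hself : ∀ (j : Fin 3) (m : ℕ), ∏ i ∈ (Finset.range N).erase m, (1 - c (j, i) * (c (j, m))⁻¹)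
      = ∏ i ∈ (Finset.range N).erase m, (1 - q ^ i / q ^ m) := fun j m => by
    refine Finset.prod_congr rfl fun i _ => ?_
    rw [hx]
    simp only [hcdef]
    rw [mul_div_cancel_left₀ _ (hA0 j)]
  congr 1
  · congr 1
    · refine Finset.sum_congr rfl fun m _ => ?_
      rw [prod_product_erase _ _ (Finset.mem_univ _), e0, Finset.prod_pair (by decide), hself, hprod,
        hprod, Polynomial.eval_mul, eval_qPochPoly, eval_qPochPoly]
      simp only [hx]
      rfl
    · refine Finset.sum_congr rfl fun m _ => ?_
      rw [prod_product_erase _ _ (Finset.mem_univ _), e1, Finset.prod_pair (by decide), hself, hprod,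
        hprod, Polynomial.eval_mul, eval_qPochPoly, eval_qPochPoly]
      simp only [hx]
      rfl
  · refine Finset.sum_congr rfl fun m _ => ?_
    rw [prod_product_erase _ _ (Finset.mem_univ _), e2, Finset.prod_pair (by decide), hself, hprod,
      hprod, Polynomial.eval_mul, eval_qPochPoly, eval_qPochPoly, mul_comm (qPoch q (A 0 * _) N)]
    simp only [hx]
    rfl

/-- The coefficients of the entire series which describe `₃φ₂(a, a', a''; b, 0; q, ·)` near
infinity. -/
noncomputable def inftyCoeff (q a a' a'' b : ℂ) (m : ℕ) : ℂ :=
  gaussPow q (m + 1) * hyp32Coeff q a (a * q / b) 0 (a * q / a') (a * q / a'') m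

/-- The indices below `m` give `(q^{-m};q)_m`, which is reversed, and those above `m` give
`(q;q)_n`. -/
theorem prod_erase_one_sub_pow_div {q : ℂ} (hq0 : q ≠ 0) (m n : ℕ) :
    ∏ i ∈ (Finset.range (m + 1 + n)).erase m, (1 - q ^ i / q ^ m) =
      (-1) ^ m / gaussPow q (m + 1) * qPoch q q m * qPoch q q n := by
  have h1 := qPoch_div_pow hq0 one_ne_zero m
  rw [div_one] at h1
  rw [← h1]
  set f : ℕ → ℂ := fun i => if i = m then 1 else 1 - q ^ i / q ^ m with hf
  have e : ∏ i ∈ (Finset.range (m + 1 + n)).erase m, (1 - q ^ i / q ^ m) =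
      ∏ i ∈ (Finset.range (m + 1 + n)).erase m, f i :=
    Finset.prod_congr rfl fun i hi => by rw [hf]; simp only [if_neg (Finset.ne_of_mem_erase hi)]
  rw [e, Finset.prod_erase _ (by simp [hf]), Finset.prod_range_add, Finset.prod_range_succ]
  congr 1
  · rw [show f m = 1 by simp [hf], mul_one, qPoch]
    refine Finset.prod_congr rfl fun i hi => ?_
    rw [hf]
    simp only [if_neg (Finset.mem_range.1 hi).ne]
    ring
  · refine Finset.prod_congr rfl fun i _ => ?_
    rw [hf]
    simp only [if_neg (show m + 1 + i ≠ m by omega)]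
    rw [pow_add, pow_succ]
    field_simp

theorem div_mul_pow_ne_one {q a b : ℂ} (h : a ∉ qSpiral q b) (ha : a ≠ 0) (k : ℕ) :
    b / a * q ^ k ≠ 1 := fun e => h ⟨k, by
  rw [zpow_natCast]; field_simp at e; exact e.symm⟩

theorem mul_div_mul_pow_ne_one {q a b : ℂ} (hq0 : q ≠ 0) (h : a ∉ qSpiral q b) (hb : b ≠ 0)
    (k : ℕ) : a * q / b * q ^ k ≠ 1 := fun e => h ⟨-((k : ℤ) + 1), by
  rw [zpow_neg, zpow_add₀ hq0, zpow_natCast, zpow_one]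
  field_simp at e ⊢
  linear_combination e⟩

/-- Reversing the shifted products yields two factors `1/gaussPow q (m + 1)` above and three below,
so exactly one Gaussian survives. What remains splits into a part depending on `m` alone and a part
depending on `n = N - m - 1` alone, which isolates the limit `N → ∞`. -/
theorem finResidue_eq {q a a' a'' b : ℂ} (hq0 : q ≠ 0) (ha : a ≠ 0) (ha' : a' ≠ 0) (ha'' : a'' ≠ 0)
    (hb : b ≠ 0) (m n : ℕ) :
    finResidue q a a' a'' b (m + 1 + n) m =
      inftyCoeff q a a' a'' b m * (-(b * q / (a' * a''))) ^ m *
        (qPoch q (b / a) (n + 1) * qPoch q (q / a) (n + 1) /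
          (qPoch q (a' / a) (n + 1) * qPoch q (a'' / a) (n + 1) * qPoch q q n)) := by
  have key : ∀ y : ℂ, y ≠ 0 → qPoch q (y / a / q ^ m) (m + 1 + n) =
      (-(y / a)) ^ m / gaussPow q (m + 1) * qPoch q (a * q / y) m * qPoch q (y / a) (n + 1) := by
    intro y hy
    have e1 : y / a / q ^ m * q ^ m = y / a := by field_simp
    have e2 : q / (y / a) = a * q / y := by field_simp
    rw [add_assoc, add_comm 1 n, qPoch_add, e1, qPoch_div_pow hq0 (div_ne_zero hy ha), e2]
  have hg := gaussPow_ne_zero hq0 (m + 1)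
  have e3 : a * q / q = a := by field_simp
  rw [finResidue, prod_erase_one_sub_pow_div hq0, key b hb, key q hq0, key a' ha', key a'' ha'', e3,
    inftyCoeff, hyp32Coeff, qPoch_zero_left]
  have e4 : (-(b * q / (a' * a''))) ^ m =
      (-(b / a)) ^ m * (-(q / a)) ^ m / ((-1) ^ m * ((-(a' / a)) ^ m * (-(a'' / a)) ^ m)) := by
    rw [← mul_pow, ← mul_pow, ← mul_pow, ← div_pow]
    congr 1
    field_simp
  rw [e4]
  generalize (-(b / a)) ^ m = x1
  generalize (-(q / a)) ^ m = x2
  generalize (-(a' / a)) ^ m = x3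
  generalize (-(a'' / a)) ^ m = x4
  generalize ((-1 : ℂ)) ^ m = x5
  generalize gaussPow q (m + 1) = g at *
  have hG : g⁻¹ * g⁻¹ * (g * g * g) = g := by field_simp
  simp only [div_eq_mul_inv, mul_inv, inv_inv, mul_one]
  generalize g⁻¹ = i at *
  generalize qPoch q (a * q * b⁻¹) m = y1
  generalize qPoch q a m = y2
  generalize (qPoch q (a * q * a'⁻¹) m)⁻¹ = y3
  generalize (qPoch q (a * q * a''⁻¹) m)⁻¹ = y4
  generalize (qPoch q q m)⁻¹ = y5
  generalize qPoch q (b * a⁻¹) (n + 1) = z1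
  generalize qPoch q (q * a⁻¹) (n + 1) = z2
  generalize (qPoch q (a' * a⁻¹) (n + 1))⁻¹ = z3
  generalize (qPoch q (a'' * a⁻¹) (n + 1))⁻¹ = z4
  generalize (qPoch q q n)⁻¹ = z5
  generalize x3⁻¹ = w3
  generalize x4⁻¹ = w4
  generalize x5⁻¹ = w5
  linear_combination
    x1 * x2 * w3 * w4 * w5 * y1 * y2 * y3 * y4 * y5 * z1 * z2 * z3 * z4 * z5 * hG

theorem summable_gaussPow_mul_of_bounded {q : ℂ} (hq0 : q ≠ 0) (hq : ‖q‖ < 1) {u : ℕ → ℂ} {C : ℝ}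
    (hC : ∀ n, ‖u n‖ ≤ C) (y : ℂ) :
    Summable fun m : ℕ => ‖gaussPow q (m + 1) * u m * y ^ m‖ := by
  refine Summable.of_nonneg_of_le (fun _ => norm_nonneg _) (fun m => ?_)
    ((summable_gaussPow_mul_pow hq0 hq (q * y)).mul_left C)
  rw [gaussPow_add_one hq0, zpow_natCast, mul_pow, mul_right_comm, norm_mul _ (u m), mul_comm]
  simp only [norm_mul]
  rw [mul_assoc ‖gaussPow q m‖]
  exact mul_le_mul_of_nonneg_right (hC m) (by positivity)

theorem summable_inftyCoeff {q a a' a'' b : ℂ} (hq0 : q ≠ 0) (hq : ‖q‖ < 1) (ha' : a' ≠ 0)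
    (ha'' : a'' ≠ 0) (h1 : a ∉ qSpiral q a') (h2 : a ∉ qSpiral q a'') (y : ℂ) :
    Summable fun m : ℕ => ‖inftyCoeff q a a' a'' b m * y ^ m‖ := by
  obtain ⟨C, -, hC⟩ := exists_norm_hyp32Coeff_le (α := a) (β := a * q / b) (γ := 0) hq
    (mul_div_mul_pow_ne_one hq0 h1 ha') (mul_div_mul_pow_ne_one hq0 h2 ha'')
  exact summable_gaussPow_mul_of_bounded hq0 hq hC y

/-- The constant in front of the residues of `(bt, qt;q)_∞ / (at, a't, a''t;q)_∞`. -/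
noncomputable def residueConst (q a a' a'' b : ℂ) : ℂ :=
  qPochInf q (b / a) * qPochInf q (q / a) /
    (qPochInf q (a' / a) * qPochInf q (a'' / a) * qPochInf q q)

/-- Dominated convergence applies: the surviving Gaussian makes the bound summable whatever the size
of `bq/(a'a'')`. -/
theorem tendsto_sum_finResidue {q a a' a'' b t : ℂ} (hq0 : q ≠ 0) (hq : ‖q‖ < 1)
    (ha : a ≠ 0) (ha' : a' ≠ 0) (ha'' : a'' ≠ 0) (hb : b ≠ 0) (h1 : a ∉ qSpiral q a')
    (h2 : a ∉ qSpiral q a'') :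
    Tendsto (fun N => ∑ m ∈ Finset.range N, finResidue q a a' a'' b N m / (1 - a * q ^ m * t)) atTop
      (𝓝 (∑' m : ℕ, inftyCoeff q a a' a'' b m * (-(b * q / (a' * a''))) ^ m *
        residueConst q a a' a'' b / (1 - a * q ^ m * t))) := by
  set tl : ℕ → ℂ := fun n => qPoch q (b / a) (n + 1) * qPoch q (q / a) (n + 1) /
          (qPoch q (a' / a) (n + 1) * qPoch q (a'' / a) (n + 1) * qPoch q q n) with htl
  have htlim : Tendsto tl atTop (𝓝 (residueConst q a a' a'' b)) := by
    have hi : ∀ x, Tendsto (fun n => qPoch q x (n + 1)) atTop (𝓝 (qPochInf q x)) :=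
      fun x => (tendsto_add_atTop_iff_nat 1).2 (tendsto_qPoch hq x)
    exact ((hi _).mul (hi _)).div (((hi _).mul (hi _)).mul (tendsto_qPoch hq q))
      (mul_ne_zero (mul_ne_zero (qPochInf_ne_zero hq (div_mul_pow_ne_one h1 ha))
        (qPochInf_ne_zero hq (div_mul_pow_ne_one h2 ha)))
        (qPochInf_ne_zero hq (self_mul_pow_ne_one hq)))
  obtain ⟨C, hC0, hC⟩ := exists_norm_le_of_tendsto htlim
  have hinv : Tendsto (fun m : ℕ => (1 - a * q ^ m * t)⁻¹) atTop (𝓝 (1 - a * 0 * t)⁻¹) :=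
    (tendsto_const_nhds.sub (((tendsto_pow_atTop_nhds_zero_of_norm_lt_one hq).const_mul
      a).mul_const t)).inv₀ (by simp)
  obtain ⟨D, hD0, hD⟩ := exists_norm_le_of_tendsto hinv
  have hfin : ∀ N m : ℕ, m < N → finResidue q a a' a'' b N m =
      inftyCoeff q a a' a'' b m * (-(b * q / (a' * a''))) ^ m * tl (N - (m + 1)) := by
    intro N m h
    obtain ⟨n, rfl⟩ := Nat.exists_eq_add_of_le (Nat.succ_le_of_lt h)
    rw [Nat.succ_eq_add_one, Nat.add_sub_cancel_left, finResidue_eq hq0 ha ha' ha'' hb]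
  have lim := tendsto_tsum_of_dominated_convergence (𝓕 := atTop)
    (f := fun (N : ℕ) (m : ℕ) => if m ∈ Finset.range N then
        finResidue q a a' a'' b N m / (1 - a * q ^ m * t) else 0)
    (g := fun m => inftyCoeff q a a' a'' b m * (-(b * q / (a' * a''))) ^ m *
        residueConst q a a' a'' b / (1 - a * q ^ m * t))
    ((summable_inftyCoeff (b := b) hq0 hq ha' ha'' h1 h2 (-(b * q / (a' * a'')))).mul_right (C * D))
    (fun m => ?_) (Eventually.of_forall fun N m => ?_)
  · refine lim.congr fun N => ?_
    rw [tsum_eq_sum (s := Finset.range N) (fun n hn => if_neg hn)]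
    exact Finset.sum_congr rfl fun m hm => if_pos hm
  · have h3 : Tendsto (fun N : ℕ => N - (m + 1)) atTop atTop := tendsto_sub_atTop_nat _
    have h4 := ((htlim.comp h3).const_mul (inftyCoeff q a a' a'' b m *
      (-(b * q / (a' * a''))) ^ m)).div_const (1 - a * q ^ m * t)
    refine h4.congr' ?_
    filter_upwards [eventually_gt_atTop m] with N hN
    rw [if_pos (Finset.mem_range.2 hN), hfin N m hN]
    rfl
  · split_ifs with h
    · rw [hfin N m (Finset.mem_range.1 h), div_eq_mul_inv, mul_assoc _ (tl _), norm_mul]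
      gcongr
      rw [norm_mul]
      gcongr
      · exact hC _
      · exact hD _
    · rw [norm_zero]; positivity

/-- The partial fraction expansion of `(bt, qt;q)_∞ / (at, a't, a''t;q)_∞`. -/
theorem qPochInf_div_eq_tsum {q a a' a'' b t : ℂ} (hq0 : q ≠ 0) (hq : ‖q‖ < 1)
    (ha : a ≠ 0) (ha' : a' ≠ 0) (ha'' : a'' ≠ 0) (hb : b ≠ 0) (h1 : a ∉ qSpiral q a')
    (h2 : a ∉ qSpiral q a'') (h3 : a' ∉ qSpiral q a'') (ht : ∀ m : ℕ, 1 - a * q ^ m * t ≠ 0)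
    (ht' : ∀ m : ℕ, 1 - a' * q ^ m * t ≠ 0) (ht'' : ∀ m : ℕ, 1 - a'' * q ^ m * t ≠ 0) :
    qPochInf q (b * t) * qPochInf q (q * t) /
        (qPochInf q (a * t) * qPochInf q (a' * t) * qPochInf q (a'' * t)) =
      (∑' m : ℕ, inftyCoeff q a a' a'' b m * (-(b * q / (a' * a''))) ^ m *
        residueConst q a a' a'' b / (1 - a * q ^ m * t)) +
      (∑' m : ℕ, inftyCoeff q a' a a'' b m * (-(b * q / (a * a''))) ^ m *
        residueConst q a' a a'' b / (1 - a' * q ^ m * t)) +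
      ∑' m : ℕ, inftyCoeff q a'' a' a b m * (-(b * q / (a' * a))) ^ m *
        residueConst q a'' a' a b / (1 - a'' * q ^ m * t) := by
  have hne : ∀ x, (∀ m : ℕ, 1 - x * q ^ m * t ≠ 0) → qPochInf q (x * t) ≠ 0 := fun x hx =>
    qPochInf_ne_zero hq fun k h => hx k (by rw [mul_right_comm, h, sub_self])
  have hi : ∀ x, Tendsto (qPoch q x) atTop (𝓝 (qPochInf q x)) := tendsto_qPoch hq
  have hL := ((hi (b * t)).mul (hi (q * t))).div (((hi (a * t)).mul (hi (a' * t))).mul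
    (hi (a'' * t))) (mul_ne_zero (mul_ne_zero (hne a ht) (hne a' ht')) (hne a'' ht''))
  have h1' := not_mem_qSpiral_comm hq0 h1
  have h2' := not_mem_qSpiral_comm hq0 h2
  have h3' := not_mem_qSpiral_comm hq0 h3
  have hR := ((tendsto_sum_finResidue (t := t) hq0 hq ha ha' ha'' hb h1 h2).add
    (tendsto_sum_finResidue (t := t) hq0 hq ha' ha ha'' hb h1' h3)).add
    (tendsto_sum_finResidue (t := t) hq0 hq ha'' ha' ha hb h3' h2')
  refine tendsto_nhds_unique hL (hR.congr' ?_)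
  filter_upwards [eventually_gt_atTop 0] with N hN
  exact (qPoch_div_eq_sum hq0 hq ha ha' ha'' h1 h2 h3 ht ht' ht'' hN).symm

/-! ### The bilateral sum `∑ z^n/(1 - aq^n)` in closed form. -/

/-- The equivalence `(n, i) ↦ (n + e i, i)`. -/
def shearEquiv {ι : Type*} (e : ι → ℤ) : ℤ × ι ≃ ℤ × ι where
  toFun p := (p.1 + e p.2, p.2)
  invFun p := (p.1 - e p.2, p.2)
  left_inv p := by simp
  right_inv p := by simp

/-- This one rearrangement serves three times: for theta times Kronecker's sum, for that sum times
the series at infinity, and for theta times `₃φ₂` in the Laplace transform. -/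
theorem hasSum_shear {ι : Type*} {f : ℤ → ℂ} {g : ι → ℂ} (e : ι → ℤ)
    (hf : Summable fun n => ‖f n‖) (hg : Summable fun i => ‖g i‖) :
    HasSum (fun n : ℤ => ∑' i, f (n + e i) * g i) ((∑' n, f n) * ∑' i, g i) := by
  have h := (summable_mul_of_summable_norm hf hg).hasSum
  rw [← tsum_mul_tsum_of_summable_norm hf hg] at h
  have h2 := (Equiv.hasSum_iff (shearEquiv e)).2 h
  exact h2.prod_fiberwise fun n => (h2.summable.prod_factor n).hasSum

theorem one_sub_mul_zpow_ne_zero {q a : ℂ} (hq0 : q ≠ 0) (ha : a ∉ qSpiral q 1) (n : ℤ) :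
    1 - a * q ^ n ≠ 0 := fun h => ha ⟨-n, by
  have := zpow_ne_zero n hq0
  rw [zpow_neg]
  field_simp
  linear_combination -h⟩

/-- Boundedness for `n ≥ 0` and decay like `|q|^n` at `-n` are what make `∑ z^n/(1 - aq^n)` converge
for `|q| < |z| < 1`. -/
theorem exists_norm_inv_one_sub_le {q a : ℂ} (hq0 : q ≠ 0) (hq : ‖q‖ < 1) (ha0 : a ≠ 0)
    (ha : a ∉ qSpiral q 1) : ∃ C : ℝ, 0 < C ∧ (∀ n : ℕ, ‖(1 - a * q ^ n)⁻¹‖ ≤ C) ∧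
      ∀ n : ℕ, ‖(1 - a * q ^ (-(n : ℤ)))⁻¹‖ ≤ C * ‖q‖ ^ n := by
  have hp := tendsto_pow_atTop_nhds_zero_of_norm_lt_one hq
  obtain ⟨C, hC0, hC⟩ := exists_norm_le_of_tendsto ((tendsto_const_nhds (x := (1 : ℂ))).sub
    (hp.const_mul a) |>.inv₀ (by simp))
  obtain ⟨D, hD0, hD⟩ := exists_norm_le_of_tendsto ((hp.sub (tendsto_const_nhds (x := a))).inv₀
    (by simpa using ha0))
  refine ⟨max C D, by positivity, fun n => (hC n).trans (le_max_left _ _), fun n => ?_⟩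
  have e : (1 - a * q ^ (-(n : ℤ)))⁻¹ = (q ^ n - a)⁻¹ * q ^ n := by
    have h1 := one_sub_mul_zpow_ne_zero hq0 ha (-(n : ℤ))
    have h2 : q ^ n - a = q ^ n * (1 - a * q ^ (-(n : ℤ))) := by
      rw [zpow_neg, zpow_natCast]; field_simp
    rw [h2]
    field_simp
  rw [e, norm_mul, norm_pow]
  exact mul_le_mul_of_nonneg_right ((hD n).trans (le_max_right _ _)) (by positivity)

theorem summable_pow_natAbs {r : ℝ} (h0 : 0 ≤ r) (h1 : r < 1) :
    Summable fun n : ℤ => r ^ n.natAbs := by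
  refine Summable.of_nat_of_neg ?_ ?_ <;>
    simpa using summable_geometric_of_lt_one h0 h1

theorem norm_lerch_term_le {q a z : ℂ} (hq0 : q ≠ 0) {C : ℝ}
    (hC1 : ∀ n : ℕ, ‖(1 - a * q ^ n)⁻¹‖ ≤ C)
    (hC2 : ∀ n : ℕ, ‖(1 - a * q ^ (-(n : ℤ)))⁻¹‖ ≤ C * ‖q‖ ^ n) {r : ℝ} (hz : z ≠ 0) (h1 : ‖z‖ ≤ r)
    (h2 : ‖q‖ / ‖z‖ ≤ r) (n : ℤ) : ‖z ^ n * (1 - a * q ^ n)⁻¹‖ ≤ C * r ^ n.natAbs := by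
  have hzn : 0 < ‖z‖ := norm_pos_iff.2 hz
  have hC0 : 0 ≤ C := (norm_nonneg _).trans (hC1 0)
  obtain ⟨m, rfl | rfl⟩ := n.eq_nat_or_neg
  · rw [norm_mul, mul_comm, zpow_natCast, zpow_natCast, norm_pow, Int.natAbs_natCast]
    gcongr
    exact hC1 m
  · rw [norm_mul, norm_zpow, Int.natAbs_neg, Int.natAbs_natCast, zpow_neg, zpow_natCast]
    calc _ ≤ (‖z‖ ^ m)⁻¹ * (C * ‖q‖ ^ m) := by gcongr; exact hC2 m
      _ = C * (‖q‖ / ‖z‖) ^ m := by rw [div_pow]; ring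
      _ ≤ _ := by gcongr

theorem summable_lerch {q a z : ℂ} (hq0 : q ≠ 0) (hq : ‖q‖ < 1) (ha0 : a ≠ 0)
    (ha : a ∉ qSpiral q 1) (hz1 : ‖q‖ < ‖z‖) (hz2 : ‖z‖ < 1) :
    Summable fun n : ℤ => ‖z ^ n * (1 - a * q ^ n)⁻¹‖ := by
  obtain ⟨C, hC0, hC1, hC2⟩ := exists_norm_inv_one_sub_le hq0 hq ha0 ha
  have hz : z ≠ 0 := norm_pos_iff.1 ((norm_nonneg q).trans_lt hz1)
  have hr : max ‖z‖ (‖q‖ / ‖z‖) < 1 := max_lt hz2 ((div_lt_one (norm_pos_iff.2 hz)).2 hz1)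
  exact Summable.of_nonneg_of_le (fun _ => norm_nonneg _)
    (norm_lerch_term_le hq0 hC1 hC2 hz (le_max_left _ _) (le_max_right _ _))
    ((summable_pow_natAbs (le_max_of_le_left (norm_nonneg _)) hr).mul_left C)

/-- The Laurent coefficients of `θ(-z) ∑ z^n / (1 - a q^n)`. -/
noncomputable def lerchCoeff (q a : ℂ) (N : ℤ) : ℂ :=
  ∑' k : ℤ, gaussPow q k * (-1) ^ k * (1 - a * q ^ (N - k))⁻¹

theorem exists_norm_inv_one_sub_zpow_le {q a : ℂ} (hq0 : q ≠ 0) (hq : ‖q‖ < 1) (ha0 : a ≠ 0)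
    (ha : a ∉ qSpiral q 1) : ∃ C : ℝ, ∀ n : ℤ, ‖(1 - a * q ^ n)⁻¹‖ ≤ C := by
  obtain ⟨C, hC0, hC1, hC2⟩ := exists_norm_inv_one_sub_le hq0 hq ha0 ha
  refine ⟨C, fun n => ?_⟩
  obtain ⟨m, rfl | rfl⟩ := n.eq_nat_or_neg
  · exact_mod_cast hC1 m
  · refine (hC2 m).trans ?_
    exact mul_le_of_le_one_right hC0.le (pow_le_one₀ (norm_nonneg _) hq.le)

theorem hasSum_lerchCoeff {q a : ℂ} (hq0 : q ≠ 0) (hq : ‖q‖ < 1) (ha0 : a ≠ 0)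
    (ha : a ∉ qSpiral q 1) (N : ℤ) :
    HasSum (fun k : ℤ => gaussPow q k * (-1) ^ k * (1 - a * q ^ (N - k))⁻¹) (lerchCoeff q a N) := by
  obtain ⟨C, hC⟩ := exists_norm_inv_one_sub_zpow_le hq0 hq ha0 ha
  have h := summable_gaussPow_mul_zpow hq0 hq (u := fun k => (1 - a * q ^ (N - k))⁻¹)
    (fun k => hC (N - k)) (-1) (-1)
  simp only [ite_self] at h
  exact (h.of_norm.congr fun k => mul_right_comm _ _ _).hasSum

theorem lerchCoeff_add_one {q a : ℂ} (hq0 : q ≠ 0) (hq : ‖q‖ < 1) (ha0 : a ≠ 0)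
    (ha : a ∉ qSpiral q 1) (N : ℤ) : lerchCoeff q a (N + 1) = -a * q ^ N * lerchCoeff q a N := by
  have h1 := (Equiv.hasSum_iff (Equiv.addRight (1 : ℤ))).2 (hasSum_lerchCoeff hq0 hq ha0 ha (N + 1))
  have h2 := (hasSum_lerchCoeff hq0 hq ha0 ha N).mul_left (-a * q ^ N)
  -- Shifting `k` and writing `q^k = q^k(1 - aq^{N-k}) + aq^N` leaves, besides the wanted sum, a
  -- multiple of `θ(-q) = 0`.
  have h3 := (hasSum_qTheta hq0 hq (q * -1)).mul_left (-1)
  have h4 : qTheta q (q * -1) = 0 := by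
    rw [qTheta_mul_left hq0 (by norm_num), qTheta_neg_one hq0 hq, zero_div]
  have h5 := h2.add h3
  rw [h4, mul_zero, add_zero] at h5
  refine h1.unique (h5.congr_fun fun k => ?_)
  have h6 := one_sub_mul_zpow_ne_zero hq0 ha (N - k)
  have e : q ^ N = q ^ k * q ^ (N - k) := by rw [← zpow_add₀ hq0]; congr 1; ring
  simp only [Function.comp_apply, Equiv.coe_addRight]
  rw [show N + 1 - (k + 1) = N - k by ring, gaussPow_add_one hq0, zpow_add₀ (by norm_num), mul_zpow,
    zpow_one, e]
  field_simp
  ring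

theorem lerchCoeff_eq {q a : ℂ} (hq0 : q ≠ 0) (hq : ‖q‖ < 1) (ha0 : a ≠ 0)
    (ha : a ∉ qSpiral q 1) (N : ℤ) :
    lerchCoeff q a N = gaussPow q N * (-a) ^ N * lerchCoeff q a 0 := by
  have h0 : -a ≠ 0 := neg_ne_zero.2 ha0
  induction N using Int.induction_on with
  | zero => simp [gaussPow_zero]
  | succ n ih =>
    rw [lerchCoeff_add_one hq0 hq ha0 ha, ih, gaussPow_add_one hq0, zpow_add₀ h0, zpow_one]
    ring
  | pred n ih =>
    have h := lerchCoeff_add_one hq0 hq ha0 ha (-(n : ℤ) - 1)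
    have hg := gaussPow_add_one hq0 (-(n : ℤ) - 1)
    have hz : (-a) ^ (-(n : ℤ)) = (-a) ^ (-(n : ℤ) - 1) * (-a) := by
      rw [← zpow_add_one₀ h0, sub_add_cancel]
    rw [sub_add_cancel] at h hg
    rw [ih, hg, hz] at h
    have h1 := zpow_ne_zero (-(n : ℤ) - 1) hq0
    apply mul_left_cancel₀ (mul_ne_zero h0 h1)
    linear_combination -h

/-- By their recursion the Laurent coefficients of the product are `q^{N(N-1)/2}(-a)^N` times the
coefficient at `0`, that is, those of `θ(-az)` up to a constant. -/
theorem lerch_mul_qTheta {q a z : ℂ} (hq0 : q ≠ 0) (hq : ‖q‖ < 1) (ha0 : a ≠ 0)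
    (ha : a ∉ qSpiral q 1) (hz1 : ‖q‖ < ‖z‖) (hz2 : ‖z‖ < 1) :
    (∑' n : ℤ, z ^ n * (1 - a * q ^ n)⁻¹) * qTheta q (-z) =
      lerchCoeff q a 0 * qTheta q (-(a * z)) := by
  have hz : z ≠ 0 := norm_pos_iff.1 ((norm_nonneg q).trans_lt hz1)
  have h := hasSum_shear (fun k : ℤ => -k) (summable_lerch hq0 hq ha0 ha hz1 hz2)
    (summable_theta hq0 hq (-z))
  refine h.unique (((hasSum_qTheta hq0 hq (-(a * z))).mul_left (lerchCoeff q a 0)).congr_fun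
    fun N => ?_)
  have e : lerchCoeff q a 0 * (gaussPow q N * (-(a * z)) ^ N) = lerchCoeff q a N * z ^ N := by
    rw [lerchCoeff_eq hq0 hq ha0 ha N, neg_mul_eq_neg_mul, mul_zpow]
    ring
  rw [e, lerchCoeff, ← tsum_mul_right]
  refine tsum_congr fun k => ?_
  rw [← sub_eq_add_neg, zpow_sub₀ hz, neg_eq_neg_one_mul z, mul_zpow]
  field_simp

/-- The constant is found by letting `z → 1`: the sum has the polar part `1/(1 - z)`, while the
triple product gives `θ(-z)/(1 - z) → (q;q)_∞^3`. -/
theorem lerchCoeff_zero_mul_qTheta {q a : ℂ} (hq0 : q ≠ 0) (hq : ‖q‖ < 1) (ha0 : a ≠ 0)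
    (ha : a ∉ qSpiral q 1) : lerchCoeff q a 0 * qTheta q (-a) = qPochInf q q ^ 3 := by
  obtain ⟨C, hC0, hC1, hC2⟩ := exists_norm_inv_one_sub_le hq0 hq ha0 ha
  have hqn : 0 < ‖q‖ := norm_pos_iff.2 hq0
  obtain ⟨ρ, hρ1, hρ2⟩ := exists_between hq
  have hρ0 : 0 < ρ := hqn.trans hρ1
  set r : ℝ := ‖q‖ / ρ with hr
  have hr0 : 0 ≤ r := by positivity
  have hr1 : r < 1 := (div_lt_one hρ0).2 hρ1
  have hqr : ‖q‖ ≤ r := (le_div_iff₀ hρ0).2 (mul_le_of_le_one_right hqn.le hρ2.le)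
  set S : ℂ → ℂ := fun z => ∑' n : ℤ, z ^ n * (1 - a * q ^ n)⁻¹ with hS
  set M : ℝ := ∑' n : ℤ, (‖a‖ + 1) * C * r ^ n.natAbs with hM
  -- Subtracting `z^n` for `n ≥ 0` leaves `z^n aq^n/(1 - aq^n)`, and for `n = -m < 0` the condition
  -- `|z| > ρ > |q|` gives terms of size `(|q|/ρ)^m`. The bound is therefore uniform up to `|z| =
  -- 1`.
  have hbound : ∀ z : ℂ, ρ < ‖z‖ → ‖z‖ < 1 → ‖S z - (1 - z)⁻¹‖ ≤ M := by
    intro z hz1 hz2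
    have hz : z ≠ 0 := norm_pos_iff.1 (hρ0.trans hz1)
    have g1 := (summable_lerch hq0 hq ha0 ha (hρ1.trans hz1) hz2).of_norm.hasSum
    have g2 : HasSum (fun n : ℤ => if 0 ≤ n then z ^ n else 0) (1 - z)⁻¹ := by
      have g3 := hasSum_geometric_of_norm_lt_one hz2
      refine (Function.Injective.hasSum_iff (Nat.cast_injective (R := ℤ)) ?_).1
        (g3.congr_fun fun n => by simp)
      intro n hn
      refine if_neg fun h => hn ⟨n.toNat, by simpa using h⟩
    have g4 := g1.sub g2
    rw [show S z - (1 - z)⁻¹ = _ from g4.tsum_eq.symm]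
    refine tsum_of_norm_bounded ((summable_pow_natAbs hr0 hr1).mul_left _).hasSum fun n => ?_
    obtain ⟨m, rfl | rfl⟩ := n.eq_nat_or_neg
    · have h1 := one_sub_mul_zpow_ne_zero hq0 ha m
      rw [zpow_natCast] at h1
      have e : z ^ (m : ℤ) * (1 - a * q ^ (m : ℤ))⁻¹ - (if 0 ≤ (m : ℤ) then z ^ (m : ℤ) else 0) =
          z ^ m * (a * (1 - a * q ^ m)⁻¹ * q ^ m) := by
        rw [if_pos (by positivity), zpow_natCast, zpow_natCast]
        field_simp
        ring
      rw [e, Int.natAbs_natCast]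
      simp only [norm_mul, norm_pow]
      calc _ ≤ 1 * (‖a‖ * C * r ^ m) := by
            gcongr
            · exact pow_le_one₀ (norm_nonneg _) hz2.le
            · exact hC1 m
        _ ≤ _ := by
            rw [one_mul]
            gcongr
            linarith
    · rcases Nat.eq_zero_or_pos m with rfl | hm
      · have h1 := one_sub_mul_zpow_ne_zero hq0 ha 0
        rw [zpow_zero, mul_one] at h1
        have h2 := hC1 0
        rw [pow_zero, mul_one] at h2
        have e : (1 - a)⁻¹ - 1 = a * (1 - a)⁻¹ := by field_simp; ring
        simp only [Nat.cast_zero, neg_zero, zpow_zero, mul_one, one_mul, le_refl, if_true, e,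
          Int.natAbs_zero, pow_zero, norm_mul]
        gcongr
        linarith
      · rw [if_neg (by omega), sub_zero]
        rw [norm_mul, norm_zpow, Int.natAbs_neg, Int.natAbs_natCast, zpow_neg, zpow_natCast]
        calc _ ≤ (ρ ^ m)⁻¹ * (C * ‖q‖ ^ m) := by gcongr; exact hC2 m
          _ = 1 * C * r ^ m := by rw [hr, div_pow]; ring
          _ ≤ _ := by
            gcongr
            linarith [norm_nonneg a]
  have hcast : Tendsto (fun x : ℝ => (x : ℂ)) (𝓝[<] 1) (𝓝 1) :=
    (Complex.continuous_ofReal.tendsto' 1 1 (by simp)).mono_left nhdsWithin_le_nhds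
  have hev : ∀ᶠ x : ℝ in 𝓝[<] 1, ρ < ‖(x : ℂ)‖ ∧ ‖(x : ℂ)‖ < 1 := by
    filter_upwards [Ioo_mem_nhdsLT hρ2] with x hx
    rw [Complex.norm_real, Real.norm_eq_abs, abs_of_pos (hρ0.trans hx.1)]
    exact hx
  have lim1 : Tendsto (fun x : ℝ => (1 - (x : ℂ)) * S x) (𝓝[<] 1) (𝓝 1) := by
    have h0 : Tendsto (fun x : ℝ => (1 - (x : ℂ)) * (S x - (1 - (x : ℂ))⁻¹)) (𝓝[<] 1) (𝓝 0) := by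
      refine squeeze_zero_norm' (a := fun x : ℝ => ‖1 - (x : ℂ)‖ * M) ?_ ?_
      · filter_upwards [hev] with x hx
        rw [norm_mul]
        gcongr
        exact hbound x hx.1 hx.2
      · have := ((tendsto_const_nhds (x := (1 : ℂ))).sub hcast).norm.mul_const M
        simpa using this
    have h1 := h0.add_const 1
    rw [zero_add] at h1
    refine h1.congr' ?_
    filter_upwards [hev] with x hx
    have : (1 - (x : ℂ)) ≠ 0 := fun h => by
      rw [← sub_eq_zero.1 h] at hx
      simp at hx
    field_simp
    ring
  have hQ := continuous_qPochInf hq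
  have lim2 : Tendsto (fun x : ℝ => (1 - (x : ℂ)) * S x *
      (qPochInf q q * (qPochInf q (x * q) * qPochInf q (q / x)))) (𝓝[<] 1)
      (𝓝 (1 * (qPochInf q q * (qPochInf q (1 * q) * qPochInf q (q / 1))))) :=
    lim1.mul (tendsto_const_nhds.mul (((hQ.tendsto _).comp (hcast.mul_const q)).mul
      ((hQ.tendsto _).comp (tendsto_const_nhds.div hcast one_ne_zero))))
  have lim3 : Tendsto (fun x : ℝ => lerchCoeff q a 0 * qTheta q (-(a * x))) (𝓝[<] 1)
      (𝓝 (lerchCoeff q a 0 * qTheta q (-a))) := by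
    refine tendsto_const_nhds.mul ?_
    have := (analyticAt_qTheta hq0 hq (neg_ne_zero.2 ha0)).continuousAt.tendsto
    exact this.comp (by simpa using (hcast.const_mul a).neg)
  have := tendsto_nhds_unique_of_eventuallyEq lim3 lim2 ?_
  · rw [this, one_mul, one_mul, div_one]; ring
  · filter_upwards [hev] with x hx
    have hx0 : (x : ℂ) ≠ 0 := norm_pos_iff.1 (hρ0.trans hx.1)
    have := lerch_mul_qTheta hq0 hq ha0 ha (hρ1.trans hx.1) hx.2
    rw [← this, qTheta_eq_mul hq0 hq (neg_ne_zero.2 hx0), neg_neg, div_neg, neg_neg,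
      qPochInf_eq_one_sub_mul hq x]
    simp only [hS]
    ring

/-! ### Connecting `0` and `∞` in an annulus, for parameters outside `q^ℤ`. -/

/-- The entire series which describes `₃φ₂(a, a', a''; b, 0; q, ·)` near infinity. -/
noncomputable def inftySeries (q a a' a'' b y : ℂ) : ℂ := ∑' m : ℕ, inftyCoeff q a a' a'' b m * y ^ m

/-- The constant factor of the connection coefficient. -/
noncomputable def connConst (q a a' a'' b : ℂ) : ℂ :=
  (qPochInf q a' * qPochInf q a'' * qPochInf q (b / a)) /
    (qPochInf q b * qPochInf q (a' / a) * qPochInf q (a'' / a))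

theorem mul_pow_ne_one_of_not_mem_qSpiral {q a : ℂ} (ha : a ∉ qSpiral q 1) (k : ℕ) :
    a * q ^ k ≠ 1 := fun h => ha ⟨-(k : ℤ), by
  have hq : q ^ k ≠ 0 := fun h0 => by simp [h0] at h
  rw [zpow_neg, zpow_natCast, one_mul]
  exact eq_inv_of_mul_eq_one_left h⟩

theorem div_mul_pow_ne_one_of_not_mem_qSpiral {q a : ℂ} (hq0 : q ≠ 0) (ha : a ∉ qSpiral q 1)
    (k : ℕ) : q / a * q ^ k ≠ 1 := fun h => ha ⟨k + 1, by
  have ha0 : a ≠ 0 := fun h0 => by simp [h0] at h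
  rw [zpow_add₀ hq0, zpow_natCast, zpow_one]
  field_simp at h
  linear_combination -h⟩

theorem residueConst_mul_lerchCoeff {q a a' a'' b : ℂ} (hq0 : q ≠ 0) (hq : ‖q‖ < 1) (ha0 : a ≠ 0)
    (ha : a ∉ qSpiral q 1) :
    qPochInf q a * qPochInf q a' * qPochInf q a'' / (qPochInf q b * qPochInf q q) *
      residueConst q a a' a'' b * lerchCoeff q a 0 = connConst q a a' a'' b := by
  have h := lerchCoeff_zero_mul_qTheta hq0 hq ha0 ha
  rw [qTheta_eq_mul hq0 hq (neg_ne_zero.2 ha0), neg_neg, div_neg, neg_neg] at h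
  have h1 := qPochInf_ne_zero hq (self_mul_pow_ne_one hq)
  have h2 := qPochInf_ne_zero hq (mul_pow_ne_one_of_not_mem_qSpiral ha)
  have h3 := qPochInf_ne_zero hq (div_mul_pow_ne_one_of_not_mem_qSpiral hq0 ha)
  have h4 : lerchCoeff q a 0 = qPochInf q q ^ 2 / (qPochInf q a * qPochInf q (q / a)) := by
    rw [eq_div_iff (mul_ne_zero h2 h3)]
    apply mul_left_cancel₀ h1
    linear_combination h
  rw [h4, residueConst, connConst]
  simp only [div_eq_mul_inv, mul_inv] at h3 ⊢
  generalize qPochInf q (q * a⁻¹) = x at *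
  generalize qPochInf q a = y at *
  generalize qPochInf q q = w at *
  have e1 : w⁻¹ * w⁻¹ * w ^ 2 = 1 := by field_simp
  have e2 : y * y⁻¹ = 1 := by field_simp
  have e3 : x * x⁻¹ = 1 := by field_simp
  calc _ = (w⁻¹ * w⁻¹ * w ^ 2) * (y * y⁻¹) * (x * x⁻¹) * (qPochInf q a' * qPochInf q a'' *
      qPochInf q (b * a⁻¹) * ((qPochInf q b)⁻¹ * (qPochInf q (a' * a⁻¹))⁻¹ *
        (qPochInf q (a'' * a⁻¹))⁻¹)) := by ring
    _ = _ := by rw [e1, e2, e3]; ring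

/-- Use `(x;q)_n = (x;q)_∞/(xq^n;q)_∞`. For negative `n` the factor `(q^{n+1};q)_∞` vanishes, so the
added terms are zero. -/
theorem hasSum_bilateral {q a a' a'' b z : ℂ} (hq0 : q ≠ 0) (hq : ‖q‖ < 1)
    (ha : a ∉ qSpiral q 1) (ha' : a' ∉ qSpiral q 1) (ha'' : a'' ∉ qSpiral q 1)
    (hb : ∀ k : ℕ, b * q ^ k ≠ 1) (hz : ‖z‖ < 1) :
    HasSum (fun n : ℤ => qPochInf q a * qPochInf q a' * qPochInf q a'' /
      (qPochInf q b * qPochInf q q) * (qPochInf q (b * q ^ n) * qPochInf q (q * q ^ n) /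
        (qPochInf q (a * q ^ n) * qPochInf q (a' * q ^ n) * qPochInf q (a'' * q ^ n))) * z ^ n)
      (∑' n : ℕ, hyp32Coeff q a a' a'' b 0 n * z ^ n) := by
  obtain ⟨C, -, hC⟩ := exists_norm_hyp32Coeff_le (α := a) (β := a') (γ := a'') (ε := 0) hq hb
    (by simp)
  have h := (summable_norm_mul_pow_of_bounded hC hz).of_norm.hasSum
  refine (Function.Injective.hasSum_iff (Nat.cast_injective (R := ℤ)) ?_).1 (h.congr_fun fun n => ?_)
  · intro n hn
    have hn' : n < 0 := by
      by_contra hc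
      exact hn ⟨n.toNat, by simpa using hc⟩
    have : qPochInf q (q * q ^ n) = 0 := by
      refine (qPochInf_eq_zero_iff hq).2 ⟨(-n - 1).toNat, ?_⟩
      rw [← zpow_natCast, Int.toNat_of_nonneg (by omega), ← zpow_one_add₀ hq0, ← zpow_add₀ hq0]
      rw [show 1 + n + (-n - 1) = 0 by ring, zpow_zero]
    simp [this]
  · have key : ∀ x : ℂ, (∀ k : ℕ, x * q ^ k ≠ 1) →
        qPochInf q (x * q ^ n) = qPochInf q x / qPoch q x n := fun x hx => by
      rw [eq_div_iff (qPoch_ne_zero hx n), qPochInf_eq_qPoch_mul hq x n, mul_comm]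
    have hA := mul_pow_ne_one_of_not_mem_qSpiral ha
    have hA' := mul_pow_ne_one_of_not_mem_qSpiral ha'
    have hA'' := mul_pow_ne_one_of_not_mem_qSpiral ha''
    have hQ := self_mul_pow_ne_one hq
    simp only [Function.comp_apply, zpow_natCast]
    rw [key b hb, key q hQ, key a hA, key a' hA', key a'' hA'', hyp32Coeff, qPoch_zero_left]
    congr 1
    have n1 := qPochInf_ne_zero hq hA
    have n2 := qPochInf_ne_zero hq hA'
    have n3 := qPochInf_ne_zero hq hA''
    have n4 := qPochInf_ne_zero hq hb
    have n5 := qPochInf_ne_zero hq hQ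
    have m1 := qPoch_ne_zero hA n
    have m2 := qPoch_ne_zero hA' n
    have m3 := qPoch_ne_zero hA'' n
    have m4 := qPoch_ne_zero hb n
    have m5 := qPoch_ne_zero hQ n
    field_simp

/-- The pole term depends on `n + m` only. Writing `z^n = z^{n+m}z^{-m}` separates Kronecker's sum
from the entire series, now evaluated in `1/z`. -/
theorem hasSum_inftySeries_mul_lerch {q a a' a'' b z : ℂ} (hq0 : q ≠ 0) (hq : ‖q‖ < 1)
    (ha0 : a ≠ 0) (ha0' : a' ≠ 0) (ha0'' : a'' ≠ 0) (h1 : a ∉ qSpiral q a')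
    (h2 : a ∉ qSpiral q a'') (ha : a ∉ qSpiral q 1) (hz1 : ‖q‖ < ‖z‖) (hz2 : ‖z‖ < 1) :
    HasSum (fun n : ℤ => (∑' m : ℕ, inftyCoeff q a a' a'' b m * (-(b * q / (a' * a''))) ^ m *
        residueConst q a a' a'' b / (1 - a * q ^ m * q ^ n)) * z ^ n)
      (residueConst q a a' a'' b * ((∑' n : ℤ, z ^ n * (1 - a * q ^ n)⁻¹) *
        inftySeries q a a' a'' b (-(b * q / (a' * a'')) / z))) := by
  have hz : z ≠ 0 := norm_pos_iff.1 ((norm_nonneg q).trans_lt hz1)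
  have h := (hasSum_shear (fun m : ℕ => (m : ℤ)) (summable_lerch hq0 hq ha0 ha hz1 hz2)
    (summable_inftyCoeff (b := b) hq0 hq ha0' ha0'' h1 h2 (-(b * q / (a' * a'')) / z))).mul_left
    (residueConst q a a' a'' b)
  refine h.congr_fun fun n => ?_
  rw [← tsum_mul_right, ← tsum_mul_left]
  refine tsum_congr fun m => ?_
  have e : a * q ^ m * q ^ n = a * q ^ (n + m) := by
    rw [zpow_add₀ hq0, zpow_natCast]; ring
  rw [e, zpow_add₀ hz, zpow_natCast, div_pow]
  field_simp

theorem connection_of_not_mem_qSpiral {q a a' a'' b z : ℂ} (hq0 : q ≠ 0) (hq : ‖q‖ < 1)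
    (ha0 : a ≠ 0) (ha0' : a' ≠ 0) (ha0'' : a'' ≠ 0) (hb0 : b ≠ 0) (hb : ∀ k : ℕ, b * q ^ k ≠ 1)
    (h1 : a ∉ qSpiral q a') (h2 : a ∉ qSpiral q a'') (h3 : a' ∉ qSpiral q a'')
    (ha : a ∉ qSpiral q 1) (ha' : a' ∉ qSpiral q 1) (ha'' : a'' ∉ qSpiral q 1)
    (hz1 : ‖q‖ < ‖z‖) (hz2 : ‖z‖ < 1) :
    (∑' n : ℕ, hyp32Coeff q a a' a'' b 0 n * z ^ n) * qTheta q (-z) =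
      connConst q a a' a'' b * qTheta q (-(a * z)) *
        inftySeries q a a' a'' b (-(b * q / (a' * a'')) / z) +
      connConst q a' a a'' b * qTheta q (-(a' * z)) *
        inftySeries q a' a a'' b (-(b * q / (a * a'')) / z) +
      connConst q a'' a' a b * qTheta q (-(a'' * z)) *
        inftySeries q a'' a' a b (-(b * q / (a' * a)) / z) := by
  have h1' := not_mem_qSpiral_comm hq0 h1
  have h2' := not_mem_qSpiral_comm hq0 h2
  have h3' := not_mem_qSpiral_comm hq0 h3
  have hL := hasSum_bilateral hq0 hq ha ha' ha'' hb hz2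
  set K := qPochInf q a * qPochInf q a' * qPochInf q a'' / (qPochInf q b * qPochInf q q) with hK
  have s1 := hasSum_inftySeries_mul_lerch (b := b) hq0 hq ha0 ha0' ha0'' h1 h2 ha hz1 hz2
  have s2 := hasSum_inftySeries_mul_lerch (b := b) hq0 hq ha0' ha0 ha0'' h1' h3 ha' hz1 hz2
  have s3 := hasSum_inftySeries_mul_lerch (b := b) hq0 hq ha0'' ha0' ha0 h3' h2' ha'' hz1 hz2
  have hR := (((s1.add s2).add s3).mul_left K)
  have hne : ∀ x : ℂ, x ∉ qSpiral q 1 → ∀ (n : ℤ) (m : ℕ), 1 - x * q ^ m * q ^ n ≠ 0 := by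
    intro x hx n m
    rw [mul_assoc, ← zpow_natCast, ← zpow_add₀ hq0]
    exact one_sub_mul_zpow_ne_zero hq0 hx _
  have heq := hL.unique (hR.congr_fun fun n => by
    rw [qPochInf_div_eq_tsum hq0 hq ha0 ha0' ha0'' hb0 h1 h2 h3 (hne a ha n) (hne a' ha' n)
      (hne a'' ha'' n)]
    ring)
  rw [heq]
  have l1 := lerch_mul_qTheta hq0 hq ha0 ha hz1 hz2
  have l2 := lerch_mul_qTheta hq0 hq ha0' ha' hz1 hz2
  have l3 := lerch_mul_qTheta hq0 hq ha0'' ha'' hz1 hz2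
  have c1 := residueConst_mul_lerchCoeff (a' := a') (a'' := a'') (b := b) hq0 hq ha0 ha
  have c2 := residueConst_mul_lerchCoeff (a' := a) (a'' := a'') (b := b) hq0 hq ha0' ha'
  have c3 := residueConst_mul_lerchCoeff (a' := a') (a'' := a) (b := b) hq0 hq ha0'' ha''
  rw [← hK] at c1
  rw [show qPochInf q a' * qPochInf q a * qPochInf q a'' / (qPochInf q b * qPochInf q q) = K by
    rw [hK]; ring] at c2
  rw [show qPochInf q a'' * qPochInf q a' * qPochInf q a / (qPochInf q b * qPochInf q q) = K by
    rw [hK]; ring] at c3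
  rw [← c1, ← c2, ← c3]
  generalize inftySeries q a a' a'' b (-(b * q / (a' * a'')) / z) = I1
  generalize inftySeries q a' a a'' b (-(b * q / (a * a'')) / z) = I2
  generalize inftySeries q a'' a' a b (-(b * q / (a' * a)) / z) = I3
  linear_combination K * residueConst q a a' a'' b * I1 * l1 +
    K * residueConst q a' a a'' b * I2 * l2 + K * residueConst q a'' a' a b * I3 * l3

/-! ### Removing the restriction on the parameters by continuity. -/

theorem continuous_qPoch (q : ℂ) (n : ℕ) : Continuous fun a => qPoch q a n := by
  unfold qPoch
  fun_prop

theorem norm_mul_le_of_mem_ball {s a : ℂ} (hs : s ∈ Metric.ball (1 : ℂ) (1 / 2)) :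
    ‖s * a‖ ≤ 2 * ‖a‖ := by
  rw [mem_ball_iff_norm] at hs
  have : ‖s‖ ≤ 2 := by
    calc ‖s‖ = ‖(s - 1) + 1‖ := by ring_nf
      _ ≤ ‖s - 1‖ + ‖(1 : ℂ)‖ := norm_add_le _ _
      _ ≤ 2 := by rw [norm_one]; linarith
  rw [norm_mul]
  gcongr

theorem half_le_norm_of_mem_ball {s : ℂ} (hs : s ∈ Metric.ball (1 : ℂ) (1 / 2)) :
    1 / 2 ≤ ‖s‖ := by
  rw [mem_ball_iff_norm'] at hs
  have h : ‖(1 : ℂ)‖ - ‖s‖ ≤ ‖1 - s‖ := norm_sub_norm_le _ _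
  rw [norm_one] at h
  linarith

theorem tendsto_mul_const_nhds_one (a : ℂ) : Tendsto (fun s : ℂ => s * a) (𝓝 1) (𝓝 a) := by
  simpa using (continuous_mul_const a).tendsto (1 : ℂ)

theorem tendsto_tsum_hyp32Coeff {q a a' a'' b z : ℂ} (hq : ‖q‖ < 1) (hb : ∀ k : ℕ, b * q ^ k ≠ 1)
    (hz : ‖z‖ < 1) :
    Tendsto (fun s : ℂ => ∑' n : ℕ, hyp32Coeff q (s * a) (s * a') (s * a'') b 0 n * z ^ n) (𝓝 1)
      (𝓝 (∑' n : ℕ, hyp32Coeff q a a' a'' b 0 n * z ^ n)) := by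
  obtain ⟨B, hB0, hB⟩ := exists_norm_inv_qPoch_le hq hb
  obtain ⟨D, hD0, hD⟩ := exists_norm_inv_qPoch_le hq (self_mul_pow_ne_one hq)
  set X : ℂ → ℝ := fun a => Real.exp (2 * ‖a‖ * (1 - ‖q‖)⁻¹)
  refine tendsto_tsum_of_dominated_convergence
    (bound := fun n => X a * X a' * X a'' * (B * D) * ‖z‖ ^ n)
    ((summable_geometric_of_lt_one (norm_nonneg z) hz).mul_left _) (fun n => ?_) ?_
  · have h : ∀ x : ℂ, Tendsto (fun s : ℂ => qPoch q (s * x) n) (𝓝 1) (𝓝 (qPoch q x n)) := fun x =>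
      ((continuous_qPoch q n).tendsto x).comp (tendsto_mul_const_nhds_one x)
    exact ((((h a).mul (h a')).mul (h a'')).div_const _).mul_const _
  · filter_upwards [Metric.ball_mem_nhds (1 : ℂ) (by norm_num : (0 : ℝ) < 1 / 2)] with s hs n
    have h : ∀ x : ℂ, ‖qPoch q (s * x) n‖ ≤ X x := fun x =>
      norm_qPoch_le hq (norm_mul_le_of_mem_ball hs) n
    rw [hyp32Coeff, qPoch_zero_left, mul_one, div_eq_mul_inv, mul_inv]
    simp only [norm_mul, norm_pow]
    gcongr
    · exact h a
    · exact h a'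
    · exact h a''
    · exact hB n
    · exact hD n

theorem tendsto_inftySeries {q a a' a'' b z : ℂ} (hq0 : q ≠ 0) (hq : ‖q‖ < 1) (ha0' : a' ≠ 0)
    (ha0'' : a'' ≠ 0) (h1 : a ∉ qSpiral q a') (h2 : a ∉ qSpiral q a'') :
    Tendsto (fun s : ℂ => inftySeries q (s * a) (s * a') (s * a'') b
        (-(b * q / (s * a' * (s * a''))) / z)) (𝓝 1)
      (𝓝 (inftySeries q a a' a'' b (-(b * q / (a' * a'')) / z))) := by
  obtain ⟨B, hB0, hB⟩ := exists_norm_inv_qPoch_le hq (mul_div_mul_pow_ne_one hq0 h1 ha0')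
  obtain ⟨D, hD0, hD⟩ := exists_norm_inv_qPoch_le hq (mul_div_mul_pow_ne_one hq0 h2 ha0'')
  obtain ⟨G, hG0, hG⟩ := exists_norm_inv_qPoch_le hq (self_mul_pow_ne_one hq)
  set X : ℂ → ℝ := fun a => Real.exp (2 * ‖a‖ * (1 - ‖q‖)⁻¹)
  set y : ℂ := -(b * q / (a' * a'')) / z with hy
  have hball := Metric.ball_mem_nhds (1 : ℂ) (by norm_num : (0 : ℝ) < 1 / 2)
  have hyz : ∀ s : ℂ, -(b * q / (s * a' * (s * a''))) / z = (s * s)⁻¹ * y := fun s => by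
    rw [hy, show s * a' * (s * a'') = s * s * (a' * a'') by ring]
    simp only [div_eq_mul_inv, mul_inv]
    ring
  -- The denominators depend only on ratios of the parameters, hence not on `s`; only numerators
  -- need a uniform bound.
  have hcoeff : ∀ s : ℂ, s ≠ 0 → ∀ m, inftyCoeff q (s * a) (s * a') (s * a'') b m =
      gaussPow q (m + 1) * (qPoch q (s * a) m * qPoch q (s * (a * q / b)) m *
        ((qPoch q (a * q / a') m)⁻¹ * (qPoch q (a * q / a'') m)⁻¹ * (qPoch q q m)⁻¹)) :=
    fun s hs m => by
      rw [inftyCoeff, hyp32Coeff, qPoch_zero_left, mul_assoc s a q, mul_div_mul_left _ _ hs,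
        mul_div_mul_left _ _ hs, mul_one, mul_div_assoc s, div_eq_mul_inv, mul_inv, mul_inv]
  unfold inftySeries
  refine tendsto_tsum_of_dominated_convergence
    (bound := fun m => X a * X (a * q / b) * (B * D * G) *
      ‖gaussPow q (m + 1) * 1 * ((4 * ‖y‖ : ℝ) : ℂ) ^ m‖)
    ((summable_gaussPow_mul_of_bounded hq0 hq (u := fun _ => 1) (C := 1) (by simp) _).mul_left _)
    (fun m => ?_) ?_
  · have h : ∀ x : ℂ, Tendsto (fun s : ℂ => qPoch q (s * x) m) (𝓝 1) (𝓝 (qPoch q x m)) := fun x =>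
      ((continuous_qPoch q m).tendsto x).comp (tendsto_mul_const_nhds_one x)
    have hc := ((((h a).mul (h (a * q / b))).mul_const ((qPoch q (a * q / a') m)⁻¹ *
      (qPoch q (a * q / a'') m)⁻¹ * (qPoch q q m)⁻¹)).const_mul (gaussPow q (m + 1)))
    have hid : Tendsto (fun s : ℂ => s) (𝓝 1) (𝓝 1) := tendsto_id
    have hp := (((hid.mul hid).inv₀ (by norm_num)).mul_const y).pow m
    have e := hcoeff 1 one_ne_zero m
    simp only [one_mul] at e
    rw [e]
    have := hc.mul hp
    simp only [mul_one, inv_one, one_mul] at this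
    refine this.congr' ?_
    filter_upwards [hball] with s hs
    have hs0 : s ≠ 0 := norm_pos_iff.1 (by linarith [half_le_norm_of_mem_ball hs])
    rw [hcoeff s hs0, hyz]
  · filter_upwards [hball] with s hs m
    have hs1 := half_le_norm_of_mem_ball hs
    have hs0 : s ≠ 0 := norm_pos_iff.1 (by linarith)
    have h : ∀ x : ℂ, ‖qPoch q (s * x) m‖ ≤ X x := fun x =>
      norm_qPoch_le hq (norm_mul_le_of_mem_ball hs) m
    rw [hcoeff s hs0, hyz]
    have h4 : ‖(s * s)⁻¹ * y‖ ≤ 4 * ‖y‖ := by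
      rw [norm_mul, norm_inv, norm_mul]
      gcongr
      rw [inv_le_comm₀ (by positivity) (by norm_num)]
      nlinarith
    calc _ = ‖gaussPow q (m + 1)‖ * (‖qPoch q (s * a) m‖ * ‖qPoch q (s * (a * q / b)) m‖ *
        (‖(qPoch q (a * q / a') m)⁻¹‖ * ‖(qPoch q (a * q / a'') m)⁻¹‖ * ‖(qPoch q q m)⁻¹‖)) *
        ‖(s * s)⁻¹ * y‖ ^ m := by simp only [norm_mul, norm_pow]
      _ ≤ ‖gaussPow q (m + 1)‖ * (X a * X (a * q / b) * (B * D * G)) * (4 * ‖y‖) ^ m := by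
          gcongr
          · exact h a
          · exact h _
          · exact hB m
          · exact hD m
          · exact hG m
      _ = _ := by
          rw [mul_one, norm_mul, norm_pow, Complex.norm_real, Real.norm_eq_abs,
            abs_of_nonneg (by positivity)]
          ring

theorem tendsto_connConst {q a a' a'' b : ℂ} (hq : ‖q‖ < 1) (ha0 : a ≠ 0)
    (hb : ∀ k : ℕ, b * q ^ k ≠ 1) (h1 : a ∉ qSpiral q a') (h2 : a ∉ qSpiral q a'') :
    Tendsto (fun s : ℂ => connConst q (s * a) (s * a') (s * a'') b) (𝓝 1)
      (𝓝 (connConst q a a' a'' b)) := by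
  have hQ : ∀ {f : ℂ → ℂ} {x : ℂ}, Tendsto f (𝓝 1) (𝓝 x) →
      Tendsto (fun s => qPochInf q (f s)) (𝓝 1) (𝓝 (qPochInf q x)) := fun {f x} hf =>
    ((continuous_qPochInf hq).tendsto x).comp hf
  have hm := tendsto_mul_const_nhds_one
  exact (((hQ (hm a')).mul (hQ (hm a''))).mul (hQ (tendsto_const_nhds.div (hm a) ha0))).div
    ((tendsto_const_nhds.mul (hQ ((hm a').div (hm a) ha0))).mul (hQ ((hm a'').div (hm a) ha0)))
    (mul_ne_zero (mul_ne_zero (qPochInf_ne_zero hq hb)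
      (qPochInf_ne_zero hq (div_mul_pow_ne_one h1 ha0)))
      (qPochInf_ne_zero hq (div_mul_pow_ne_one h2 ha0)))

theorem countable_qSpiral (q μ : ℂ) : (qSpiral q μ).Countable :=
  (Set.countable_range fun k : ℤ => μ * q ^ k).mono fun _ hx => by
    obtain ⟨k, hk⟩ := hx
    exact ⟨k, hk.symm⟩

theorem mul_not_mem_qSpiral_mul {q a b s : ℂ} (hs : s ≠ 0) (h : a ∉ qSpiral q b) :
    s * a ∉ qSpiral q (s * b) := fun ⟨k, hk⟩ => h ⟨k, by
  rw [mul_assoc] at hk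
  exact mul_left_cancel₀ hs hk⟩

/-- Scaling all three parameters by `s` preserves their ratios, and only countably many `s` put one
of them in `q^ℤ`. Both sides are continuous at `s = 1`, so the generic formula passes to the limit.
-/
theorem connection_annulus {q a a' a'' b z : ℂ} (hq0 : q ≠ 0) (hq : ‖q‖ < 1)
    (ha0 : a ≠ 0) (ha0' : a' ≠ 0) (ha0'' : a'' ≠ 0) (hb0 : b ≠ 0) (hb : ∀ k : ℕ, b * q ^ k ≠ 1)
    (h1 : a ∉ qSpiral q a') (h2 : a ∉ qSpiral q a'') (h3 : a' ∉ qSpiral q a'')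
    (hz1 : ‖q‖ < ‖z‖) (hz2 : ‖z‖ < 1) :
    (∑' n : ℕ, hyp32Coeff q a a' a'' b 0 n * z ^ n) * qTheta q (-z) =
      connConst q a a' a'' b * qTheta q (-(a * z)) *
        inftySeries q a a' a'' b (-(b * q / (a' * a'')) / z) +
      connConst q a' a a'' b * qTheta q (-(a' * z)) *
        inftySeries q a' a a'' b (-(b * q / (a * a'')) / z) +
      connConst q a'' a' a b * qTheta q (-(a'' * z)) *
        inftySeries q a'' a' a b (-(b * q / (a' * a)) / z) := by
  have hz : z ≠ 0 := norm_pos_iff.1 ((norm_nonneg q).trans_lt hz1)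
  have h1' := not_mem_qSpiral_comm hq0 h1
  have h2' := not_mem_qSpiral_comm hq0 h2
  have h3' := not_mem_qSpiral_comm hq0 h3
  set bad : Set ℂ := {s | s * a ∈ qSpiral q 1} ∪ {s | s * a' ∈ qSpiral q 1} ∪
    {s | s * a'' ∈ qSpiral q 1} with hbad
  have hcount : ∀ x : ℂ, x ≠ 0 → {s | s * x ∈ qSpiral q 1}.Countable := fun x hx =>
    (countable_qSpiral q 1).preimage (mul_left_injective₀ hx)
  have hdense : Dense badᶜ :=
    (((hcount a ha0).union (hcount a' ha0')).union (hcount a'' ha0'')).dense_compl ℂ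
  have hne : (𝓝[badᶜ] (1 : ℂ)).NeBot := mem_closure_iff_nhdsWithin_neBot.1 (hdense 1)
  have hle : 𝓝[badᶜ] (1 : ℂ) ≤ 𝓝 1 := nhdsWithin_le_nhds
  have hθ : ∀ x : ℂ, x ≠ 0 →
      Tendsto (fun s : ℂ => qTheta q (-(s * x * z))) (𝓝 1) (𝓝 (qTheta q (-(x * z)))) := fun x hx =>
    ((analyticAt_qTheta hq0 hq (neg_ne_zero.2 (mul_ne_zero hx hz))).continuousAt.tendsto).comp
      ((tendsto_mul_const_nhds_one x).mul_const z).neg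
  have hL := (tendsto_tsum_hyp32Coeff (a := a) (a' := a') (a'' := a'') hq hb hz2).mul_const
    (qTheta q (-z))
  have hR := ((((tendsto_connConst hq ha0 hb h1 h2).mul (hθ a ha0)).mul
      (tendsto_inftySeries (b := b) (z := z) hq0 hq ha0' ha0'' h1 h2)).add
    (((tendsto_connConst hq ha0' hb h1' h3).mul (hθ a' ha0')).mul
      (tendsto_inftySeries (b := b) (z := z) hq0 hq ha0 ha0'' h1' h3))).add
    (((tendsto_connConst hq ha0'' hb h3' h2').mul (hθ a'' ha0'')).mul
      (tendsto_inftySeries (b := b) (z := z) hq0 hq ha0' ha0 h3' h2'))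
  refine tendsto_nhds_unique_of_eventuallyEq (hL.mono_left hle) (hR.mono_left hle) ?_
  filter_upwards [self_mem_nhdsWithin,
    hle (Metric.ball_mem_nhds (1 : ℂ) (by norm_num : (0 : ℝ) < 1 / 2))] with s hs hs'
  have hs0 : s ≠ 0 := norm_pos_iff.1 (by linarith [half_le_norm_of_mem_ball hs'])
  simp only [hbad, Set.mem_compl_iff, Set.mem_union, Set.mem_ofPred_eq, not_or] at hs
  exact connection_of_not_mem_qSpiral hq0 hq (mul_ne_zero hs0 ha0) (mul_ne_zero hs0 ha0')
    (mul_ne_zero hs0 ha0'') hb0 hb (mul_not_mem_qSpiral_mul hs0 h1) (mul_not_mem_qSpiral_mul hs0 h2)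
    (mul_not_mem_qSpiral_mul hs0 h3) hs.1.1 hs.1.2 hs.2 hz1 hz2

/-! ### The connection formula on the whole domain of the Borel transform. -/

theorem differentiable_inftySeries {q a a' a'' : ℂ} (b : ℂ) (hq0 : q ≠ 0) (hq : ‖q‖ < 1)
    (ha0' : a' ≠ 0) (ha0'' : a'' ≠ 0) (h1 : a ∉ qSpiral q a') (h2 : a ∉ qSpiral q a'') :
    Differentiable ℂ (inftySeries q a a' a'' b) := fun y =>
  (differentiableOn_tsum_mul_pow (R := ‖y‖ + 1) fun z _ =>
    summable_inftyCoeff (b := b) hq0 hq ha0' ha0'' h1 h2 z).differentiableAt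
    (Metric.isOpen_ball.mem_nhds (by simp))

theorem exists_continuation_borel31 {q a a' a'' b : ℂ} (hq0 : q ≠ 0) (hq : ‖q‖ < 1)
    (hb : ∀ k : ℕ, b * q ^ k ≠ 1) :
    ∃ F : ℂ → ℂ, IsContinuation (borel31 q a a' a'' b) (qSlitPlane q (-1)) F ∧
      ∀ ξ, ‖ξ‖ < 1 → F ξ = ∑' n : ℕ, hyp32Coeff q a a' a'' b 0 n * (-ξ) ^ n := by
  obtain ⟨F, hF, hs, -⟩ := exists_continuation_hyp32 (α := a) (β := a') (γ := a'') (ε := 0) hq0 hq hb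
    (by simp)
  have hmem : ∀ ξ ∈ qSlitPlane q (-1), -ξ ∈ qSlitPlane q 1 := fun ξ hξ k h =>
    hξ k (by linear_combination -h)
  refine ⟨fun ξ => F (-ξ), ⟨fun ξ hξ => ?_, ?_⟩, fun ξ hξ => ?_⟩
  · exact (hF.analytic _ (hmem ξ hξ)).comp (f := fun ξ : ℂ => -ξ) (by fun_prop)
  · filter_upwards [Metric.ball_mem_nhds (0 : ℂ) one_pos] with ξ hξ
    rw [mem_ball_zero_iff] at hξ
    refine (hs (-ξ) (by simpa using hξ)).congr_fun fun n => ?_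
    rw [coeff_borel31 hq0, neg_pow ξ]
    ring
  · exact (hs (-ξ) (by simpa using hξ)).tsum_eq.symm

theorem isContinuation_borel31Fun {q : ℂ} (a a' a'' : ℂ) {b : ℂ} (hq0 : q ≠ 0) (hq : ‖q‖ < 1)
    (hb : ∀ k : ℕ, b * q ^ k ≠ 1) :
    IsContinuation (borel31 q a a' a'' b) (qSlitPlane q (-1)) (borel31Fun q a a' a'' b) := by
  obtain ⟨F, hF, -⟩ := exists_continuation_borel31 (a := a) (a' := a') (a'' := a'') hq0 hq hb
  exact isContinuation_continuation ⟨F, hF⟩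

/-- The connection formula between `0` and `∞` for the `q`-Borel transform. -/
theorem borel31Fun_connection {q a a' a'' b ξ : ℂ} (hq0 : q ≠ 0) (hq : ‖q‖ < 1)
    (ha0 : a ≠ 0) (ha0' : a' ≠ 0) (ha0'' : a'' ≠ 0) (hb0 : b ≠ 0) (hb : ∀ k : ℕ, b * q ^ k ≠ 1)
    (h1 : a ∉ qSpiral q a') (h2 : a ∉ qSpiral q a'') (h3 : a' ∉ qSpiral q a'')
    (hξ0 : ξ ≠ 0) (hξ : ξ ∈ qSlitPlane q (-1)) :
    borel31Fun q a a' a'' b ξ * qTheta q ξ =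
      connConst q a a' a'' b * qTheta q (a * ξ) *
        inftySeries q a a' a'' b (b * q / (a' * a'') / ξ) +
      connConst q a' a a'' b * qTheta q (a' * ξ) *
        inftySeries q a' a a'' b (b * q / (a * a'') / ξ) +
      connConst q a'' a' a b * qTheta q (a'' * ξ) *
        inftySeries q a'' a' a b (b * q / (a' * a) / ξ) := by
  have h1' := not_mem_qSpiral_comm hq0 h1
  have h2' := not_mem_qSpiral_comm hq0 h2
  have h3' := not_mem_qSpiral_comm hq0 h3
  set U : Set ℂ := {ξ | ξ ≠ 0 ∧ ξ ∈ qSlitPlane q (-1)} with hU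
  have hUc : Uᶜ.Countable := by
    refine ((Set.countable_singleton (0 : ℂ)).union (countable_compl_qSlitPlane hq0 (-1))).mono ?_
    intro x hx
    simp only [hU, Set.mem_compl_iff, Set.mem_ofPred_eq, not_and] at hx
    by_cases h : x = 0
    · exact Or.inl h
    · exact Or.inr (hx h)
  have hcont := isContinuation_borel31Fun a a' a'' hq0 hq hb
  obtain ⟨F, hF, hFs⟩ := exists_continuation_borel31 (a := a) (a' := a') (a'' := a'') hq0 hq hb
  have hEq := hcont.eqOn hF (isPreconnected_qSlitPlane hq0 (-1)) (zero_mem_qSlitPlane (by norm_num))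
  have hθ : AnalyticOnNhd ℂ (qTheta q) U := fun x hx => analyticAt_qTheta hq0 hq hx.1
  have hterm : ∀ {x y w : ℂ} (c : ℂ), x ≠ 0 → y ≠ 0 → w ≠ 0 → x ∉ qSpiral q y → x ∉ qSpiral q w →
      AnalyticOnNhd ℂ (fun ξ => c * qTheta q (x * ξ) *
        inftySeries q x y w b (b * q / (y * w) / ξ)) U := by
    intro x y w c hx hy hw hxy hxw t ht
    have e1 : AnalyticAt ℂ (fun ξ => qTheta q (x * ξ)) t :=
      (analyticAt_qTheta hq0 hq (mul_ne_zero hx ht.1)).comp (f := fun ξ => x * ξ) (by fun_prop)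
    have e2 : AnalyticAt ℂ (fun ξ => inftySeries q x y w b (b * q / (y * w) / ξ)) t :=
      ((differentiable_inftySeries b hq0 hq hy hw hxy hxw).analyticAt _).comp
        (f := fun ξ => b * q / (y * w) / ξ) (analyticAt_const.div analyticAt_id ht.1)
    exact (analyticAt_const.mul e1).mul e2
  have hl : AnalyticOnNhd ℂ (fun ξ => borel31Fun q a a' a'' b ξ * qTheta q ξ) U :=
    fun x hx => (hcont.analytic x hx.2).mul (hθ x hx)
  have hr := ((hterm (connConst q a a' a'' b) ha0 ha0' ha0'' h1 h2).add
    (hterm (connConst q a' a a'' b) ha0' ha0 ha0'' h1' h3)).add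
    (hterm (connConst q a'' a' a b) ha0'' ha0' ha0 h3' h2')
  -- Any point of the annulus serves as base point for the identity theorem.
  obtain ⟨ρ, hρ1, hρ2⟩ := exists_between hq
  have hρ0 : 0 < ρ := (norm_nonneg q).trans_lt hρ1
  have hann : ∀ t : ℂ, ‖q‖ < ‖t‖ → ‖t‖ < 1 → t ∈ U := fun t ht1 ht2 =>
    ⟨norm_pos_iff.1 ((norm_nonneg q).trans_lt ht1), fun k h =>
      mem_qSlitPlane_one_of_norm_lt hq (z := -t) (by simpa using ht2) k (by linear_combination -h)⟩
  have hO : IsOpen {t : ℂ | ‖q‖ < ‖t‖ ∧ ‖t‖ < 1} :=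
    (isOpen_lt continuous_const continuous_norm).inter (isOpen_lt continuous_norm continuous_const)
  have hρn : ‖(ρ : ℂ)‖ = ρ := by rw [Complex.norm_real, Real.norm_eq_abs, abs_of_pos hρ0]
  have hρmem : (ρ : ℂ) ∈ {t : ℂ | ‖q‖ < ‖t‖ ∧ ‖t‖ < 1} := ⟨by rwa [hρn], by rwa [hρn]⟩
  refine hl.eqOn_of_preconnected_of_eventuallyEq hr (isPreconnected_of_countable_compl hUc)
    (hann _ hρmem.1 hρmem.2) ?_ ⟨hξ0, hξ⟩
  filter_upwards [hO.mem_nhds hρmem] with t ht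
  have key := connection_annulus (z := -t) hq0 hq ha0 ha0' ha0'' hb0 hb h1 h2 h3
    (by simpa using ht.1) (by simpa using ht.2)
  simp only [mul_neg, neg_neg, neg_div_neg_eq] at key
  rw [hEq (hann t ht.1 ht.2).2, hFs t ht.2, key]
  rfl

/-! ### The solutions at infinity and their `q`-difference equation. -/

theorem exists_phi32_aux {q a a' a'' : ℂ} (b : ℂ) (hq0 : q ≠ 0) (hq : ‖q‖ < 1) (ha0' : a' ≠ 0)
    (ha0'' : a'' ≠ 0) (h1 : a ∉ qSpiral q a') (h2 : a ∉ qSpiral q a'') :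
    ∃ F : ℂ → ℂ, IsContinuation (series32 q a a' a'' b) (qSlitPlane q 1) F ∧
      Set.EqOn (phi32 q a a' a'' b) F (qSlitPlane q 1) ∧
      (∀ z, ‖z‖ < 1 → HasSum (fun n => hyp32Coeff q a (a * q / b) 0 (a * q / a') (a * q / a'') n *
        z ^ n) (F z)) ∧
      ∀ z ∈ qSlitPlane q 1,
        F z - (1 + (a * q / a' + a * q / a'') / q) * F (q * z) +
          ((a * q / a' + a * q / a'') / q + a * q / a' * (a * q / a'') / q ^ 2) * F (q ^ 2 * z)
          - a * q / a' * (a * q / a'') / q ^ 2 * F (q ^ 3 * z) =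
        z * (F z - (a + a * q / b + 0) * F (q * z) +
          (a * (a * q / b) + a * q / b * 0 + 0 * a) * F (q ^ 2 * z)
          - a * (a * q / b) * 0 * F (q ^ 3 * z)) := by
  obtain ⟨F, hF, hs, heq⟩ := exists_continuation_hyp32 (α := a) (β := a * q / b) (γ := 0) hq0 hq
    (mul_div_mul_pow_ne_one hq0 h1 ha0') (mul_div_mul_pow_ne_one hq0 h2 ha0'')
  have hc : IsContinuation (series32 q a a' a'' b) (qSlitPlane q 1) (phi32 q a a' a'' b) :=
    isContinuation_continuation ⟨F, hF⟩
  exact ⟨F, hF, hc.eqOn hF (isPreconnected_qSlitPlane hq0 1) (zero_mem_qSlitPlane one_ne_zero),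
    hs, heq⟩

theorem isContinuation_phi32 {q a a' a'' : ℂ} (b : ℂ) (hq0 : q ≠ 0) (hq : ‖q‖ < 1) (ha0' : a' ≠ 0)
    (ha0'' : a'' ≠ 0) (h1 : a ∉ qSpiral q a') (h2 : a ∉ qSpiral q a'') :
    IsContinuation (series32 q a a' a'' b) (qSlitPlane q 1) (phi32 q a a' a'' b) := by
  obtain ⟨F, hF, -⟩ := exists_phi32_aux b hq0 hq ha0' ha0'' h1 h2
  exact isContinuation_continuation ⟨F, hF⟩

theorem hasSum_phi32 {q a a' a'' : ℂ} (b : ℂ) (hq0 : q ≠ 0) (hq : ‖q‖ < 1) (ha0' : a' ≠ 0)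
    (ha0'' : a'' ≠ 0) (h1 : a ∉ qSpiral q a') (h2 : a ∉ qSpiral q a'') {z : ℂ} (hz : ‖z‖ < 1) :
    HasSum (fun n => hyp32Coeff q a (a * q / b) 0 (a * q / a') (a * q / a'') n * z ^ n)
      (phi32 q a a' a'' b z) := by
  obtain ⟨F, -, hE, hs, -⟩ := exists_phi32_aux b hq0 hq ha0' ha0'' h1 h2
  rw [hE (mem_qSlitPlane_one_of_norm_lt hq hz)]
  exact hs z hz

theorem phi32_qDiff_eq {q a a' a'' b : ℂ} (hq0 : q ≠ 0) (hq : ‖q‖ < 1) (ha0' : a' ≠ 0)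
    (ha0'' : a'' ≠ 0) (h1 : a ∉ qSpiral q a') (h2 : a ∉ qSpiral q a'') {z : ℂ}
    (hz : z ∈ qSlitPlane q 1) :
    phi32 q a a' a'' b z - (1 + a / a' + a / a'') * phi32 q a a' a'' b (q * z) +
        (a / a' + a / a'' + a / a' * (a / a'')) * phi32 q a a' a'' b (q ^ 2 * z) -
        a / a' * (a / a'') * phi32 q a a' a'' b (q ^ 3 * z) =
      z * (phi32 q a a' a'' b z - (a + a * q / b) * phi32 q a a' a'' b (q * z) +
        a * (a * q / b) * phi32 q a a' a'' b (q ^ 2 * z)) := by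
  obtain ⟨F, -, hE, -, heq⟩ := exists_phi32_aux b hq0 hq ha0' ha0'' h1 h2
  have h := heq z hz
  have hqz : q * z ∈ qSlitPlane q 1 := by simpa using pow_mul_mem_qSlitPlane hz 1
  rw [hE hz, hE hqz, hE (pow_mul_mem_qSlitPlane hz 2), hE (pow_mul_mem_qSlitPlane hz 3)]
  have e1 : (a * q / a' + a * q / a'') / q = a / a' + a / a'' := by field_simp
  have e2 : a * q / a' * (a * q / a'') / q ^ 2 = a / a' * (a / a'') := by field_simp
  rw [e1, e2] at h
  linear_combination h

theorem qTheta_div_pow_mul {q a x : ℂ} (hq0 : q ≠ 0) (ha0 : a ≠ 0) (hx : x ≠ 0) (i : ℕ) :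
    qTheta q (a * (q ^ i * x)) / qTheta q (q ^ i * x) = qTheta q (a * x) / qTheta q x / a ^ i := by
  have h1 := qTheta_zpow_mul hq0 (mul_ne_zero ha0 hx) i
  have h2 := qTheta_zpow_mul hq0 hx i
  rw [zpow_natCast, zpow_natCast] at h1 h2
  have hg := gaussPow_ne_zero hq0 i
  have hxi := pow_ne_zero i hx
  rw [show a * (q ^ i * x) = q ^ i * (a * x) by ring, h1, h2, div_div_div_comm, mul_pow]
  congr 1
  field_simp

/-- Multiplying `x` by `q` divides the argument of `₃φ₂` by `q`, so the equation is that of `₃φ₂` at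
`y`, the argument belonging to `q³x`, read in reverse order. The theta quotient contributes `a^{-i}`
at `q^i x`. Regularity at `y` implies it at every `q^i y`, so a condition at `q³x` suffices. -/
theorem thirdOrderOp_vInf {q a a' a'' b x : ℂ} (hq0 : q ≠ 0) (hq : ‖q‖ < 1) (ha0 : a ≠ 0)
    (ha0' : a' ≠ 0) (ha0'' : a'' ≠ 0) (hb0 : b ≠ 0) (h1 : a ∉ qSpiral q a')
    (h2 : a ∉ qSpiral q a'') (hx0 : x ≠ 0)
    (hx : q * b / (a * a' * a'' * (q ^ 3 * x)) ∈ qSlitPlane q 1) :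
    thirdOrderOp q a a' a'' b (vInf q a a' a'' b) x = 0 := by
  have key := phi32_qDiff_eq (b := b) hq0 hq ha0' ha0'' h1 h2 hx
  set y := q * b / (a * a' * a'' * (q ^ 3 * x)) with hy
  have e : ∀ i : ℕ, i ≤ 3 → q * b / (a * a' * a'' * (q ^ i * x)) = q ^ (3 - i) * y := by
    intro i hi
    have : q ^ 3 = q ^ i * q ^ (3 - i) := by rw [← pow_add]; congr 1; omega
    rw [hy, this]
    field_simp
  have t := fun i => qTheta_div_pow_mul hq0 ha0 hx0 i
  have e3 := e 3 le_rfl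
  have e2 := e 2 (by norm_num)
  have e1 := e 1 (by norm_num)
  have e0 := e 0 (by norm_num)
  have t1 := t 1
  norm_num at e3 e2 e1 e0 t1
  rw [thirdOrderOp, vInf, vInf, vInf, vInf, t 3, t 2, t1, e3, e2, e1, e0]
  set P := phi32 q a a' a'' b
  generalize qTheta q (a * x) / qTheta q x = T
  have hyx : y * q ^ 2 * (a * a' * a'' * x) = b := by rw [hy]; field_simp
  have k1 : (a * a' * a'' * x - b / q ^ 2) * (T / a ^ 3 * P y) -
      ((a * a' + a' * a'' + a'' * a) * x - (b / q ^ 2 + 1 / q)) * (T / a ^ 2 * P (q * y)) +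
      ((a + a' + a'') * x - 1 / q) * (T / a * P (q ^ 2 * y)) - x * (T * P (q ^ 3 * y)) =
      T * (a' * a'' * x / a ^ 2) * ((P y - (1 + a / a' + a / a'') * P (q * y) +
        (a / a' + a / a'' + a / a' * (a / a'')) * P (q ^ 2 * y) -
        a / a' * (a / a'') * P (q ^ 3 * y)) - y * (P y - (a + a * q / b) * P (q * y) +
        a * (a * q / b) * P (q ^ 2 * y))) := by
    have hyv : y = b / (q ^ 2 * (a * a' * a'' * x)) := by rw [← hyx]; field_simp
    generalize P y = p0
    generalize P (q * y) = p1
    generalize P (q ^ 2 * y) = p2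
    generalize P (q ^ 3 * y) = p3
    rw [hyv]
    field_simp
    ring
  rw [k1, key]
  ring

/-! ### The Laplace sum along the spiral `[λ;q]`. -/

theorem mem_qSpiral_of_div_mem {q x lam : ℂ} (hq0 : q ≠ 0) (hx : x ≠ 0)
    (h : lam / x ∈ qSpiral q (-1)) : x ∈ qSpiral q (-lam) := by
  obtain ⟨k, hk⟩ := h
  refine ⟨-k, ?_⟩
  have := zpow_ne_zero k hq0
  rw [zpow_neg]
  field_simp at hk ⊢
  linear_combination hk

theorem qLaplaceTerm_eq {q lam x : ℂ} (hq0 : q ≠ 0) (hlam0 : lam ≠ 0) (hx : x ≠ 0) (φ : ℂ → ℂ)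
    (n : ℤ) : qLaplaceTerm q lam φ x n =
      φ (lam * q ^ n) * gaussPow q n * (lam / x) ^ n / qTheta q (lam / x) := by
  rw [qLaplaceTerm, show lam * q ^ n / x = q ^ n * (lam / x) by ring,
    qTheta_zpow_mul hq0 (div_ne_zero hlam0 hx), div_div_eq_mul_div, mul_assoc]

theorem mul_zpow_mem_qSlitPlane {q lam : ℂ} (hq0 : q ≠ 0) (hlam : lam ∉ qSpiral q (-1)) (n : ℤ) :
    lam * q ^ n ∈ qSlitPlane q (-1) := fun k h => hlam ⟨-(n + k), by
  rw [mul_assoc, ← zpow_natCast, ← zpow_add₀ hq0] at h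
  have := zpow_ne_zero (n + k) hq0
  rw [zpow_neg, ← h]
  field_simp⟩

/-- The coefficients in the expansion of the `q`-Borel transform on the spiral `[λ;q]`. -/
noncomputable def spiralConst (q a a' a'' b lam : ℂ) : ℂ :=
  connConst q a a' a'' b * (qTheta q (a * lam) / qTheta q lam)

/-- Quasi-periodicity makes the Gaussian and `λ^n` cancel in `θ(aλq^n)/θ(λq^n)`, leaving `a^{-n}`
times its value at `n = 0`. -/
theorem borel31Fun_mul_zpow {q a a' a'' b lam : ℂ} (hq0 : q ≠ 0) (hq : ‖q‖ < 1)
    (ha0 : a ≠ 0) (ha0' : a' ≠ 0) (ha0'' : a'' ≠ 0) (hb0 : b ≠ 0) (hb : ∀ k : ℕ, b * q ^ k ≠ 1)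
    (h1 : a ∉ qSpiral q a') (h2 : a ∉ qSpiral q a'') (h3 : a' ∉ qSpiral q a'')
    (hlam0 : lam ≠ 0) (hlam : lam ∉ qSpiral q (-1)) (n : ℤ) :
    borel31Fun q a a' a'' b (lam * q ^ n) =
      spiralConst q a a' a'' b lam * ((a ^ n)⁻¹ *
        inftySeries q a a' a'' b (b * q / (a' * a'') / lam * (q ^ n)⁻¹)) +
      spiralConst q a' a a'' b lam * ((a' ^ n)⁻¹ *
        inftySeries q a' a a'' b (b * q / (a * a'') / lam * (q ^ n)⁻¹)) +
      spiralConst q a'' a' a b lam * ((a'' ^ n)⁻¹ *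
        inftySeries q a'' a' a b (b * q / (a' * a) / lam * (q ^ n)⁻¹)) := by
  have hqn := zpow_ne_zero n hq0
  have hθ : qTheta q lam ≠ 0 := fun h => hlam ((qTheta_eq_zero_iff hq0 hq hlam0).1 h)
  have h := borel31Fun_connection hq0 hq ha0 ha0' ha0'' hb0 hb h1 h2 h3
    (mul_ne_zero hlam0 hqn) (mul_zpow_mem_qSlitPlane hq0 hlam n)
  have hg := gaussPow_ne_zero hq0 n
  have hl := zpow_ne_zero n hlam0
  have t : ∀ x : ℂ, x ≠ 0 → qTheta q (x * (lam * q ^ n)) =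
      qTheta q (x * lam) * (x ^ n)⁻¹ / (gaussPow q n * lam ^ n) := fun x hx => by
    rw [show x * (lam * q ^ n) = q ^ n * (x * lam) by ring,
      qTheta_zpow_mul hq0 (mul_ne_zero hx hlam0), mul_zpow]
    have := zpow_ne_zero n hx
    field_simp
  have t0 := t 1 one_ne_zero
  simp only [one_mul, one_zpow, inv_one, mul_one] at t0
  have e : ∀ y : ℂ, y / (lam * q ^ n) = y / lam * (q ^ n)⁻¹ := fun y => by
    rw [← div_div, div_eq_mul_inv (y / lam)]
  rw [t0, t a ha0, t a' ha0', t a'' ha0'', e, e, e] at h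
  rw [spiralConst, spiralConst, spiralConst]
  generalize inftySeries q a a' a'' b (b * q / (a' * a'') / lam * (q ^ n)⁻¹) = I1 at *
  generalize inftySeries q a' a a'' b (b * q / (a * a'') / lam * (q ^ n)⁻¹) = I2 at *
  generalize inftySeries q a'' a' a b (b * q / (a' * a) / lam * (q ^ n)⁻¹) = I3 at *
  generalize (a ^ n)⁻¹ = A1 at *
  generalize (a' ^ n)⁻¹ = A2 at *
  generalize (a'' ^ n)⁻¹ = A3 at *
  field_simp at h ⊢
  linear_combination h

theorem summable_spiral_neg {q a a' a'' : ℂ} (b : ℂ) (hq0 : q ≠ 0) (hq : ‖q‖ < 1)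
    (ha0' : a' ≠ 0) (ha0'' : a'' ≠ 0) (h1 : a ∉ qSpiral q a') (h2 : a ∉ qSpiral q a'') (c y z : ℂ) :
    Summable fun m : ℕ => c * ((a ^ (-(m : ℤ)))⁻¹ * inftySeries q a a' a'' b
      (y * (q ^ (-(m : ℤ)))⁻¹)) * gaussPow q (-(m : ℤ)) * z ^ (-(m : ℤ)) := by
  have hc : Tendsto (fun m : ℕ => inftySeries q a a' a'' b (y * q ^ m)) atTop
      (𝓝 (inftySeries q a a' a'' b (y * 0))) :=
    ((differentiable_inftySeries b hq0 hq ha0' ha0'' h1 h2).continuous.tendsto _).comp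
      ((tendsto_pow_atTop_nhds_zero_of_norm_lt_one hq).const_mul y)
  obtain ⟨C, hC0, hC⟩ := exists_norm_le_of_tendsto hc
  refine Summable.of_norm_bounded
    ((summable_gaussPow_mul_pow hq0 hq (q * a * z⁻¹)).mul_left (‖c‖ * C)) fun m => ?_
  have e : c * ((a ^ (-(m : ℤ)))⁻¹ * inftySeries q a a' a'' b (y * (q ^ (-(m : ℤ)))⁻¹)) *
      gaussPow q (-(m : ℤ)) * z ^ (-(m : ℤ)) =
      c * inftySeries q a a' a'' b (y * q ^ m) * (gaussPow q m * (q * a * z⁻¹) ^ m) := by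
    rw [gaussPow_neg hq0, zpow_neg, zpow_neg, zpow_neg, inv_inv, inv_inv, zpow_natCast,
      zpow_natCast, zpow_natCast, mul_pow, mul_pow, inv_pow]
    ring
  rw [e, norm_mul, norm_mul c]
  gcongr
  exact hC m

theorem summable_borel_laurent {q a a' a'' b lam : ℂ} (hq0 : q ≠ 0) (hq : ‖q‖ < 1)
    (ha0 : a ≠ 0) (ha0' : a' ≠ 0) (ha0'' : a'' ≠ 0) (hb0 : b ≠ 0) (hb : ∀ k : ℕ, b * q ^ k ≠ 1)
    (h1 : a ∉ qSpiral q a') (h2 : a ∉ qSpiral q a'') (h3 : a' ∉ qSpiral q a'')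
    (hlam0 : lam ≠ 0) (hlam : lam ∉ qSpiral q (-1)) (y : ℂ) :
    Summable fun n : ℤ => ‖borel31Fun q a a' a'' b (lam * q ^ n) * gaussPow q n * y ^ n‖ := by
  have h1' := not_mem_qSpiral_comm hq0 h1
  have h2' := not_mem_qSpiral_comm hq0 h2
  have h3' := not_mem_qSpiral_comm hq0 h3
  refine Summable.of_nat_of_neg ?_ (Summable.norm ?_)
  -- In this direction `λq^m → 0`, where the Borel transform is continuous, so its values stay
  -- bounded.
  · have hc : Tendsto (fun m : ℕ => borel31Fun q a a' a'' b (lam * q ^ m)) atTop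
        (𝓝 (borel31Fun q a a' a'' b 0)) :=
      ((isContinuation_borel31Fun a a' a'' hq0 hq hb).analytic 0
        (zero_mem_qSlitPlane (by norm_num))).continuousAt.tendsto.comp
        (by simpa using (tendsto_pow_atTop_nhds_zero_of_norm_lt_one hq).const_mul lam)
    obtain ⟨C, hC0, hC⟩ := exists_norm_le_of_tendsto hc
    refine Summable.of_nonneg_of_le (fun _ => norm_nonneg _) (fun m => ?_)
      ((summable_gaussPow_mul_pow hq0 hq y).mul_left C)
    rw [mul_assoc, norm_mul, zpow_natCast, zpow_natCast]
    gcongr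
    exact hC m
  -- In the other direction the points tend to infinity and the expansion there is used: the entire
  -- series stay bounded, since their arguments tend to `0`, and the Gaussian beats the powers.
  · refine (((summable_spiral_neg b hq0 hq ha0' ha0'' h1 h2 (spiralConst q a a' a'' b lam)
      (b * q / (a' * a'') / lam) y).add
      (summable_spiral_neg b hq0 hq ha0 ha0'' h1' h3 (spiralConst q a' a a'' b lam)
      (b * q / (a * a'') / lam) y)).add
      (summable_spiral_neg b hq0 hq ha0' ha0 h3' h2' (spiralConst q a'' a' a b lam)
      (b * q / (a' * a) / lam) y)).congr fun m => ?_
    rw [borel31Fun_mul_zpow hq0 hq ha0 ha0' ha0'' hb0 hb h1 h2 h3 hlam0 hlam]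
    ring

/-- The Gaussian of index `n - m` is the product of the Laplace weight of index `n`, the factor
`q^{m(m+1)/2}` in `inftyCoeff`, and `q^{-nm}`. So the double sum is the product of `θ(λ/(ax))` and
the `₃φ₂` series, which needs its argument inside the unit disc. -/
theorem hasSum_spiral_laurent {q a a' a'' b lam x : ℂ} (hq0 : q ≠ 0) (hq : ‖q‖ < 1)
    (ha0 : a ≠ 0) (ha0' : a' ≠ 0) (ha0'' : a'' ≠ 0) (h1 : a ∉ qSpiral q a')
    (h2 : a ∉ qSpiral q a'') (hlam0 : lam ≠ 0) (hx0 : x ≠ 0)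
    (hz : ‖q * b / (a * a' * a'' * x)‖ < 1) :
    HasSum (fun n : ℤ => (a ^ n)⁻¹ * inftySeries q a a' a'' b
        (b * q / (a' * a'') / lam * (q ^ n)⁻¹) * gaussPow q n * (lam / x) ^ n)
      (qTheta q (a * q * x / lam) * phi32 q a a' a'' b (q * b / (a * a' * a'' * x))) := by
  obtain ⟨C, -, hC⟩ := exists_norm_hyp32Coeff_le (α := a) (β := a * q / b) (γ := 0) hq
    (mul_div_mul_pow_ne_one hq0 h1 ha0') (mul_div_mul_pow_ne_one hq0 h2 ha0'')
  set z := q * b / (a * a' * a'' * x) with hzdef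
  set w := lam / (a * x) with hw
  have hw0 : w ≠ 0 := div_ne_zero hlam0 (mul_ne_zero ha0 hx0)
  have h := hasSum_shear (fun m : ℕ => -(m : ℤ)) (summable_theta hq0 hq w)
    (summable_norm_mul_pow_of_bounded hC hz)
  have hθ : qTheta q (a * q * x / lam) = ∑' n : ℤ, gaussPow q n * w ^ n := by
    rw [← qTheta_eq, show a * q * x / lam = q * (a * x / lam) by ring, ← qTheta_inv hq0, inv_div]
  rw [(hasSum_phi32 b hq0 hq ha0' ha0'' h1 h2 hz).tsum_eq.symm, hθ]
  refine h.congr_fun fun n => ?_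
  have hyz : b * q / (a' * a'') / lam * w = z := by
    rw [hw, hzdef]; field_simp
  have hlx : lam / x = a * w := by rw [hw]; field_simp
  rw [inftySeries, ← tsum_mul_left, ← tsum_mul_right, ← tsum_mul_right]
  refine tsum_congr fun m => ?_
  have hg : gaussPow q (-(m : ℤ)) = gaussPow q (m + 1) := by
    rw [← gaussPow_one_sub]; congr 1; ring
  have hqq : q ^ (n * -(m : ℤ)) = ((q ^ n)⁻¹) ^ m := by
    rw [zpow_mul, zpow_neg, zpow_natCast, inv_pow]
  rw [gaussPow_add hq0, hg, hqq, zpow_add₀ hw0, zpow_neg, zpow_natCast, ← hyz, mul_pow, mul_pow,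
    inftyCoeff, hlx, mul_zpow]
  have han := zpow_ne_zero n ha0
  have hwm := pow_ne_zero m hw0
  field_simp

theorem f31_eq_div {q a a' a'' b lam x : ℂ} (hq0 : q ≠ 0) (hlam0 : lam ≠ 0) (hx0 : x ≠ 0) :
    f31 q a a' a'' b lam x =
      (∑' n : ℤ, borel31Fun q a a' a'' b (lam * q ^ n) * gaussPow q n * (lam / x) ^ n) /
        qTheta q (lam / x) := by
  rw [f31, qLaplace, ← tsum_div_const]
  exact tsum_congr fun n => qLaplaceTerm_eq hq0 hlam0 hx0 _ n

theorem qTheta_div_ne_zero {q lam x : ℂ} (hq0 : q ≠ 0) (hq : ‖q‖ < 1) (hlam0 : lam ≠ 0)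
    (hx0 : x ≠ 0) (hx : x ∉ qSpiral q (-lam)) : qTheta q (lam / x) ≠ 0 := fun h =>
  hx (mem_qSpiral_of_div_mem hq0 hx0 ((qTheta_eq_zero_iff hq0 hq (div_ne_zero hlam0 hx0)).1 h))

theorem analyticOnNhd_f31 {q a a' a'' b lam : ℂ} (hq0 : q ≠ 0) (hq : ‖q‖ < 1)
    (ha0 : a ≠ 0) (ha0' : a' ≠ 0) (ha0'' : a'' ≠ 0) (hb0 : b ≠ 0) (hb : ∀ k : ℕ, b * q ^ k ≠ 1)
    (h1 : a ∉ qSpiral q a') (h2 : a ∉ qSpiral q a'') (h3 : a' ∉ qSpiral q a'')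
    (hlam0 : lam ≠ 0) (hlam : lam ∉ qSpiral q (-1)) :
    AnalyticOnNhd ℂ (f31 q a a' a'' b lam) {x | x ≠ 0 ∧ x ∉ qSpiral q (-lam)} := by
  rintro x ⟨hx0, hx⟩
  have hdiv : AnalyticAt ℂ (fun x : ℂ => lam / x) x := analyticAt_const.div analyticAt_id hx0
  have hl0 := div_ne_zero hlam0 hx0
  have e1 := (analyticAt_laurent (fun y _ => summable_borel_laurent hq0 hq ha0 ha0' ha0'' hb0 hb h1 h2
    h3 hlam0 hlam y) hl0).comp (f := fun x : ℂ => lam / x) hdiv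
  have e2 := (analyticAt_qTheta hq0 hq hl0).comp (f := fun x : ℂ => lam / x) hdiv
  refine (e1.div e2 (qTheta_div_ne_zero hq0 hq hlam0 hx0 hx)).congr ?_
  filter_upwards [isOpen_compl_singleton.mem_nhds hx0] with y hy
  exact (f31_eq_div hq0 hlam0 hy).symm

/-! ### The connection formula, first for large `|x|`, then by continuation. -/

/-- The `j`-th term of the connection formula, with the theta quotients of the connection
coefficient and of the solution at infinity cancelled. -/
noncomputable def connTerm (q a a' a'' b lam x : ℂ) : ℂ :=
  spiralConst q a a' a'' b lam * (qTheta q (a * q * x / lam) / qTheta q (lam / x)) *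
    phi32 q a a' a'' b (q * b / (a * a' * a'' * x))

/-- Points of `[-λ;q]` may be admitted: there `θ(λ/x) = 0`, and with division by zero equal to zero
both sides vanish. -/
theorem f31_eq_of_norm_lt {q a a' a'' b lam x : ℂ} (hq0 : q ≠ 0) (hq : ‖q‖ < 1)
    (ha0 : a ≠ 0) (ha0' : a' ≠ 0) (ha0'' : a'' ≠ 0) (hb0 : b ≠ 0) (hb : ∀ k : ℕ, b * q ^ k ≠ 1)
    (h1 : a ∉ qSpiral q a') (h2 : a ∉ qSpiral q a'') (h3 : a' ∉ qSpiral q a'')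
    (hlam0 : lam ≠ 0) (hlam : lam ∉ qSpiral q (-1)) (hx0 : x ≠ 0)
    (hz : ‖q * b / (a * a' * a'' * x)‖ < 1) :
    f31 q a a' a'' b lam x = connTerm q a a' a'' b lam x + connTerm q a' a a'' b lam x +
      connTerm q a'' a' a b lam x := by
  have s1 := (hasSum_spiral_laurent (b := b) hq0 hq ha0 ha0' ha0'' h1 h2 hlam0 hx0 hz).mul_left
    (spiralConst q a a' a'' b lam)
  have s2 := (hasSum_spiral_laurent (b := b) hq0 hq ha0' ha0 ha0'' (not_mem_qSpiral_comm hq0 h1) h3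
    hlam0 hx0 (by rwa [mul_comm a' a])).mul_left (spiralConst q a' a a'' b lam)
  have s3 := (hasSum_spiral_laurent (b := b) hq0 hq ha0'' ha0' ha0 (not_mem_qSpiral_comm hq0 h3)
    (not_mem_qSpiral_comm hq0 h2) hlam0 hx0
    (by rwa [show a'' * a' * a = a * a' * a'' by ring])).mul_left (spiralConst q a'' a' a b lam)
  have s := (s1.add s2).add s3
  have key := (s.congr_fun fun n => (by
    rw [borel31Fun_mul_zpow hq0 hq ha0 ha0' ha0'' hb0 hb h1 h2 h3 hlam0 hlam]
    ring : borel31Fun q a a' a'' b (lam * q ^ n) * gaussPow q n * (lam / x) ^ n = _)).tsum_eq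
  rw [f31_eq_div hq0 hlam0 hx0, key, connTerm, connTerm, connTerm]
  ring

theorem f31_eq_connTerm {q a a' a'' b lam x : ℂ} (hq0 : q ≠ 0) (hq : ‖q‖ < 1)
    (ha0 : a ≠ 0) (ha0' : a' ≠ 0) (ha0'' : a'' ≠ 0) (hb0 : b ≠ 0) (hb : ∀ k : ℕ, b * q ^ k ≠ 1)
    (h1 : a ∉ qSpiral q a') (h2 : a ∉ qSpiral q a'') (h3 : a' ∉ qSpiral q a'')
    (hlam0 : lam ≠ 0) (hlam : lam ∉ qSpiral q (-1)) (hx0 : x ≠ 0) (hx : x ∉ qSpiral q (-lam))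
    (hz : q * b / (a * a' * a'' * x) ∈ qSlitPlane q 1) :
    f31 q a a' a'' b lam x = connTerm q a a' a'' b lam x + connTerm q a' a a'' b lam x +
      connTerm q a'' a' a b lam x := by
  have h1' := not_mem_qSpiral_comm hq0 h1
  have h2' := not_mem_qSpiral_comm hq0 h2
  have h3' := not_mem_qSpiral_comm hq0 h3
  set U : Set ℂ := {x | x ≠ 0 ∧ x ∉ qSpiral q (-lam) ∧
    q * b / (a * a' * a'' * x) ∈ qSlitPlane q 1} with hU
  have hUc : Uᶜ.Countable := by
    refine (((Set.countable_singleton (0 : ℂ)).union (countable_qSpiral q (-lam))).union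
      (Set.countable_range fun k : ℕ => q * b * q ^ k / (a * a' * a''))).mono ?_
    intro t ht
    by_cases t0 : t = 0
    · exact Or.inl (Or.inl t0)
    by_cases t1 : t ∈ qSpiral q (-lam)
    · exact Or.inl (Or.inr t1)
    · have t2 : ¬ q * b / (a * a' * a'' * t) ∈ qSlitPlane q 1 := fun t2 => ht ⟨t0, t1, t2⟩
      simp only [qSlitPlane, Set.mem_ofPred_eq, not_forall, not_not] at t2
      obtain ⟨k, hk⟩ := t2
      refine Or.inr ⟨k, ?_⟩
      field_simp at hk ⊢
      exact hk
  have hl : AnalyticOnNhd ℂ (f31 q a a' a'' b lam) U := fun t ht =>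
    analyticOnNhd_f31 hq0 hq ha0 ha0' ha0'' hb0 hb h1 h2 h3 hlam0 hlam t ⟨ht.1, ht.2.1⟩
  have hterm : ∀ {x y w : ℂ}, x ≠ 0 → y ≠ 0 → w ≠ 0 → x ∉ qSpiral q y → x ∉ qSpiral q w →
      x * y * w = a * a' * a'' → AnalyticOnNhd ℂ (connTerm q x y w b lam) U := by
    intro x y w hx hy hw hxy hxw hxyw t ht
    have d1 : AnalyticAt ℂ (fun t : ℂ => lam / t) t := analyticAt_const.div analyticAt_id ht.1
    have d2 : AnalyticAt ℂ (fun t : ℂ => q * b / (x * y * w * t)) t :=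
      analyticAt_const.div (by fun_prop)
        (mul_ne_zero (mul_ne_zero (mul_ne_zero hx hy) hw) ht.1)
    have e1 : AnalyticAt ℂ (fun t => qTheta q (x * q * t / lam)) t :=
      (analyticAt_qTheta hq0 hq (div_ne_zero (mul_ne_zero (mul_ne_zero hx hq0) ht.1) hlam0)).comp
        (f := fun t => x * q * t / lam) (by fun_prop)
    have e2 := (analyticAt_qTheta hq0 hq (div_ne_zero hlam0 ht.1)).comp
      (f := fun t : ℂ => lam / t) d1
    have e3 := ((isContinuation_phi32 b hq0 hq hy hw hxy hxw).analytic _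
      (by rw [hxyw]; exact ht.2.2 : q * b / (x * y * w * t) ∈ qSlitPlane q 1)).comp
      (f := fun t : ℂ => q * b / (x * y * w * t)) d2
    exact (analyticAt_const.mul (e1.div e2 (qTheta_div_ne_zero hq0 hq hlam0 ht.1 ht.2.1))).mul e3
  have hr := ((hterm ha0 ha0' ha0'' h1 h2 rfl).add (hterm ha0' ha0 ha0'' h1' h3 (by ring))).add
    (hterm ha0'' ha0' ha0 h3' h2' (by ring))
  -- For `|x| > r` the argument of `₃φ₂` lies in the unit disc, and the dense set `U` meets this
  -- region.
  set r : ℝ := ‖q * b / (a * a' * a'')‖ with hrdef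
  have hO : IsOpen {t : ℂ | r < ‖t‖} := isOpen_lt continuous_const continuous_norm
  have hne : {t : ℂ | r < ‖t‖}.Nonempty := ⟨((r + 1 : ℝ) : ℂ), by
    rw [Set.mem_ofPred_eq, Complex.norm_real, Real.norm_eq_abs,
      abs_of_pos (by have := norm_nonneg (q * b / (a * a' * a'')); linarith)]
    linarith⟩
  have hd : Dense U := by
    have := hUc.dense_compl ℂ
    rwa [compl_compl] at this
  obtain ⟨x₀, hx₀, hx₀U⟩ := hd.inter_open_nonempty _ hO hne
  refine hl.eqOn_of_preconnected_of_eventuallyEq hr (isPreconnected_of_countable_compl hUc) hx₀U ?_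
    ⟨hx0, hx, hz⟩
  filter_upwards [hO.mem_nhds hx₀] with t ht
  have ht0 : 0 < ‖t‖ := (norm_nonneg _).trans_lt ht
  refine f31_eq_of_norm_lt hq0 hq ha0 ha0' ha0'' hb0 hb h1 h2 h3 hlam0 hlam (norm_pos_iff.1 ht0) ?_
  rw [← div_div, norm_div]
  exact (div_lt_one ht0).2 ht

/-- The factors `θ(x)/θ(ax)` and `θ(ax)/θ(x)` cancel, and `θ(qx/λ) = θ(λ/x)`. -/
theorem connCoeff_mul_vInf {q a a' a'' b lam x : ℂ} (hq0 : q ≠ 0)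
    (hx : qTheta q x ≠ 0) (hax : qTheta q (a * x) ≠ 0) :
    connCoeff q a a' a'' b lam x * vInf q a a' a'' b x = connTerm q a a' a'' b lam x := by
  have e : qTheta q (lam / x) = qTheta q (q * x / lam) := by
    rw [show q * x / lam = q * (x / lam) by ring, ← qTheta_inv hq0, inv_div]
  have h : qTheta q x / qTheta q (a * x) * (qTheta q (a * x) / qTheta q x) = 1 := by field_simp
  rw [connTerm, e, spiralConst, connConst, connCoeff, vInf]
  linear_combination (qPochInf q a' * qPochInf q a'' * qPochInf q (b / a) /
    (qPochInf q b * qPochInf q (a' / a) * qPochInf q (a'' / a)) *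
    (qTheta q (a * lam) / qTheta q lam) *
    (qTheta q (a * q * x / lam) / qTheta q (q * x / lam)) *
    phi32 q a a' a'' b (q * b / (a * a' * a'' * x))) * h

/-! ### Ellipticity of the coefficients and assembly of the theorem. -/

/-- Under `x ↦ qx` the quotient in `x/λ` gains `1/a` and the quotient `θ(x)/θ(ax)` gains `a`. -/
theorem isQElliptic_connCoeff {q a lam : ℂ} (a' a'' b : ℂ) (hq0 : q ≠ 0) (hq : ‖q‖ < 1)
    (ha0 : a ≠ 0) (hlam0 : lam ≠ 0) : IsQElliptic q (connCoeff q a a' a'' b lam) := by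
  constructor
  · intro x hx
    have hx0 : x ≠ 0 := hx
    have h : ∀ c : ℂ, c ≠ 0 → MeromorphicAt (fun x => qTheta q (c * x)) x := fun c hc =>
      ((analyticAt_qTheta hq0 hq (mul_ne_zero hc hx0)).comp (f := fun x => c * x)
        (by fun_prop)).meromorphicAt
    have h' : ∀ c : ℂ, c ≠ 0 → MeromorphicAt (fun x => qTheta q (c * x / lam)) x := fun c hc =>
      ((analyticAt_qTheta hq0 hq (div_ne_zero (mul_ne_zero hc hx0) hlam0)).comp
        (f := fun x => c * x / lam) (by fun_prop)).meromorphicAt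
    exact ((MeromorphicAt.const _ _).mul ((h' (a * q) (mul_ne_zero ha0 hq0)).div (h' q hq0))).mul
      ((analyticAt_qTheta hq0 hq hx0).meromorphicAt.div (h a ha0))
  · intro x hx
    rw [connCoeff, connCoeff, show a * q * (q * x) / lam = q * (a * q * x / lam) by ring,
      show q * (q * x) / lam = q * (q * x / lam) by ring,
      show a * (q * x) = q * (a * x) by ring, qTheta_mul_left hq0 hx,
      qTheta_mul_left hq0 (mul_ne_zero ha0 hx),
      qTheta_mul_left hq0 (div_ne_zero (mul_ne_zero (mul_ne_zero ha0 hq0) hx) hlam0),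
      qTheta_mul_left hq0 (div_ne_zero (mul_ne_zero hq0 hx) hlam0), div_div_div_comm,
      div_div_div_comm (qTheta q x)]
    have e1 : a * q * x / lam / (q * x / lam) = a := by field_simp
    have e2 : x / (a * x) = a⁻¹ := by field_simp
    rw [e1, e2]
    generalize qTheta q (a * q * x / lam) / qTheta q (q * x / lam) = A
    generalize qTheta q x / qTheta q (a * x) = B
    field_simp

theorem thirdOrderOp_comm {q a a' a'' b : ℂ} {u : ℂ → ℂ} {x : ℂ} :
    thirdOrderOp q a' a a'' b u x = thirdOrderOp q a a' a'' b u x ∧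
      thirdOrderOp q a'' a' a b u x = thirdOrderOp q a a' a'' b u x := by
  constructor <;> (unfold thirdOrderOp; ring)

theorem theorem3p2 (q a₁ a₂ a₃ b₁ lam : ℂ)
    (hq0 : q ≠ 0) (hq1 : ‖q‖ < 1)
    (ha₁ : a₁ ≠ 0) (ha₂ : a₂ ≠ 0) (ha₃ : a₃ ≠ 0) (hb₁ : b₁ ≠ 0)
    -- the denominators `(b₁;q)_n` do not vanish
    (hb : ∀ k : ℕ, b₁ * q ^ k ≠ 1)
    -- no quotient `a_i / a_j` with `i ≠ j` is an integer power of `q`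
    (h12 : a₁ ∉ qSpiral q a₂) (h13 : a₁ ∉ qSpiral q a₃) (h23 : a₂ ∉ qSpiral q a₃)
    (hlam0 : lam ≠ 0) (hlam : lam ∉ qSpiral q (-1)) :
    -- the functions in the formula exist
    IsContinuation (borel31 q a₁ a₂ a₃ b₁) (qSlitPlane q (-1)) (borel31Fun q a₁ a₂ a₃ b₁) ∧
    IsContinuation (series32 q a₁ a₂ a₃ b₁) (qSlitPlane q 1) (phi32 q a₁ a₂ a₃ b₁) ∧
    IsContinuation (series32 q a₂ a₁ a₃ b₁) (qSlitPlane q 1) (phi32 q a₂ a₁ a₃ b₁) ∧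
    IsContinuation (series32 q a₃ a₂ a₁ b₁) (qSlitPlane q 1) (phi32 q a₃ a₂ a₁ b₁) ∧
    -- the `q`-Laplace transform converges and is analytic on the whole of `ℂ* \ [-λ;q]`
    (∀ x : ℂ, x ≠ 0 → x ∉ qSpiral q (-lam) →
      Summable (qLaplaceTerm q lam (borel31Fun q a₁ a₂ a₃ b₁) x)) ∧
    AnalyticOnNhd ℂ (f31 q a₁ a₂ a₃ b₁ lam) {x | x ≠ 0 ∧ x ∉ qSpiral q (-lam)} ∧
    -- the connection formula, wherever all the factors on the right are defined
    (∀ x : ℂ, x ∉ qSpiral q (-lam) → x ∈ regularPts q a₁ a₂ a₃ b₁ →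
      qTheta q (a₁ * x) ≠ 0 → qTheta q (a₂ * x) ≠ 0 → qTheta q (a₃ * x) ≠ 0 →
      f31 q a₁ a₂ a₃ b₁ lam x =
        connCoeff q a₁ a₂ a₃ b₁ lam x * vInf q a₁ a₂ a₃ b₁ x +
        connCoeff q a₂ a₁ a₃ b₁ lam x * vInf q a₂ a₁ a₃ b₁ x +
        connCoeff q a₃ a₂ a₁ b₁ lam x * vInf q a₃ a₂ a₁ b₁ x) ∧
    -- `v₁`, `v₂`, `v₃` solve the `q`-difference equation of `₃φ₁`
    (∀ x : ℂ, x ∈ regularPts q a₁ a₂ a₃ b₁ → q ^ 3 * x ∈ regularPts q a₁ a₂ a₃ b₁ →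
      thirdOrderOp q a₁ a₂ a₃ b₁ (vInf q a₁ a₂ a₃ b₁) x = 0 ∧
      thirdOrderOp q a₁ a₂ a₃ b₁ (vInf q a₂ a₁ a₃ b₁) x = 0 ∧
      thirdOrderOp q a₁ a₂ a₃ b₁ (vInf q a₃ a₂ a₁ b₁) x = 0) ∧
    -- the connection coefficients are `q`-elliptic
    IsQElliptic q (connCoeff q a₁ a₂ a₃ b₁ lam) ∧
    IsQElliptic q (connCoeff q a₂ a₁ a₃ b₁ lam) ∧
    IsQElliptic q (connCoeff q a₃ a₂ a₁ b₁ lam) := by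
  have h21 := not_mem_qSpiral_comm hq0 h12
  have h31 := not_mem_qSpiral_comm hq0 h13
  have h32 := not_mem_qSpiral_comm hq0 h23
  refine ⟨isContinuation_borel31Fun a₁ a₂ a₃ hq0 hq1 hb,
    isContinuation_phi32 b₁ hq0 hq1 ha₂ ha₃ h12 h13, isContinuation_phi32 b₁ hq0 hq1 ha₁ ha₃ h21 h23,
    isContinuation_phi32 b₁ hq0 hq1 ha₂ ha₁ h32 h31, fun x hx0 _ => ?_,
    analyticOnNhd_f31 hq0 hq1 ha₁ ha₂ ha₃ hb₁ hb h12 h13 h23 hlam0 hlam,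
    fun x hx hreg hx1 hx2 hx3 => ?_, fun x hreg hreg3 => ?_,
    isQElliptic_connCoeff a₂ a₃ b₁ hq0 hq1 ha₁ hlam0, isQElliptic_connCoeff a₁ a₃ b₁ hq0 hq1 ha₂ hlam0,
    isQElliptic_connCoeff a₂ a₁ b₁ hq0 hq1 ha₃ hlam0⟩
  · refine ((summable_borel_laurent hq0 hq1 ha₁ ha₂ ha₃ hb₁ hb h12 h13 h23 hlam0 hlam
      (lam / x)).of_norm.div_const (qTheta q (lam / x))).congr fun n => ?_
    rw [qLaplaceTerm_eq hq0 hlam0 hx0]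
  · obtain ⟨hx0, hθ, hz⟩ := hreg
    rw [connCoeff_mul_vInf hq0 hθ hx1, connCoeff_mul_vInf hq0 hθ hx2, connCoeff_mul_vInf hq0 hθ hx3]
    exact f31_eq_connTerm hq0 hq1 ha₁ ha₂ ha₃ hb₁ hb h12 h13 h23 hlam0 hlam hx0 hx hz
  · have hx0 := hreg.1
    have hz := hreg3.2.2
    refine ⟨thirdOrderOp_vInf hq0 hq1 ha₁ ha₂ ha₃ hb₁ h12 h13 hx0 hz, ?_, ?_⟩
    · rw [← thirdOrderOp_comm.1]
      exact thirdOrderOp_vInf hq0 hq1 ha₂ ha₁ ha₃ hb₁ h21 h23 hx0 (by rwa [mul_comm a₂ a₁])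
    · rw [← thirdOrderOp_comm.2]
      exact thirdOrderOp_vInf hq0 hq1 ha₃ ha₂ ha₁ hb₁ h32 h31 hx0
        (by rwa [show a₃ * a₂ * a₁ = a₁ * a₂ * a₃ by ring])
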